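/- Work over $\mathbb C$. Identify plane curves of degree $4$ in $\mathbb P^2$ with points of $\mathbb P^{14}=\mathbb P(\mathbb C[x,y,z]_4)$, the projective space of nonzero quartic forms up to scalars, equipped with its Zariski topology. A curve $\{F=0\}$ is integral if $F$ is irreducible, and an integral curve is rational if its normalization is isomorphic to $\mathbb P^1$ (equivalently, it has geometric genus $0$; equivalently, its function field is isomorphic to $\mathbb C(t)$ over $\mathbb C$). Let $Y\subset\mathbb P^2$ be a set of four distinct points lying on a line, and let $R_Y\subset\mathbb P^{14}$ be the set of integral rational plane curves of degree $4$ that contain $Y$, with the topology induced from $\mathbb P^{14}$. Then $R_Y$ is (nonempty and) irreducible, of dimension $7$. -/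

import Mathlib

open scoped LinearAlgebra.Projectivization

noncomputable section

/-! ### The Zariski topology on a projective space over a field -/

/-- The zero locus in the projective space `ℙ K (ι → K)` of a set `S` of polynomials. It is only
used for sets of homogeneous polynomials, where the choice of representatives is irrelevant. -/
def projZeroLocus {K ι : Type*} [Field K] (S : Set (MvPolynomial ι K)) : Set (ℙ K (ι → K)) :=
  {P | ∀ f ∈ S, MvPolynomial.eval P.rep f = 0}

/-- A subset of projective space is algebraic if it is the common zero locus of a set of
homogeneous polynomials (of possibly different degrees). -/
def IsProjAlgebraic {K ι : Type*} [Field K] (Z : Set (ℙ K (ι → K))) : Prop :=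
  ∃ S : Set (MvPolynomial ι K), (∀ f ∈ S, ∃ n : ℕ, f.IsHomogeneous n) ∧ Z = projZeroLocus S

/-- The Zariski topology on projective space: the closed sets are the algebraic sets. -/
instance projZariskiTopology {K ι : Type*} [Field K] : TopologicalSpace (ℙ K (ι → K)) :=
  TopologicalSpace.ofClosed {Z | IsProjAlgebraic Z}
    ⟨{1}, by
      rintro f rfl
      exact ⟨0, MvPolynomial.isHomogeneous_one ι K⟩, by
      ext P
      simp [projZeroLocus]⟩
    (by
      intro A hA
      refine ⟨{f | ∃ n : ℕ, f.IsHomogeneous n ∧ ∃ Z ∈ A, ∀ P ∈ Z, MvPolynomial.eval P.rep f = 0},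
        fun f hf => ⟨hf.choose, hf.choose_spec.1⟩, ?_⟩
      ext P
      constructor
      · rintro hP f ⟨n, -, Z, hZ, hf⟩
        exact hf P (hP Z hZ)
      · intro hP Z hZ
        obtain ⟨S, hS, rfl⟩ := hA hZ
        intro f hf
        obtain ⟨n, hn⟩ := hS f hf
        exact hP f ⟨n, hn, _, hZ, fun Q hQ => hQ f hf⟩)
    (by
      rintro _ ⟨S, hS, rfl⟩ _ ⟨T, hT, rfl⟩
      refine ⟨{h | ∃ f ∈ S, ∃ g ∈ T, h = f * g}, ?_, ?_⟩
      · rintro _ ⟨f, hf, g, hg, rfl⟩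
        obtain ⟨m, hm⟩ := hS f hf
        obtain ⟨n, hn⟩ := hT g hg
        exact ⟨m + n, hm.mul hn⟩
      · ext P
        constructor
        · rintro (h | h) _ ⟨f, hf, g, hg, rfl⟩
          · simp [h f hf]
          · simp [h g hg]
        · intro h
          by_contra hne
          simp only [Set.mem_union, not_or, projZeroLocus, Set.mem_ofPred_eq, not_forall] at hne
          obtain ⟨⟨f, hf, hf0⟩, g, hg, hg0⟩ := hne
          have := h (f * g) ⟨f, hf, g, hg, rfl⟩
          rw [map_mul, mul_eq_zero] at this
          exact this.elim hf0 hg0)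

theorem isClosed_iff_isProjAlgebraic {K ι : Type*} [Field K] (Z : Set (ℙ K (ι → K))) :
    IsClosed Z ↔ IsProjAlgebraic Z := by
  rw [← isOpen_compl_iff]
  change IsProjAlgebraic Zᶜᶜ ↔ _
  rw [compl_compl]

/-! ### Plane curves -/

/-- The projective plane over `ℂ`. -/
abbrev ProjPlane : Type := ℙ ℂ (Fin 3 → ℂ)

/-- Exponents of the monomials of degree `d` in three variables. -/
abbrev PlaneMonomial (d : ℕ) : Type := ↥(Finset.finsuppAntidiag (Finset.univ : Finset (Fin 3)) d)

/-- The projective space of plane curves of degree `d`, i.e. of nonzero ternary forms of degree `d`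
up to scalars, with the coefficients of the form as homogeneous coordinates. For `d = 4` it is
a 14-dimensional projective space. -/
abbrev PlaneCurve (d : ℕ) : Type := ℙ ℂ (PlaneMonomial d → ℂ)

/-- The ternary form with the given coefficients. -/
def ternaryForm {d : ℕ} (c : PlaneMonomial d → ℂ) : MvPolynomial (Fin 3) ℂ :=
  ∑ m : PlaneMonomial d, MvPolynomial.monomial m.1 (c m)

namespace PlaneCurve

variable {d : ℕ} (C : PlaneCurve d)

/-- An equation of the curve (well defined up to a nonzero scalar). -/
def equation : MvPolynomial (Fin 3) ℂ := ternaryForm C.rep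

/-- The homogeneous coordinate ring `ℂ[x₀, x₁, x₂] / (F)` of the curve `F = 0`. -/
abbrev CoordRing : Type := MvPolynomial (Fin 3) ℂ ⧸ Ideal.span {PlaneCurve.equation C}

/-- A plane curve `F = 0` is integral if its homogeneous coordinate ring is a domain, i.e. if `F`
generates a prime ideal (equivalently, `F` is irreducible). -/
def IsIntegral : Prop := IsDomain (PlaneCurve.CoordRing C)

/-- The function field of an integral plane curve `F = 0`: the field of fractions `f / g` with
`f`, `g` forms of the same degree and `g` not divisible by `F`, inside the fraction field of the
homogeneous coordinate ring. -/
def functionField [IsDomain (PlaneCurve.CoordRing C)] :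
    IntermediateField ℂ (FractionRing (PlaneCurve.CoordRing C)) where
  carrier := {x | ∃ (n : ℕ) (f g : MvPolynomial (Fin 3) ℂ), f.IsHomogeneous n ∧
    g.IsHomogeneous n ∧ (Ideal.Quotient.mk _ g : PlaneCurve.CoordRing C) ≠ 0 ∧
    x = algebraMap (PlaneCurve.CoordRing C) _ (Ideal.Quotient.mk _ f) /
      algebraMap (PlaneCurve.CoordRing C) _ (Ideal.Quotient.mk _ g)}
  mul_mem' := by
    rintro _ _ ⟨m, f, g, hf, hg, h0, rfl⟩ ⟨n, f', g', hf', hg', h0', rfl⟩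
    refine ⟨m + n, f * f', g * g', hf.mul hf', hg.mul hg', ?_, ?_⟩
    · rw [map_mul]
      exact mul_ne_zero h0 h0'
    · simp only [map_mul]
      rw [div_mul_div_comm]
  add_mem' := by
    rintro _ _ ⟨m, f, g, hf, hg, h0, rfl⟩ ⟨n, f', g', hf', hg', h0', rfl⟩
    refine ⟨m + n, f * g' + g * f', g * g', (hf.mul hg').add (hg.mul hf'), hg.mul hg', ?_, ?_⟩
    · rw [map_mul]
      exact mul_ne_zero h0 h0'
    · simp only [map_mul, map_add]
      rw [div_add_div]
      · simpa using h0
      · simpa using h0'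
  algebraMap_mem' := by
    intro r
    refine ⟨0, MvPolynomial.C r, 1, MvPolynomial.isHomogeneous_C _ r,
      MvPolynomial.isHomogeneous_one _ _, ?_, ?_⟩
    · rw [map_one]
      exact one_ne_zero
    · rw [map_one, map_one, div_one]
      rfl
  inv_mem' := by
    rintro _ ⟨n, f, g, hf, hg, h0, rfl⟩
    by_cases h : (Ideal.Quotient.mk _ f : PlaneCurve.CoordRing C) = 0
    · refine ⟨n, f, g, hf, hg, h0, ?_⟩
      rw [h]
      simp
    · exact ⟨n, g, f, hg, hf, h, by rw [inv_div]⟩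

/-- An integral plane curve is rational if it is birational to the projective line (i.e. its
normalization is isomorphic to the projective line): its function field is isomorphic, over `ℂ`,
to the field `ℂ(t)` of rational functions in one variable. -/
def IsRational : Prop :=
  ∃ _ : IsDomain (PlaneCurve.CoordRing C),
    Nonempty (PlaneCurve.functionField C ≃ₐ[ℂ] RatFunc ℂ)

/-- The curve passes through the point `P`. -/
def Contains (P : ProjPlane) : Prop := MvPolynomial.eval P.rep (PlaneCurve.equation C) = 0

end PlaneCurve

/-- The space `R_Y` of integral rational plane quartics that contain a finite set `Y` of (reduced)
points, as a subset of the projective space of all plane quartics. -/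
def integralRationalQuartics (Y : Set ProjPlane) : Set (PlaneCurve 4) :=
  {C | PlaneCurve.IsIntegral C ∧ PlaneCurve.IsRational C ∧ ∀ P ∈ Y, PlaneCurve.Contains C P}

end

/-! Choose linear coordinates `(u : v : w)` in which the four points are `(1 : ηᵢ : 0)` with
distinct `ηᵢ`. A rational quartic through them is traced by a degree-four map from the line. The
divisor `w = 0` pulls back to four parameters, and each `(1 : ηᵢ : 0)` must be hit, so there is one
simple pole `τᵢ` over each point. By partial fractions `u/w = a + ∑ μⱼ/(t - τⱼ)` and `v/w = b + ∑ ηⱼ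
μⱼ/(t - τⱼ)`, with all `μⱼ ≠ 0` (`exists_eq_rationalCurve_of_generates`).

The equation of such a curve is explicit. The vector with entries `1/(t - τⱼ)` lies in the kernel of
`diag(v - ηᵢ u) + w O` for a constant matrix `O` depending on `τ, μ, a, b`, so the curve lies on the
quartic given by the determinant (`pencil_rationalCurve`). Conversely, for distinct `τᵢ` and nonzero
`μᵢ` this determinant divides every form vanishing on the parametrized curve, by descent along
powers of `w` (`dvd_of_aeval_eq_zero`). Hence it defines an integral curve, whose function field
embeds in `ℂ(t)` and is rational by Lüroth's theorem.

The ten parameters `τ, μ, a, b` are redundant by the three-dimensional group of reparametrizations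
of the line. Moving the poles to a normal form and conjugating `O` by a diagonal matrix, which
leaves the determinant unchanged, gives a matrix polynomial in seven parameters
(`conj_rationalMatrix_eq_quarticMatrix`). So the set in question is the image of a nonempty
principal open subset of affine 7-space under a polynomial map
(`mem_integralRationalQuartics_iff_exists_parameter`).

Irreducibility is then immediate. The dimension is at most 7 because chains of irreducible closed
subsets give chains of primes in a finitely generated subalgebra of a polynomial ring in seven
variables (`topologicalKrullDim_le_of_polynomial`). It is at least 7 because seven polynomial
functions of the coefficients have a nonzero Jacobian determinant in the parameters
(`le_topologicalKrullDim_of_jacobian`, `det_jacobian_coordinateValue_ne_zero`). These functions are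
read off from the 1- and 2-jets of the quartic at the four points. -/

noncomputable section

/-! ### Zariski topology of projective space, through representatives normalized by a linear form -/

section ProjectiveTopology

variable {K ι : Type*} [Field K]

theorem MvPolynomial.IsHomogeneous.aeval_mul {R S : Type*} [CommRing R] [CommRing S] [Algebra R S]
    {f : MvPolynomial ι R} {n : ℕ} (hf : f.IsHomogeneous n) (s : S) (x : ι → S) :
    MvPolynomial.aeval (fun i => s * x i) f = s ^ n * MvPolynomial.aeval x f := by
  rw [MvPolynomial.aeval_def, MvPolynomial.aeval_def, MvPolynomial.eval₂_eq,
    MvPolynomial.eval₂_eq, Finset.mul_sum]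
  refine Finset.sum_congr rfl fun d hd => ?_
  rw [hf.degree_eq_sum_deg_support hd]
  simp only [mul_pow, Finset.prod_mul_distrib, Finset.prod_pow_eq_pow_sum]
  ring

theorem MvPolynomial.IsHomogeneous.eval_smul {R : Type*} [CommRing R] {f : MvPolynomial ι R}
    {n : ℕ} (hf : f.IsHomogeneous n) (s : R) (x : ι → R) :
    MvPolynomial.eval (s • x) f = s ^ n * MvPolynomial.eval x f := by
  have h := hf.aeval_mul s x
  rw [MvPolynomial.aeval_eq_eval] at h
  exact h

theorem eval_rep_mk_eq_zero_iff {f : MvPolynomial ι K} {n : ℕ} (hf : f.IsHomogeneous n)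
    (c : ι → K) (hc : c ≠ 0) :
    MvPolynomial.eval (Projectivization.mk K c hc).rep f = 0 ↔ MvPolynomial.eval c f = 0 := by
  obtain ⟨a, ha⟩ := Projectivization.exists_smul_eq_mk_rep K c hc
  rw [← ha, Units.smul_def, hf.eval_smul]
  simp

/-- The homogenization of a polynomial with respect to a linear form. -/
def homogenizeWith (l p : MvPolynomial ι K) : MvPolynomial ι K :=
  ∑ k ∈ Finset.range (p.totalDegree + 1),
    MvPolynomial.homogeneousComponent k p * l ^ (p.totalDegree - k)

theorem isHomogeneous_homogenizeWith {l : MvPolynomial ι K} (hl : l.IsHomogeneous 1)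
    (p : MvPolynomial ι K) : (homogenizeWith l p).IsHomogeneous p.totalDegree := by
  refine MvPolynomial.IsHomogeneous.sum _ _ _ fun k hk => ?_
  have h := (MvPolynomial.homogeneousComponent_isHomogeneous k p).mul
    (hl.pow (p.totalDegree - k))
  have e : k + 1 * (p.totalDegree - k) = p.totalDegree := by
    have := Finset.mem_range.1 hk
    omega
  rwa [e] at h

theorem eval_homogenizeWith {l : MvPolynomial ι K} (p : MvPolynomial ι K) {c : ι → K}
    (hc : MvPolynomial.eval c l = 1) :
    MvPolynomial.eval c (homogenizeWith l p) = MvPolynomial.eval c p := by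
  conv_rhs => rw [← MvPolynomial.sum_homogeneousComponent p]
  simp [homogenizeWith, hc]

theorem ne_zero_of_eval_eq_one {l : MvPolynomial ι K} (hl : l.IsHomogeneous 1) {c : ι → K}
    (hc : MvPolynomial.eval c l = 1) : c ≠ 0 := by
  rintro rfl
  have h : MvPolynomial.eval (0 : ι → K) l = 0 := by
    have := hl.eval_smul 0 0
    simpa using this
  rw [h] at hc
  exact zero_ne_one hc

/-- The polynomials that vanish at all normalized representatives of the points of a set. -/
def normalizedIdeal (l : MvPolynomial ι K) (Z : Set (ℙ K (ι → K))) : Ideal (MvPolynomial ι K) where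
  carrier := {p | ∀ (c : ι → K) (hc : c ≠ 0), MvPolynomial.eval c l = 1 →
    Projectivization.mk K c hc ∈ Z → MvPolynomial.eval c p = 0}
  zero_mem' := by simp
  add_mem' := by
    intro p q hp hq c hc h1 hZ
    rw [map_add, hp c hc h1 hZ, hq c hc h1 hZ, add_zero]
  smul_mem' := by
    intro p q hq c hc h1 hZ
    rw [smul_eq_mul, map_mul, hq c hc h1 hZ, mul_zero]

theorem isClosed_vanishing {f : MvPolynomial ι K} {n : ℕ} (hf : f.IsHomogeneous n) :
    IsClosed {P : ℙ K (ι → K) | MvPolynomial.eval P.rep f = 0} := by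
  rw [isClosed_iff_isProjAlgebraic]
  exact ⟨{f}, by rintro _ rfl; exact ⟨n, hf⟩, by ext; simp [projZeroLocus]⟩

theorem mk_mem_vanishing_homogenizeWith {l : MvPolynomial ι K} (hl : l.IsHomogeneous 1)
    (p : MvPolynomial ι K) {c : ι → K} (hc : c ≠ 0) (h1 : MvPolynomial.eval c l = 1) :
    Projectivization.mk K c hc ∈
      {P : ℙ K (ι → K) | MvPolynomial.eval P.rep (homogenizeWith l p) = 0} ↔
      MvPolynomial.eval c p = 0 := by
  rw [Set.mem_ofPred_eq, eval_rep_mk_eq_zero_iff (isHomogeneous_homogenizeWith hl p),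
    eval_homogenizeWith p h1]

theorem exists_normalized_rep {l : MvPolynomial ι K} (hl : l.IsHomogeneous 1)
    (P : ℙ K (ι → K)) (hP : MvPolynomial.eval P.rep l ≠ 0) :
    ∃ (c : ι → K) (hc : c ≠ 0), MvPolynomial.eval c l = 1 ∧ P = Projectivization.mk K c hc := by
  have h1 : MvPolynomial.eval ((MvPolynomial.eval P.rep l)⁻¹ • P.rep) l = 1 := by
    rw [hl.eval_smul, pow_one, inv_mul_cancel₀ hP]
  refine ⟨_, ne_zero_of_eval_eq_one hl h1, h1, ?_⟩
  conv_lhs => rw [← P.mk_rep]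
  rw [Projectivization.mk_eq_mk_iff']
  exact ⟨MvPolynomial.eval P.rep l, by rw [smul_smul, mul_inv_cancel₀ hP, one_smul]⟩

/-- The homogeneous equations of `W` vanish at all representatives of points of `A`, so they belong
to the ideal of `A`, hence to that of `B`. On `B` the linear form does not vanish, so normalized
representatives see every point. -/
theorem subset_of_normalizedIdeal_le {l : MvPolynomial ι K} (hl : l.IsHomogeneous 1)
    {A B W : Set (ℙ K (ι → K))} (hW : IsClosed W) (hA : A ⊆ W)
    (hB : ∀ P ∈ B, MvPolynomial.eval P.rep l ≠ 0)
    (h : normalizedIdeal l A ≤ normalizedIdeal l B) : B ⊆ W := by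
  obtain ⟨S, hS, rfl⟩ := (isClosed_iff_isProjAlgebraic W).1 hW
  intro P hP
  obtain ⟨c, hc, h1, rfl⟩ := exists_normalized_rep hl P (hB P hP)
  intro f hf
  obtain ⟨n, hn⟩ := hS f hf
  rw [eval_rep_mk_eq_zero_iff hn]
  exact h (fun c' hc' _ hmem => (eval_rep_mk_eq_zero_iff hn c' hc').1 (hA hmem f hf)) c hc h1 hP

/-- If `p * q` vanishes on `A`, the zero sets of the homogenizations of `p` and `q` are closed and
cover `A`, so irreducibility puts `A` inside one of them. -/
theorem isPrime_normalizedIdeal {l : MvPolynomial ι K} (hl : l.IsHomogeneous 1)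
    {A : Set (ℙ K (ι → K))} (hA : IsIrreducible A)
    (hA' : ∀ P ∈ A, MvPolynomial.eval P.rep l ≠ 0) : (normalizedIdeal l A).IsPrime := by
  refine ⟨?_, ?_⟩
  · intro h
    obtain ⟨P, hP⟩ := hA.nonempty
    obtain ⟨c, hc, h1, rfl⟩ := exists_normalized_rep hl P (hA' P hP)
    have := (h ▸ Submodule.mem_top : (1 : MvPolynomial ι K) ∈ normalizedIdeal l A) c hc h1 hP
    simp at this
  · intro p q hpq
    have hcov : A ⊆ {P | MvPolynomial.eval P.rep (homogenizeWith l p) = 0} ∪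
        {P | MvPolynomial.eval P.rep (homogenizeWith l q) = 0} := by
      intro P hP
      obtain ⟨c, hc, h1, rfl⟩ := exists_normalized_rep hl P (hA' P hP)
      have := hpq c hc h1 hP
      rw [map_mul, mul_eq_zero] at this
      exact this.imp (mk_mem_vanishing_homogenizeWith hl p hc h1).2
        (mk_mem_vanishing_homogenizeWith hl q hc h1).2
    refine ((isPreirreducible_iff_isClosed_union_isClosed.1 hA.isPreirreducible _ _
      (isClosed_vanishing (isHomogeneous_homogenizeWith hl p))
      (isClosed_vanishing (isHomogeneous_homogenizeWith hl q)) hcov)).imp ?_ ?_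
    all_goals
      intro h c hc h1 hmem
      exact (mk_mem_vanishing_homogenizeWith hl _ hc h1).1 (h hmem)

/-- The image of a nonempty principal open subset of an affine space under a polynomial map with
nonzero values is irreducible. -/
theorem isIrreducible_image_of_polynomial [Infinite K] {σ : Type*} (Φ : ι → MvPolynomial σ K)
    (d : MvPolynomial σ K) (hd : d ≠ 0)
    (hΦ : ∀ x, MvPolynomial.eval x d ≠ 0 → (fun i => MvPolynomial.eval x (Φ i)) ≠ 0) :
    IsIrreducible {P : ℙ K (ι → K) | ∃ x, ∃ hx : MvPolynomial.eval x d ≠ 0,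
      P = Projectivization.mk K (fun i => MvPolynomial.eval x (Φ i)) (hΦ x hx)} := by
  have key : ∀ p : MvPolynomial σ K, p ≠ 0 → ∃ x, MvPolynomial.eval x p ≠ 0 := by
    intro p hp
    by_contra! h
    exact hp (MvPolynomial.funext fun x => by rw [h x, map_zero])
  refine ⟨?_, ?_⟩
  · obtain ⟨x, hx⟩ := key d hd
    exact ⟨_, x, hx, rfl⟩
  · rw [isPreirreducible_iff_isClosed_union_isClosed]
    intro Z₁ Z₂ h₁ h₂ hcov
    obtain ⟨S₁, hS₁, rfl⟩ := (isClosed_iff_isProjAlgebraic Z₁).1 h₁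
    obtain ⟨S₂, hS₂, rfl⟩ := (isClosed_iff_isProjAlgebraic Z₂).1 h₂
    by_contra! hne
    obtain ⟨⟨_, ⟨x₁, hx₁, rfl⟩, hf⟩, ⟨_, ⟨x₂, hx₂, rfl⟩, hg⟩⟩ :=
      And.intro (Set.not_subset.1 hne.1) (Set.not_subset.1 hne.2)
    simp only [projZeroLocus, Set.mem_ofPred_eq, not_forall] at hf hg
    obtain ⟨f, hfS, hf0⟩ := hf
    obtain ⟨g, hgS, hg0⟩ := hg
    obtain ⟨m, hm⟩ := hS₁ f hfS
    obtain ⟨n, hn⟩ := hS₂ g hgS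
    rw [eval_rep_mk_eq_zero_iff hm] at hf0
    rw [eval_rep_mk_eq_zero_iff hn] at hg0
    have hb : ∀ (p : MvPolynomial ι K) (x : σ → K),
        MvPolynomial.eval x (MvPolynomial.bind₁ Φ p) =
          MvPolynomial.eval (fun i => MvPolynomial.eval x (Φ i)) p := by
      intro p x
      rw [← MvPolynomial.aeval_eq_eval, ← MvPolynomial.aeval_eq_eval, MvPolynomial.aeval_bind₁]
    have hf' : MvPolynomial.bind₁ Φ f ≠ 0 := by
      intro h
      rw [← hb, h, map_zero] at hf0
      exact hf0 rfl
    have hg' : MvPolynomial.bind₁ Φ g ≠ 0 := by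
      intro h
      rw [← hb, h, map_zero] at hg0
      exact hg0 rfl
    obtain ⟨x, hx⟩ := key _ (mul_ne_zero hd (mul_ne_zero hf' hg'))
    rw [map_mul, map_mul, hb, hb] at hx
    have hxd := left_ne_zero_of_mul hx
    have hx' := right_ne_zero_of_mul hx
    rcases hcov ⟨x, hxd, rfl⟩ with h | h
    · exact left_ne_zero_of_mul hx' ((eval_rep_mk_eq_zero_iff hm _ _).1 (h f hfS))
    · exact right_ne_zero_of_mul hx' ((eval_rep_mk_eq_zero_iff hn _ _).1 (h g hgS))

end ProjectiveTopology

/-! ### Krull dimension: upper bound by a subalgebra of a polynomial ring, lower bound by a chain -/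

section Dimension

variable {K ι : Type*} [Field K]

/-- Incomparability: along an integral homomorphism, contraction of primes is strictly monotone. -/
theorem ringKrullDim_le_of_injective_of_isIntegral {R S : Type*} [CommRing R] [CommRing S]
    (f : R →+* S) (hf : f.IsIntegral) : ringKrullDim S ≤ ringKrullDim R := by
  refine Order.krullDim_le_of_strictMono (fun p => PrimeSpectrum.comap f p) ?_
  intro p q hpq
  refine lt_of_le_of_ne (Ideal.comap_mono hpq.le) fun h => ?_
  algebraize [f]
  obtain ⟨x, hxq, hxp⟩ := SetLike.exists_of_lt (PrimeSpectrum.asIdeal_lt_asIdeal p q |>.2 hpq)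
  have := Ideal.comap_lt_comap_of_integral_mem_sdiff (R := R) (I := p.asIdeal) (J := q.asIdeal) hpq.le ⟨hxq, hxp⟩ (hf x)
  exact this.ne congr(($h).asIdeal)

/-- The Krull dimension of a finitely generated algebra which is a subalgebra of a polynomial ring
in `n` variables is at most `n`. -/
theorem ringKrullDim_le_of_injective_mvPolynomial {A : Type*} [CommRing A] [Algebra K A]
    [Algebra.FiniteType K A] {n : ℕ} (f : A →ₐ[K] MvPolynomial (Fin n) K)
    (hf : Function.Injective f) : ringKrullDim A ≤ n := by
  have : Nontrivial A := f.toRingHom.domain_nontrivial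
  -- Noether normalization: `A` is integral over a polynomial ring in `s` variables, and comparing
  -- transcendence degrees gives `s ≤ n`.
  obtain ⟨s, g, hg, hint⟩ := exists_integral_inj_algHom_of_fg K A
  refine (ringKrullDim_le_of_injective_of_isIntegral _ hint).trans ?_
  rw [MvPolynomial.ringKrullDim_of_isNoetherianRing, ringKrullDim_eq_zero_of_field]
  have := lift_trdeg_le_of_injective (f.comp g) (hf.comp hg)
  rw [MvPolynomial.trdeg_of_isDomain, MvPolynomial.trdeg_of_isDomain] at this
  simpa using this

/-- The ideal of an irreducible closed subset of `R` is prime and contains every relation among the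
`Φ i`, so it descends to a prime of the algebra generated by the `Φ i`. This assignment is strictly
order-reversing, since a closed subset of `R` is recovered from its ideal. -/
theorem topologicalKrullDim_le_of_polynomial [Finite ι] {l : MvPolynomial ι K}
    (hl : l.IsHomogeneous 1) {R : Set (ℙ K (ι → K))}
    (hR : ∀ P ∈ R, MvPolynomial.eval P.rep l ≠ 0) {n : ℕ}
    (Φ : ι → MvPolynomial (Fin n) K)
    (hΦ : ∀ (c : ι → K) (hc : c ≠ 0), MvPolynomial.eval c l = 1 →
      Projectivization.mk K c hc ∈ R → ∃ x, c = fun i => MvPolynomial.eval x (Φ i)) :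
    topologicalKrullDim R ≤ n := by
  let φ := (MvPolynomial.aeval (R := K) Φ).rangeRestrict
  have hφ : Function.Surjective φ := AlgHom.rangeRestrict_surjective _
  have hft : Algebra.FiniteType K (MvPolynomial.aeval (R := K) Φ).range :=
    Algebra.FiniteType.of_surjective φ hφ
  refine le_trans ?_ (ringKrullDim_le_of_injective_mvPolynomial
    (MvPolynomial.aeval (R := K) Φ).range.val Subtype.val_injective)
  have himg : ∀ Z : TopologicalSpace.IrreducibleCloseds R,
      ∀ P ∈ Subtype.val '' (Z : Set R), MvPolynomial.eval P.rep l ≠ 0 := by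
    rintro Z _ ⟨P, -, rfl⟩
    exact hR P P.2
  have hprime : ∀ Z : TopologicalSpace.IrreducibleCloseds R,
      (normalizedIdeal l (Subtype.val '' (Z : Set R))).IsPrime := fun Z =>
    isPrime_normalizedIdeal hl (Z.isIrreducible.image _ continuous_subtype_val.continuousOn)
      (himg Z)
  have hker : ∀ Z : TopologicalSpace.IrreducibleCloseds R,
      RingHom.ker φ ≤ normalizedIdeal l (Subtype.val '' (Z : Set R)) := by
    rintro Z p hp c hc h1 ⟨P, -, hP⟩
    obtain ⟨x, rfl⟩ := hΦ c hc h1 (hP ▸ P.2)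
    have hp' : MvPolynomial.aeval (R := K) Φ p = 0 := congrArg Subtype.val hp
    have := congrArg (MvPolynomial.aeval (R := K) x) hp'
    rw [MvPolynomial.comp_aeval_apply] at this
    simpa [MvPolynomial.aeval_eq_eval] using this
  have hcm : ∀ Z : TopologicalSpace.IrreducibleCloseds R,
      ((normalizedIdeal l (Subtype.val '' (Z : Set R))).map φ).comap φ =
        normalizedIdeal l (Subtype.val '' (Z : Set R)) := fun Z =>
    by
    rw [Ideal.comap_map_of_surjective φ hφ, sup_eq_left]
    exact hker Z
  rw [topologicalKrullDim, ringKrullDim, ← Order.krullDim_orderDual (α := PrimeSpectrum _)]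
  refine Order.krullDim_le_of_strictMono (fun Z => OrderDual.toDual
    ⟨(normalizedIdeal l (Subtype.val '' (Z : Set R))).map φ,
      have := hprime Z
      Ideal.map_isPrime_of_surjective hφ (hker Z)⟩) ?_
  intro Z Z' hZ
  refine lt_of_le_of_ne ?_ ?_
  · exact Ideal.map_mono fun p hp c hc h1 hmem => hp c hc h1 (Set.image_mono hZ.le hmem)
  · intro h
    have h1 : normalizedIdeal l (Subtype.val '' (Z : Set R)) =
        normalizedIdeal l (Subtype.val '' (Z' : Set R)) := by
      rw [← hcm Z, ← hcm Z']
      exact congrArg (Ideal.comap φ) congr((OrderDual.ofDual $h).asIdeal)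
    obtain ⟨W, hW, hWZ⟩ := isClosed_induced_iff.1 Z.isClosed
    have h2 := subset_of_normalizedIdeal_le hl hW
      (by rintro _ ⟨P, hP, rfl⟩; rw [← hWZ] at hP; exact hP) (himg Z') h1.le
    refine hZ.not_ge fun P hP => ?_
    change P ∈ (Z : Set R)
    rw [← hWZ]
    exact h2 ⟨P, hP, rfl⟩

/-- Closures in `R` are traces of closures in `X`, and these stay distinct because each `T k` lies
in `R`. -/
theorem le_topologicalKrullDim_of_chain {X : Type*} [TopologicalSpace X] {R : Set X} {n : ℕ}
    (T : Fin (n + 1) → Set X) (hTR : ∀ k, T k ⊆ R) (hT : ∀ k, IsIrreducible (T k))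
    (hmono : StrictMono fun k => closure (T k)) : (n : WithBot ℕ∞) ≤ topologicalKrullDim R := by
  have himg : ∀ k, Subtype.val '' (Subtype.val ⁻¹' T k : Set R) = T k := fun k => by
    rw [Subtype.image_preimage_coe, Set.inter_eq_right.2 (hTR k)]
  have hcl : ∀ k, closure (Subtype.val ⁻¹' T k : Set R) = Subtype.val ⁻¹' closure (T k) := by
    intro k
    rw [Topology.IsInducing.subtypeVal.closure_eq_preimage_closure_image, himg]
  have hirr : ∀ k, IsIrreducible (Subtype.val ⁻¹' T k : Set R) := by
    refine fun k => ⟨?_, fun U V hU hV hTU hTV => ?_⟩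
    · obtain ⟨P, hP⟩ := (hT k).nonempty
      exact ⟨⟨P, hTR k hP⟩, hP⟩
    · obtain ⟨U, hU', rfl⟩ := isOpen_induced_iff.1 hU
      obtain ⟨V, hV', rfl⟩ := isOpen_induced_iff.1 hV
      obtain ⟨P, hP, hPU⟩ := hTU
      obtain ⟨Q, hQ, hQV⟩ := hTV
      obtain ⟨x, hx, hxUV⟩ := (hT k).isPreirreducible U V hU' hV' ⟨P, hP, hPU⟩ ⟨Q, hQ, hQV⟩
      exact ⟨⟨x, hTR k hx⟩, hx, hxUV⟩
  let s : LTSeries (TopologicalSpace.IrreducibleCloseds R) :=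
    { length := n
      toFun := fun k => ⟨closure (Subtype.val ⁻¹' T k), (hirr k).closure, isClosed_closure⟩
      step := by
        intro i
        change closure (Subtype.val ⁻¹' T _ : Set R) < closure (Subtype.val ⁻¹' T _ : Set R)
        have h := hmono (Fin.castSucc_lt_succ (i := i))
        rw [hcl, hcl]
        refine lt_of_le_of_ne (Set.preimage_mono h.le) fun heq => h.not_ge ?_
        refine closure_minimal (fun P hP => ?_) isClosed_closure
        have hm : (⟨P, hTR _ hP⟩ : R) ∈ (Subtype.val ⁻¹' closure (T i.succ) : Set R) :=
          subset_closure hP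
        rw [← heq] at hm
        exact hm }
  exact Order.LTSeries.length_le_krullDim s

end Dimension

/-! ### Jacobian criterion for algebraic independence -/

section Jacobian

variable {K : Type*} [Field K]

theorem MvPolynomial.pderiv_aeval {σ τ R : Type*} [CommRing R] [Fintype σ]
    (f : σ → MvPolynomial τ R) (p : MvPolynomial σ R) (j : τ) :
    MvPolynomial.pderiv j (MvPolynomial.aeval f p) =
      ∑ i, MvPolynomial.aeval f (MvPolynomial.pderiv i p) * MvPolynomial.pderiv j (f i) := by
  classical
  induction p using MvPolynomial.induction_on with
  | C a => simp [MvPolynomial.algebraMap_eq]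
  | add p q hp hq => simp only [map_add, hp, hq, add_mul, Finset.sum_add_distrib]
  | mul_X p i hp =>
    simp only [map_mul, MvPolynomial.aeval_X, Derivation.leibniz, hp, smul_eq_mul, map_add,
      MvPolynomial.pderiv_X, add_mul, Finset.sum_add_distrib, Finset.mul_sum]
    congr 1
    · rw [Finset.sum_eq_single i]
      · simp
      · intro b _ hb
        simp [hb.symm]
      · simp
    · exact Finset.sum_congr rfl fun _ _ => by ring

theorem MvPolynomial.totalDegree_pderiv_lt {σ R : Type*} [CommRing R] (p : MvPolynomial σ R)
    (i : σ) (h : MvPolynomial.pderiv i p ≠ 0) :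
    (MvPolynomial.pderiv i p).totalDegree < p.totalDegree := by
  have hle : ∀ m ∈ (MvPolynomial.pderiv i p).support, m.degree + 1 ≤ p.totalDegree := by
    intro m hm
    have hm' : m + Finsupp.single i 1 ∈ p.support := by
      rw [MvPolynomial.mem_support_iff, MvPolynomial.coeff_pderiv] at hm
      exact MvPolynomial.mem_support_iff.2 (left_ne_zero_of_mul hm)
    have := MvPolynomial.le_totalDegree hm'
    have e : (m + Finsupp.single i 1).degree = m.degree + 1 := by simp
    rw [← e]
    exact this
  obtain ⟨m, hm⟩ := MvPolynomial.support_nonempty.2 h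
  have hpos := hle m hm
  refine Nat.lt_of_le_sub_one (by omega) ?_
  rw [MvPolynomial.totalDegree_eq]
  refine Finset.sup_le fun m hm => ?_
  have := hle m hm
  rw [Finsupp.card_toMultiset]
  change m.degree ≤ _
  omega

theorem MvPolynomial.eq_C_of_pderiv_eq_zero {σ R : Type*} [CommRing R] [IsDomain R] [CharZero R]
    (p : MvPolynomial σ R) (h : ∀ i, MvPolynomial.pderiv i p = 0) : ∃ a, p = MvPolynomial.C a := by
  classical
  refine ⟨p.coeff 0, ?_⟩
  ext m
  rw [MvPolynomial.coeff_C]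
  split_ifs with hm
  · rw [hm]
  · obtain ⟨i, hi⟩ : ∃ i, m i ≠ 0 := by
      by_contra! h0
      exact hm (Finsupp.ext h0).symm
    have h1 := congrArg (MvPolynomial.coeff (m - Finsupp.single i 1)) (h i)
    have e : m - Finsupp.single i 1 + Finsupp.single i 1 = m :=
      tsub_add_cancel_of_le (Finsupp.single_le_iff.2 (Nat.one_le_iff_ne_zero.2 hi))
    rw [MvPolynomial.coeff_pderiv, e, MvPolynomial.coeff_zero, mul_eq_zero] at h1
    refine h1.resolve_right ?_
    exact Nat.cast_add_one_ne_zero _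

/-- The Jacobian criterion for algebraic independence in characteristic zero. -/
theorem algebraicIndependent_of_det_jacobian_ne_zero [CharZero K] {σ : Type*} [Fintype σ]
    [DecidableEq σ] (f : σ → MvPolynomial σ K)
    (h : (Matrix.of fun i j => MvPolynomial.pderiv j (f i)).det ≠ 0) :
    AlgebraicIndependent K f := by
  rw [algebraicIndependent_iff]
  -- Induction on the degree of a relation `p`. By the chain rule the values of its partial
  -- derivatives at `f` are killed by the Jacobian matrix, so each partial derivative is a relation
  -- of smaller degree, hence zero; then `p` is constant.
  have key : ∀ (n : ℕ) (p : MvPolynomial σ K), p.totalDegree < n →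
      MvPolynomial.aeval f p = 0 → p = 0 := by
    intro n
    induction n with
    | zero => intro p hp; exact absurd hp (Nat.not_lt_zero _)
    | succ n ih =>
      intro p hp h0
      have hd : ∀ i, MvPolynomial.aeval f (MvPolynomial.pderiv i p) = 0 := by
        have hv : Matrix.vecMul (fun i => MvPolynomial.aeval f (MvPolynomial.pderiv i p))
            (Matrix.of fun i j => MvPolynomial.pderiv j (f i)) = 0 := by
          ext1 j
          have := MvPolynomial.pderiv_aeval f p j
          rw [h0, map_zero] at this
          simpa [Matrix.vecMul, dotProduct] using this.symm
        exact fun i => congrFun (Matrix.eq_zero_of_vecMul_eq_zero h hv) i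
      have hz : ∀ i, MvPolynomial.pderiv i p = 0 := by
        intro i
        by_contra hne
        exact hne (ih _ (by have := MvPolynomial.totalDegree_pderiv_lt p i hne; omega) (hd i))
      obtain ⟨a, rfl⟩ := MvPolynomial.eq_C_of_pderiv_eq_zero p hz
      rw [MvPolynomial.algHom_C, MvPolynomial.algebraMap_eq, MvPolynomial.C_eq_zero] at h0
      rw [h0, map_zero]
  exact fun p hp => key _ p (Nat.lt_succ_self _) hp

end Jacobian

/-! ### Lower bound for the dimension of a polynomial family -/

section LowerBound

variable {K ι : Type*} [Field K]

theorem MvPolynomial.eval_bind₁_apply {σ : Type*} (Φ : ι → MvPolynomial σ K)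
    (p : MvPolynomial ι K) (x : σ → K) : MvPolynomial.eval x (MvPolynomial.bind₁ Φ p) =
      MvPolynomial.eval (fun i => MvPolynomial.eval x (Φ i)) p := by
  rw [← MvPolynomial.aeval_eq_eval, ← MvPolynomial.aeval_eq_eval, MvPolynomial.aeval_bind₁]

theorem not_algebraicIndependent_of_lt {m n : ℕ} (h : n < m)
    (f : Fin m → MvPolynomial (Fin n) K) : ¬ AlgebraicIndependent K f := by
  intro hf
  have := hf.lift_cardinalMk_le_trdeg
  rw [MvPolynomial.trdeg_of_isDomain] at this
  simp at this
  omega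

/-- If the coordinates of a polynomial family satisfy the Jacobian criterion, then the members of
the family form a set of Krull dimension at least the number of parameters. -/
theorem le_topologicalKrullDim_of_jacobian [CharZero K] {l : MvPolynomial ι K}
    (hl : l.IsHomogeneous 1) {R : Set (ℙ K (ι → K))} {n : ℕ}
    (Φ : ι → MvPolynomial (Fin n) K) (d : MvPolynomial (Fin n) K) (hd : d ≠ 0)
    (hΦ : ∀ x, MvPolynomial.eval (fun i => MvPolynomial.eval x (Φ i)) l = 1)
    (hR : ∀ x (hc : (fun i => MvPolynomial.eval x (Φ i)) ≠ 0), MvPolynomial.eval x d ≠ 0 →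
      Projectivization.mk K _ hc ∈ R)
    (h : Fin n → MvPolynomial ι K)
    (hJ : (Matrix.of fun i j => MvPolynomial.pderiv j (MvPolynomial.bind₁ Φ (h i))).det ≠ 0) :
    (n : WithBot ℕ∞) ≤ topologicalKrullDim R := by
  have hne : ∀ x, (fun i => MvPolynomial.eval x (Φ i)) ≠ 0 := fun x =>
    ne_zero_of_eval_eq_one hl (hΦ x)
  obtain ⟨x₀, hx₀⟩ : ∃ x, MvPolynomial.eval x (d * (Matrix.of fun i j =>
      MvPolynomial.pderiv j (MvPolynomial.bind₁ Φ (h i))).det) ≠ 0 := by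
    by_contra! h0
    exact mul_ne_zero hd hJ (MvPolynomial.funext fun x => by rw [h0 x, map_zero])
  rw [map_mul] at hx₀
  have hdx := left_ne_zero_of_mul hx₀
  have hJx := right_ne_zero_of_mul hx₀
  set J : Matrix (Fin n) (Fin n) K := Matrix.of fun i j =>
    MvPolynomial.eval x₀ (MvPolynomial.pderiv j (MvPolynomial.bind₁ Φ (h i))) with hJdef
  have hJ' : J.det ≠ 0 := by
    rw [RingHom.map_det] at hJx
    convert hJx using 2
    ext i j
    simp [J]
  -- The columns of `J⁻¹` are the slicing directions: along the affine slice through `x₀` that they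
  -- span, the functions `h` have identity Jacobian at the origin. The value 0 for `k ≥ n` only
  -- makes `v` total.
  let v : ℕ → Fin n → K := fun k i => if hk : k < n then J⁻¹ i ⟨k, hk⟩ else 0
  let ρ : (m : ℕ) → Fin n → MvPolynomial (Fin m) K := fun m i =>
    MvPolynomial.C (x₀ i) + ∑ j : Fin m, MvPolynomial.C (v j i) * MvPolynomial.X j
  let V : (m : ℕ) → (Fin m → K) → Fin n → K := fun m y i => x₀ i + ∑ j : Fin m, v j i * y j
  have hρ : ∀ m y i, MvPolynomial.eval y (ρ m i) = V m y i := by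
    intro m y i
    simp [ρ, V]
  have hρ' : ∀ m y (p : MvPolynomial (Fin n) K),
      MvPolynomial.eval y (MvPolynomial.bind₁ (ρ m) p) = MvPolynomial.eval (V m y) p := by
    intro m y p
    rw [MvPolynomial.eval_bind₁_apply]
    simp only [hρ]
  have hV0 : ∀ m, V m 0 = x₀ := fun m => by ext; simp [V]
  -- The chain consists of the images of the slices of dimension 0, 1, ..., n through `x₀`.
  let T : ℕ → Set (ℙ K (ι → K)) := fun m => {P | ∃ y, MvPolynomial.eval (V m y) d ≠ 0 ∧
    P = Projectivization.mk K _ (hne (V m y))}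
  refine le_topologicalKrullDim_of_chain (fun k => T k) ?_ ?_ ?_
  · rintro k _ ⟨y, hy, rfl⟩
    exact hR _ _ hy
  · intro k
    have hk := isIrreducible_image_of_polynomial (fun i => MvPolynomial.bind₁ (ρ k) (Φ i))
      (MvPolynomial.bind₁ (ρ k) d)
      (by
        intro h0
        apply hdx
        rw [← hV0 k, ← hρ', h0, map_zero])
      (by
        intro y _
        simp only [hρ']
        exact hne _)
    refine (congrArg IsIrreducible (Set.ext fun P => ?_)).mpr hk
    simp only [T, hρ', Set.mem_ofPred_eq, exists_prop]
  · rw [Fin.strictMono_iff_lt_succ]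
    intro k
    have hsub : T k ⊆ T (k + 1) := by
      rintro _ ⟨y, hy, rfl⟩
      have hVV : V (k + 1) (Fin.snoc y 0) = V k y := by
        ext i
        simp [V, Fin.sum_univ_castSucc]
      exact ⟨Fin.snoc y 0, by rwa [hVV], by simp only [hVV]⟩
    refine lt_of_le_of_ne (closure_mono hsub) fun heq => ?_
    let g : (m : ℕ) → Fin (k + 1) → MvPolynomial (Fin m) K := fun m i =>
      MvPolynomial.bind₁ (ρ m) (MvPolynomial.bind₁ Φ (h (Fin.castLE k.2 i)))
    -- The first `k + 1` functions are dependent on the slice of dimension `k` but independent on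
    -- that of dimension `k + 1`. A relation on the smaller slice therefore separates the two
    -- closures.
    have hdep := not_algebraicIndependent_of_lt (Nat.lt_succ_self k) (g k)
    have hind : AlgebraicIndependent K (g (k + 1)) := by
      apply algebraicIndependent_of_det_jacobian_ne_zero
      intro h0
      have h1 := congrArg (MvPolynomial.eval 0) h0
      rw [RingHom.map_det, map_zero] at h1
      have h2 : (MvPolynomial.eval (0 : Fin (k + 1) → K)).mapMatrix
          (Matrix.of fun i j => MvPolynomial.pderiv j (g (k + 1) i)) = 1 := by
        ext i j
        have hJJ := congrFun (congrFun (Matrix.mul_nonsing_inv J (isUnit_iff_ne_zero.2 hJ'))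
          (Fin.castLE k.2 i)) (Fin.castLE k.2 j)
        rw [Matrix.mul_apply] at hJJ
        rw [RingHom.mapMatrix_apply, Matrix.map_apply, Matrix.of_apply]
        change MvPolynomial.eval 0 (MvPolynomial.pderiv j (MvPolynomial.aeval _ _)) = _
        rw [MvPolynomial.pderiv_aeval, map_sum]
        have h3 : ∀ a, MvPolynomial.eval 0 (MvPolynomial.pderiv j (ρ (k + 1) a)) =
            J⁻¹ a (Fin.castLE k.2 j) := by
          intro a
          have hv : v j a = J⁻¹ a (Fin.castLE k.2 j) := dif_pos (j.2.trans_le k.2)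
          simp only [ρ, map_add, MvPolynomial.pderiv_C, map_sum, MvPolynomial.pderiv_C_mul,
            MvPolynomial.pderiv_X, zero_add, map_mul, MvPolynomial.eval_C]
          rw [Finset.sum_eq_single j, hv]
          · simp
          · intro b _ hb
            simp [hb]
          · simp
        have h4 : ∀ p : MvPolynomial (Fin n) K, MvPolynomial.eval 0
            (MvPolynomial.aeval (ρ (k + 1)) p) = MvPolynomial.eval x₀ p := fun p => by
          rw [← hV0 (k + 1)]
          exact hρ' _ _ _
        simp only [map_mul, h3, h4]
        refine hJJ.trans ?_
        simp [Matrix.one_apply]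
      rw [h2, Matrix.det_one] at h1
      exact one_ne_zero h1
    rw [algebraicIndependent_iff] at hdep hind
    push Not at hdep
    obtain ⟨P, hP, hP0⟩ := hdep
    let p : MvPolynomial ι K := MvPolynomial.bind₁ (fun i => h (Fin.castLE k.2 i)) P
    have hp : ∀ m y, MvPolynomial.eval (fun i => MvPolynomial.eval (V m y) (Φ i)) p =
        MvPolynomial.eval y (MvPolynomial.aeval (g m) P) := by
      intro m y
      rw [MvPolynomial.eval_bind₁_apply]
      change _ = MvPolynomial.eval y (MvPolynomial.bind₁ (g m) P)
      rw [MvPolynomial.eval_bind₁_apply]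
      simp only [g, hρ', MvPolynomial.eval_bind₁_apply]
    have hTk : T k ⊆ {P | MvPolynomial.eval P.rep (homogenizeWith l p) = 0} := by
      rintro _ ⟨y, -, rfl⟩
      rw [mk_mem_vanishing_homogenizeWith hl p _ (hΦ _), hp, hP, map_zero]
    have hTk' := closure_minimal hTk (isClosed_vanishing (isHomogeneous_homogenizeWith hl p))
    -- The relation is known only where `d` does not vanish, hence the extra factor.
    have h0 : MvPolynomial.bind₁ (ρ (k + 1)) d * MvPolynomial.aeval (g (k + 1)) P = 0 := by
      refine MvPolynomial.funext fun y => ?_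
      rw [map_mul, map_zero, mul_eq_zero, hρ', or_iff_not_imp_left]
      intro hy
      rw [← hp, ← mk_mem_vanishing_homogenizeWith hl p (hne _) (hΦ _)]
      refine hTk' ?_
      have : closure (T k) = closure (T (k + 1)) := heq
      rw [this]
      exact subset_closure ⟨y, hy, rfl⟩
    rcases mul_eq_zero.1 h0 with h0 | h0
    · apply hdx
      rw [← hV0 (k + 1), ← hρ', h0, map_zero]
    · exact hP0 (hind P h0)

end LowerBound

/-! ### Determinantal quartics -/

section Pencil

/-- The determinant of the matrix `diag(v - ηᵢ u) + w O`. -/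
def pencil {S : Type*} [CommRing S] (η : Fin 4 → S) (O : Matrix (Fin 4) (Fin 4) S) (u v w : S) : S :=
  (Matrix.diagonal (fun i => v - η i * u) + w • O).det

variable {S S' : Type*} [CommRing S] [CommRing S']

theorem map_pencil (f : S →+* S') (η : Fin 4 → S) (O : Matrix (Fin 4) (Fin 4) S) (u v w : S) :
    f (pencil η O u v w) = pencil (fun i => f (η i)) (O.map f) (f u) (f v) (f w) := by
  rw [pencil, pencil, RingHom.map_det]
  congr 1
  ext i j
  simp [Matrix.diagonal_apply, apply_ite f]

theorem pencil_zero (η : Fin 4 → S) (O : Matrix (Fin 4) (Fin 4) S) (u v : S) :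
    pencil η O u v 0 = ∏ i, (v - η i * u) := by
  simp [pencil]

theorem pencil_eq_zero_of_mulVec [IsDomain S] (η : Fin 4 → S) (O : Matrix (Fin 4) (Fin 4) S)
    (u v w : S) (k : Fin 4 → S) (hk : k ≠ 0)
    (h : ∀ i, (v - η i * u) * k i + w * ∑ j, O i j * k j = 0) : pencil η O u v w = 0 := by
  rw [pencil, ← Matrix.exists_mulVec_eq_zero_iff]
  refine ⟨k, hk, ?_⟩
  ext1 i
  rw [Matrix.add_mulVec, Matrix.smul_mulVec, Pi.add_apply, Matrix.mulVec_diagonal, Pi.smul_apply,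
    smul_eq_mul]
  exact h i

/-- Conjugation by a diagonal matrix fixes the diagonal part of the pencil; the hypothesis is
written without inverses so that it makes sense over a domain. -/
theorem pencil_eq_of_conj [IsDomain S] (η : Fin 4 → S) (O O' : Matrix (Fin 4) (Fin 4) S)
    (u v w : S) (k : Fin 4 → S) (hk : ∀ i, k i ≠ 0) (h : ∀ i j, k i * O i j = O' i j * k j) :
    pencil η O u v w = pencil η O' u v w := by
  have hdet : (Matrix.diagonal k).det ≠ 0 := by
    rw [Matrix.det_diagonal]
    exact Finset.prod_ne_zero_iff.2 fun i _ => hk i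
  have hmul : Matrix.diagonal k * (Matrix.diagonal (fun i => v - η i * u) + w • O) =
      (Matrix.diagonal (fun i => v - η i * u) + w • O') * Matrix.diagonal k := by
    ext i j
    rw [Matrix.diagonal_mul, Matrix.mul_diagonal]
    simp only [Matrix.add_apply, Matrix.smul_apply, smul_eq_mul]
    by_cases hij : i = j
    · subst hij
      simp only [Matrix.diagonal_apply_eq]
      linear_combination w * h i i
    · simp only [Matrix.diagonal_apply_ne _ hij]
      linear_combination w * h i j
  have := congrArg Matrix.det hmul
  rw [Matrix.det_mul, Matrix.det_mul, mul_comm] at this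
  exact mul_right_cancel₀ hdet this

/-- Modulo `w` the matrix becomes diagonal. -/
theorem exists_pencil_eq (η : Fin 4 → S) (O : Matrix (Fin 4) (Fin 4) S) (u v w : S) :
    ∃ r, pencil η O u v w = ∏ i, (v - η i * u) + w * r := by
  have h := map_pencil (Ideal.Quotient.mk (Ideal.span {w})) η O u v w
  have hw : Ideal.Quotient.mk (Ideal.span {w}) w = 0 :=
    Ideal.Quotient.eq_zero_iff_mem.2 (Ideal.mem_span_singleton_self w)
  rw [hw, pencil_zero, ← sub_eq_zero] at h
  simp only [← map_mul, ← map_sub, ← map_prod] at h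
  rw [Ideal.Quotient.eq_zero_iff_mem, Ideal.mem_span_singleton] at h
  obtain ⟨r, hr⟩ := h
  exact ⟨r, by rw [← hr]; ring⟩

theorem isHomogeneous_pencil {σ : Type*} (η : Fin 4 → S) (O : Matrix (Fin 4) (Fin 4) S)
    {u v w : MvPolynomial σ S} (hu : u.IsHomogeneous 1) (hv : v.IsHomogeneous 1)
    (hw : w.IsHomogeneous 1) : (pencil (fun i => MvPolynomial.C (η i)) (O.map MvPolynomial.C)
      u v w).IsHomogeneous 4 := by
  set A : Matrix (Fin 4) (Fin 4) (MvPolynomial σ S) :=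
    Matrix.diagonal (fun i => v - MvPolynomial.C (η i) * u) + w • O.map MvPolynomial.C with hA
  have he : ∀ i j, (A i j).IsHomogeneous 1 := by
    intro i j
    rw [hA, Matrix.add_apply]
    refine MvPolynomial.IsHomogeneous.add ?_ ?_
    · rw [Matrix.diagonal_apply]
      split_ifs
      · exact hv.sub (hu.C_mul _)
      · exact MvPolynomial.isHomogeneous_zero _ _ _
    · rw [Matrix.smul_apply, smul_eq_mul, Matrix.map_apply, mul_comm]
      exact hw.C_mul _
  rw [pencil, ← hA, Matrix.det_apply]
  refine MvPolynomial.IsHomogeneous.sum _ _ _ fun g _ => ?_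
  have hp := MvPolynomial.IsHomogeneous.prod Finset.univ (fun i => A (g i) i) (fun _ => 1) fun i _ => he _ _
  have h4 : ∑ i : Fin 4, 1 = 4 := by simp
  rw [h4] at hp
  exact ((MvPolynomial.mem_homogeneousSubmodule _ _).1
    (zsmul_mem ((MvPolynomial.mem_homogeneousSubmodule _ _).2 hp) (Equiv.Perm.sign g : ℤ)))

end Pencil

/-! ### Curves with four prescribed poles and their equations -/

section RationalMatrix

variable {K : Type*} [Field K]

/-- The matrix of the pencil that belongs to the rational curve with poles `τᵢ` of residue
`μᵢ (1, ηᵢ)` and constant term `(a, b)`. -/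
def rationalMatrix (η τ μ : Fin 4 → K) (a b : K) : Matrix (Fin 4) (Fin 4) K := fun i j =>
  if i = j then η i * a - b + ∑ k, (η i - η k) / (τ i - τ k) * μ k
  else -((η i - η j) / (τ i - τ j) * μ j)

open Polynomial in
/-- The parametrization by polynomials with the given poles, residues and constant term. -/
def rationalCurve (η τ μ : Fin 4 → K) (a b : K) : Fin 3 → K[X] :=
  ![C a * ∏ i, (X - C (τ i)) + ∑ j, C (μ j) * ∏ k ∈ Finset.univ.erase j, (X - C (τ k)),
    C b * ∏ i, (X - C (τ i)) + ∑ j, C (η j * μ j) * ∏ k ∈ Finset.univ.erase j, (X - C (τ k)),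
    ∏ i, (X - C (τ i))]

open Polynomial in
theorem eval_prod_erase_of_ne (τ : Fin 4 → K) {i j : Fin 4} (h : i ≠ j) :
    (∏ k ∈ Finset.univ.erase j, (X - C (τ k))).eval (τ i) = 0 := by
  rw [eval_prod]
  exact Finset.prod_eq_zero (Finset.mem_erase.2 ⟨h, Finset.mem_univ i⟩) (by simp)

open Polynomial in
theorem eval_prod_erase_ne_zero {τ : Fin 4 → K} (hτ : Function.Injective τ) (i : Fin 4) :
    (∏ k ∈ Finset.univ.erase i, (X - C (τ k))).eval (τ i) ≠ 0 := by
  rw [eval_prod]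
  refine Finset.prod_ne_zero_iff.2 fun k hk => ?_
  rw [eval_sub, eval_X, eval_C, sub_ne_zero]
  exact fun h => (Finset.mem_erase.1 hk).1 (hτ h).symm

open Polynomial in
theorem eval_rationalCurve {η τ μ : Fin 4 → K} {a b : K} (i : Fin 4) :
    (fun l => (rationalCurve η τ μ a b l).eval (τ i)) =
      (μ i * (∏ k ∈ Finset.univ.erase i, (X - C (τ k))).eval (τ i)) • ![1, η i, 0] := by
  have h0 : (∏ i, (X - C (τ i))).eval (τ i) = 0 := by
    rw [eval_prod]
    exact Finset.prod_eq_zero (Finset.mem_univ i) (by simp)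
  have hs : ∀ ν : Fin 4 → K,
      (∑ j, C (ν j) * ∏ k ∈ Finset.univ.erase j, (X - C (τ k))).eval (τ i) =
        ν i * (∏ k ∈ Finset.univ.erase i, (X - C (τ k))).eval (τ i) := by
    intro ν
    rw [eval_finsetSum, Finset.sum_eq_single i]
    · rw [eval_mul, eval_C]
    · intro j _ hj
      rw [eval_mul, eval_prod_erase_of_ne τ hj.symm, mul_zero]
    · simp
  ext l
  fin_cases l
  · change (C a * ∏ i, (X - C (τ i)) + ∑ j, C (μ j) * ∏ k ∈ Finset.univ.erase j,
      (X - C (τ k))).eval (τ i) = _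
    rw [eval_add, hs, eval_mul, h0]
    simp
  · change (C b * ∏ i, (X - C (τ i)) + ∑ j, C (η j * μ j) * ∏ k ∈ Finset.univ.erase j,
      (X - C (τ k))).eval (τ i) = _
    rw [eval_add, hs (fun j => η j * μ j), eval_mul, h0]
    simp
    ring
  · change (∏ i, (X - C (τ i))).eval (τ i) = _
    rw [h0]
    simp

-- The products `c j` of the factors other than `X - τⱼ` form a kernel vector. Row `i` reduces to
-- the partial fraction identity `P (cᵢ - cⱼ) = (τᵢ - τⱼ) cᵢ cⱼ`, which accounts for the
-- coefficients `(ηᵢ - ηⱼ)/(τᵢ - τⱼ)` of the matrix.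
open Polynomial in
theorem pencil_rationalCurve {η τ μ : Fin 4 → K} (hτ : Function.Injective τ) (a b : K) :
    pencil (fun i => C (η i)) ((rationalMatrix η τ μ a b).map C) (rationalCurve η τ μ a b 0)
      (rationalCurve η τ μ a b 1) (rationalCurve η τ μ a b 2) = 0 := by
  set c : Fin 4 → K[X] := fun j => ∏ k ∈ Finset.univ.erase j, (X - C (τ k)) with hc
  set P : K[X] := ∏ i, (X - C (τ i)) with hP
  have hcP : ∀ j, c j * (X - C (τ j)) = P := fun j =>
    Finset.prod_erase_mul _ _ (Finset.mem_univ j)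
  refine pencil_eq_zero_of_mulVec _ _ _ _ _ c ?_ ?_
  · intro h
    have := congrFun h 0
    exact (Finset.prod_ne_zero_iff.2 fun k _ => X_sub_C_ne_zero (τ k)) this
  intro i
  have hdiff : ∀ j, P * (c i - c j) = C (τ i - τ j) * (c i * c j) := by
    intro j
    rw [mul_sub, C_sub]
    nth_rewrite 1 [← hcP j]
    rw [← hcP i]
    ring
  have hrow : ∑ j, (rationalMatrix η τ μ a b).map C i j * c j =
      C (η i * a - b) * c i + ∑ j, C ((η i - η j) / (τ i - τ j) * μ j) * (c i - c j) := by
    have : ∀ j, (rationalMatrix η τ μ a b).map C i j * c j =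
        (if i = j then C (η i * a - b + ∑ k, (η i - η k) / (τ i - τ k) * μ k) * c i else 0) -
          C ((η i - η j) / (τ i - τ j) * μ j) * c j := by
      intro j
      rw [Matrix.map_apply, rationalMatrix]
      split_ifs with h
      · subst h; simp
      · simp
    simp only [this, Finset.sum_sub_distrib, Finset.sum_ite_eq, Finset.mem_univ, if_true,
      mul_sub, ← Finset.sum_mul, C_add, map_sum]
    ring
  have hterm : ∀ j, P * (C ((η i - η j) / (τ i - τ j) * μ j) * (c i - c j)) =
      C ((η i - η j) * μ j) * (c i * c j) := by
    intro j
    -- For `i = j` the quotient is `0 / 0 = 0`, and both sides vanish.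
    by_cases h : i = j
    · subst h; simp
    · have hne : τ i - τ j ≠ 0 := sub_ne_zero.2 fun e => h (hτ e)
      calc _ = C ((η i - η j) / (τ i - τ j) * μ j) * (P * (c i - c j)) := by ring
        _ = C ((η i - η j) / (τ i - τ j) * μ j * (τ i - τ j)) * (c i * c j) := by
            rw [hdiff, C_mul (b := τ i - τ j)]; ring
        _ = _ := by congr 2; field_simp
  have h2 : rationalCurve η τ μ a b 2 = P := rfl
  have h1 : rationalCurve η τ μ a b 1 = C b * P + ∑ j, C (η j * μ j) * c j := rfl
  have h0 : rationalCurve η τ μ a b 0 = C a * P + ∑ j, C (μ j) * c j := rfl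
  rw [hrow, h2, h1, h0]
  have hsum : ∑ j, P * (C ((η i - η j) / (τ i - τ j) * μ j) * (c i - c j)) =
      ∑ j, C ((η i - η j) * μ j) * (c i * c j) := Finset.sum_congr rfl fun j _ => hterm j
  have e1 : (∑ j, C (η j * μ j) * c j) * c i - C (η i) * (∑ j, C (μ j) * c j) * c i +
      ∑ j, C ((η i - η j) * μ j) * (c i * c j) = 0 := by
    simp only [Finset.mul_sum, Finset.sum_mul, ← Finset.sum_sub_distrib, ← Finset.sum_add_distrib]
    refine Finset.sum_eq_zero fun j _ => ?_
    simp only [C_mul, C_sub]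
    ring
  rw [← Finset.mul_sum] at hsum
  rw [C_sub, C_mul]
  linear_combination e1 + hsum

end RationalMatrix

/-! ### The determinant generates the ideal of the curve -/

section Divisibility

variable {K : Type*} [Field K]

theorem MvPolynomial.homogeneousComponent_mul_of_isHomogeneous {σ R : Type*} [CommRing R]
    {p : MvPolynomial σ R} {n : ℕ} (hp : p.IsHomogeneous n) (q : MvPolynomial σ R) (d : ℕ) :
    MvPolynomial.homogeneousComponent d (p * q) =
      if n ≤ d then p * MvPolynomial.homogeneousComponent (d - n) q else 0 := by
  have hk : ∀ k, MvPolynomial.homogeneousComponent d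
      (p * MvPolynomial.homogeneousComponent k q) =
      if n + k = d then p * MvPolynomial.homogeneousComponent k q else 0 := by
    intro k
    rw [MvPolynomial.homogeneousComponent_of_mem
      (hp.mul (MvPolynomial.homogeneousComponent_isHomogeneous k q))]
    simp only [eq_comm]
  conv_lhs => rw [← MvPolynomial.sum_homogeneousComponent q, Finset.mul_sum, map_sum]
  simp only [hk]
  split_ifs with h
  · rw [Finset.sum_eq_single (d - n)]
    · rw [if_pos (by omega)]
    · intro b _ hb
      rw [if_neg (by omega)]
    · intro hmem
      rw [if_pos (by omega), MvPolynomial.homogeneousComponent_eq_zero, mul_zero]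
      have := Finset.mem_range.not.1 hmem
      omega
  · exact Finset.sum_eq_zero fun b _ => if_neg (by omega)

/-- A ternary polynomial which vanishes on four distinct lines `X₂ = 0`, `X₁ = ηᵢ X₀` is divisible
by the product of their equations modulo `X₂`. -/
theorem exists_eq_prod_mul_add_of_eval_eq_zero [Infinite K] {η : Fin 4 → K}
    (hη : Function.Injective η) (h : MvPolynomial (Fin 3) K)
    (h0 : ∀ i s, MvPolynomial.eval ![s, η i * s, 0] h = 0) :
    ∃ q r : MvPolynomial (Fin 3) K, h = (∏ i, (MvPolynomial.X 1 - MvPolynomial.C (η i) *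
      MvPolynomial.X 0)) * q + MvPolynomial.X 2 * r := by
  open Polynomial in
  -- `π` restricts to `X₂ = 0`, viewing the result as a polynomial in `X₁` over `K[X₀]` with the
  -- four distinct roots `ηᵢ X₀`; `s` lifts it back, and `s ∘ π` is the identity modulo `X₂`.
  let π : MvPolynomial (Fin 3) K →ₐ[K] K[X][X] := MvPolynomial.aeval ![C X, X, 0]
  let s₀ : K[X] →ₐ[K] MvPolynomial (Fin 3) K := aeval (MvPolynomial.X 0)
  let s : K[X][X] →+* MvPolynomial (Fin 3) K := eval₂RingHom s₀.toRingHom (MvPolynomial.X 1)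
  have hroot : ∀ i, (C (η i) * X : K[X]) ∈ (π h).roots ∨ π h = 0 := by
    intro i
    rw [or_comm, or_iff_not_imp_left]
    intro hne
    rw [mem_roots hne, IsRoot.def]
    refine Polynomial.funext fun x => ?_
    have hc : ((evalRingHom x).comp (evalRingHom (C (η i) * X))).comp π.toRingHom =
        MvPolynomial.eval ![x, η i * x, 0] := by
      refine MvPolynomial.ringHom_ext ?_ ?_
      · intro a
        simp [π]
      · intro l
        fin_cases l <;> simp [π]
    rw [eval_zero]
    exact (RingHom.congr_fun hc h).trans (h0 i x)
  have hdvd : (∏ i, (X - C (C (η i) * X)) : K[X][X]) ∣ π h := by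
    by_cases hz : π h = 0
    · rw [hz]; exact dvd_zero _
    have hinj : Function.Injective fun i => (C (η i) * X : K[X]) := by
      intro i j hij
      have := congrArg (eval 1) hij
      simpa using hη (by simpa using this)
    have := (Multiset.prod_X_sub_C_dvd_iff_le_roots hz
      (Finset.univ.val.map fun i => (C (η i) * X : K[X]))).2 (by
        rw [Multiset.le_iff_subset (Finset.univ.nodup.map hinj)]
        intro a ha
        obtain ⟨i, -, rfl⟩ := Multiset.mem_map.1 ha
        exact (hroot i).resolve_right hz)
    rwa [Multiset.map_map] at this
  obtain ⟨q, hq⟩ := hdvd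
  have hs : (Ideal.Quotient.mk (Ideal.span {(MvPolynomial.X 2 : MvPolynomial (Fin 3) K)})).comp
      (s.comp π.toRingHom) = Ideal.Quotient.mk _ := by
    refine MvPolynomial.ringHom_ext ?_ ?_
    · intro a
      simp [π, s, s₀]
    · intro l
      fin_cases l
      · simp [π, s, s₀]
      · simp [π, s, s₀]
      · have : Ideal.Quotient.mk (Ideal.span {(MvPolynomial.X 2 : MvPolynomial (Fin 3) K)})
            (MvPolynomial.X 2) = 0 :=
          Ideal.Quotient.eq_zero_iff_mem.2 (Ideal.mem_span_singleton_self _)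
        simp [π, s, s₀, this]
  have h1 := RingHom.congr_fun hs h
  rw [eq_comm] at h1
  obtain ⟨r, hr⟩ := Ideal.mem_span_singleton.1 (Ideal.Quotient.eq.1 h1)
  refine ⟨s q, r, ?_⟩
  have h2 : s (π h) = (∏ i, (MvPolynomial.X 1 - MvPolynomial.C (η i) * MvPolynomial.X 0)) * s q := by
    rw [hq, map_mul, map_prod]
    congr 2
    ext1 i
    simp [s, s₀]
  rw [← h2, ← hr]
  simp

/-- A form that vanishes on a parametrized curve is divisible by the quartic form `G` if the curve
lies on `G = 0` and passes through the four distinct points `(1 : ηᵢ : 0)` of `G = 0` on a line. -/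
theorem dvd_of_aeval_eq_zero [Infinite K] {η : Fin 4 → K} (hη : Function.Injective η)
    {G r : MvPolynomial (Fin 3) K} (hG : G.IsHomogeneous 4)
    (hGr : G = ∏ i, (MvPolynomial.X 1 - MvPolynomial.C (η i) * MvPolynomial.X 0) +
      MvPolynomial.X 2 * r) {γ : Fin 3 → Polynomial K} (hγ : γ 2 ≠ 0)
    (hγG : MvPolynomial.aeval γ G = 0)
    (hpt : ∀ i, ∃ t ν : K, ν ≠ 0 ∧ (fun l => (γ l).eval t) = ν • ![1, η i, 0])
    (d : ℕ) (H : MvPolynomial (Fin 3) K) (hH : H.IsHomogeneous d)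
    (hγH : MvPolynomial.aeval γ H = 0) : G ∣ H := by
  -- Descent on the degree: `H` vanishes at the four points of the line, so modulo `X₂` it is a
  -- multiple of `G`. Then `H - G q' = X₂ s`, and `s` again vanishes on the curve because `γ 2 ≠ 0`.
  induction d using Nat.strong_induction_on generalizing H with | _ d ih => ?_
  have hev : ∀ i s, MvPolynomial.eval ![s, η i * s, 0] H = 0 := by
    intro i s
    obtain ⟨t, ν, hν, hpt⟩ := hpt i
    have h1 : MvPolynomial.eval (fun l => (γ l).eval t) H = 0 := by
      have := congrArg (Polynomial.evalRingHom t) hγH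
      rw [map_zero, MvPolynomial.aeval_def, MvPolynomial.eval₂_eq_eval_map,
        MvPolynomial.eval_map, MvPolynomial.hom_eval₂] at this
      have hid : (Polynomial.evalRingHom t).comp (algebraMap K (Polynomial K)) = RingHom.id K := by
        ext a
        simp
      rw [hid] at this
      exact this
    have h2 : ![s, η i * s, 0] = (s * ν⁻¹) • (fun l => (γ l).eval t) := by
      rw [hpt, smul_smul, mul_assoc, inv_mul_cancel₀ hν, mul_one]
      ext l
      fin_cases l <;> simp [mul_comm]
    rw [h2, hH.eval_smul, h1, mul_zero]
  have hP : (∏ i, (MvPolynomial.X 1 - MvPolynomial.C (η i) * MvPolynomial.X 0) :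
      MvPolynomial (Fin 3) K).IsHomogeneous 4 :=
    MvPolynomial.IsHomogeneous.prod Finset.univ _ (fun _ => 1) fun i _ =>
      (MvPolynomial.isHomogeneous_X _ _).sub ((MvPolynomial.isHomogeneous_X _ _).C_mul _)
  have hX : (MvPolynomial.X 2 : MvPolynomial (Fin 3) K).IsHomogeneous 1 :=
    MvPolynomial.isHomogeneous_X _ _
  obtain ⟨q, r', hqr⟩ := exists_eq_prod_mul_add_of_eval_eq_zero hη H hev
  have hqr' := congrArg (MvPolynomial.homogeneousComponent d) hqr
  rw [map_add, MvPolynomial.homogeneousComponent_mul_of_isHomogeneous hP,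
    MvPolynomial.homogeneousComponent_mul_of_isHomogeneous hX,
    MvPolynomial.homogeneousComponent_of_mem hH, if_pos rfl] at hqr'
  -- The degree-`d` part is taken so that `q'` is a form of degree `d - 4`, or zero when `d < 4`.
  obtain ⟨q', hq', hHq⟩ : ∃ q' : MvPolynomial (Fin 3) K, (G * q').IsHomogeneous d ∧
      H = (∏ i, (MvPolynomial.X 1 - MvPolynomial.C (η i) * MvPolynomial.X 0)) * q' +
        if 1 ≤ d then MvPolynomial.X 2 * MvPolynomial.homogeneousComponent (d - 1) r' else 0 := by
    by_cases h4 : 4 ≤ d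
    · rw [if_pos h4] at hqr'
      refine ⟨_, ?_, hqr'⟩
      have := hG.mul (MvPolynomial.homogeneousComponent_isHomogeneous (d - 4) q)
      rwa [Nat.add_sub_cancel' h4] at this
    · rw [if_neg h4] at hqr'
      exact ⟨0, by rw [mul_zero]; exact MvPolynomial.isHomogeneous_zero _ _ _, by
        rw [mul_zero]; exact hqr'⟩
  have hdiff : ∃ s, H - G * q' = MvPolynomial.X 2 * s := by
    by_cases h1 : 1 ≤ d
    · rw [if_pos h1] at hHq
      exact ⟨MvPolynomial.homogeneousComponent (d - 1) r' - r * q', by rw [hHq, hGr]; ring⟩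
    · rw [if_neg h1] at hHq
      exact ⟨- (r * q'), by rw [hHq, hGr]; ring⟩
  obtain ⟨s, hs⟩ := hdiff
  have hs' := congrArg (MvPolynomial.homogeneousComponent d) hs
  rw [MvPolynomial.homogeneousComponent_of_mem (hH.sub hq'), if_pos rfl,
    MvPolynomial.homogeneousComponent_mul_of_isHomogeneous hX] at hs'
  cases d with
  | zero =>
    rw [if_neg (by omega), sub_eq_zero] at hs'
    exact ⟨q', hs'⟩
  | succ d =>
    rw [if_pos (by omega), Nat.add_sub_cancel] at hs'
    have h0 : MvPolynomial.aeval γ (MvPolynomial.homogeneousComponent d s) = 0 := by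
      have := congrArg (MvPolynomial.aeval γ) hs'
      rw [map_sub, map_mul, map_mul, hγG, hγH, MvPolynomial.aeval_X, zero_mul, sub_zero,
        eq_comm, mul_eq_zero] at this
      exact this.resolve_left hγ
    have := ih d (Nat.lt_succ_self d) _ (MvPolynomial.homogeneousComponent_isHomogeneous d s) h0
    rw [sub_eq_iff_eq_add] at hs'
    rw [hs']
    exact dvd_add (this.mul_left _) (dvd_mul_right _ _)

end Divisibility

/-! ### Parametrized curves are integral and rational -/

section Parametrization

theorem isHomogeneous_ternaryForm {d : ℕ} (c : PlaneMonomial d → ℂ) :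
    (ternaryForm c).IsHomogeneous d := by
  refine MvPolynomial.IsHomogeneous.sum _ _ _ fun m _ => ?_
  refine MvPolynomial.isHomogeneous_monomial _ ?_
  have := (Finset.mem_finsuppAntidiag.1 m.2).1
  rw [Finsupp.degree_eq_sum]
  exact this

theorem PlaneCurve.isHomogeneous_equation {d : ℕ} (C : PlaneCurve d) :
    (PlaneCurve.equation C).IsHomogeneous d :=
  isHomogeneous_ternaryForm _

/-- The parametrization of the affine cone over a parametrized plane curve. -/
def coneParametrization (γ : Fin 3 → Polynomial ℂ) :
    MvPolynomial (Fin 3) ℂ →ₐ[ℂ] Polynomial (RatFunc ℂ) :=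
  MvPolynomial.aeval fun i =>
    Polynomial.X * Polynomial.C (algebraMap (Polynomial ℂ) (RatFunc ℂ) (γ i))

theorem coneParametrization_of_isHomogeneous (γ : Fin 3 → Polynomial ℂ) {n : ℕ}
    {H : MvPolynomial (Fin 3) ℂ} (hH : H.IsHomogeneous n) :
    coneParametrization γ H = Polynomial.X ^ n *
      Polynomial.C (algebraMap (Polynomial ℂ) (RatFunc ℂ) (MvPolynomial.aeval γ H)) := by
  rw [coneParametrization, hH.aeval_mul]
  congr 1
  let f : Polynomial ℂ →ₐ[ℂ] Polynomial (RatFunc ℂ) :=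
    (Polynomial.CAlgHom (R := ℂ) (A := RatFunc ℂ)).comp (IsScalarTower.toAlgHom ℂ (Polynomial ℂ) (RatFunc ℂ))
  exact (MvPolynomial.comp_aeval_apply γ f H).symm

/-- The extra variable records degrees: the coefficient of `X ^ n` in the image is the value of the
degree-`n` component on the curve. This passes from forms to arbitrary polynomials. -/
theorem ker_coneParametrization {d : ℕ} {F : MvPolynomial (Fin 3) ℂ} (hF : F.IsHomogeneous d)
    {γ : Fin 3 → Polynomial ℂ} (h : ∀ (n : ℕ) (H : MvPolynomial (Fin 3) ℂ), H.IsHomogeneous n →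
      (MvPolynomial.aeval γ H = 0 ↔ F ∣ H)) (H : MvPolynomial (Fin 3) ℂ) :
    coneParametrization γ H = 0 ↔ F ∣ H := by
  constructor
  · intro h0
    have hc : ∀ n, F ∣ MvPolynomial.homogeneousComponent n H := by
      intro n
      rw [← h n _ (MvPolynomial.homogeneousComponent_isHomogeneous n H)]
      have h1 := congrArg (fun p => Polynomial.coeff p n) h0
      simp only [Polynomial.coeff_zero] at h1
      rw [← MvPolynomial.sum_homogeneousComponent H, map_sum, Polynomial.finsetSum_coeff] at h1
      have h2 : ∀ k, (coneParametrization γ (MvPolynomial.homogeneousComponent k H)).coeff n =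
          if n = k then algebraMap (Polynomial ℂ) (RatFunc ℂ)
            (MvPolynomial.aeval γ (MvPolynomial.homogeneousComponent n H)) else 0 := by
        intro k
        rw [coneParametrization_of_isHomogeneous γ
          (MvPolynomial.homogeneousComponent_isHomogeneous k H), mul_comm,
          Polynomial.coeff_C_mul_X_pow]
        split_ifs with hk
        · rw [hk]
        · rfl
      simp only [h2, Finset.sum_ite_eq, Finset.mem_range] at h1
      split_ifs at h1 with hn
      · exact (map_eq_zero_iff _ (RatFunc.algebraMap_injective ℂ)).1 h1
      · rw [MvPolynomial.homogeneousComponent_eq_zero _ _ (by omega), map_zero]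
    rw [← MvPolynomial.sum_homogeneousComponent H]
    exact Finset.dvd_sum fun n _ => hc n
  · rintro ⟨q, rfl⟩
    rw [map_mul, coneParametrization_of_isHomogeneous γ hF, (h d F hF).2 dvd_rfl]
    simp

variable {d : ℕ} (C : PlaneCurve d) {γ : Fin 3 → Polynomial ℂ}

/-- The embedding of the homogeneous coordinate ring of a parametrized plane curve. -/
def PlaneCurve.coordRingHom (h : ∀ (n : ℕ) (H : MvPolynomial (Fin 3) ℂ), H.IsHomogeneous n →
      (MvPolynomial.aeval γ H = 0 ↔ PlaneCurve.equation C ∣ H)) :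
    PlaneCurve.CoordRing C →ₐ[ℂ] Polynomial (RatFunc ℂ) :=
  Ideal.Quotient.liftₐ _ (coneParametrization γ) fun H hH =>
    (ker_coneParametrization C.isHomogeneous_equation h H).2 (Ideal.mem_span_singleton.1 hH)

theorem PlaneCurve.coordRingHom_injective
    (h : ∀ (n : ℕ) (H : MvPolynomial (Fin 3) ℂ), H.IsHomogeneous n →
      (MvPolynomial.aeval γ H = 0 ↔ PlaneCurve.equation C ∣ H)) :
    Function.Injective (PlaneCurve.coordRingHom C h) := by
  rw [injective_iff_map_eq_zero]
  intro x hx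
  obtain ⟨H, rfl⟩ := Ideal.Quotient.mk_surjective x
  rw [Ideal.Quotient.eq_zero_iff_mem, Ideal.mem_span_singleton]
  exact (ker_coneParametrization C.isHomogeneous_equation h H).1 hx

theorem PlaneCurve.isIntegral_of_parametrization
    (h : ∀ (n : ℕ) (H : MvPolynomial (Fin 3) ℂ), H.IsHomogeneous n →
      (MvPolynomial.aeval γ H = 0 ↔ PlaneCurve.equation C ∣ H)) : PlaneCurve.IsIntegral C :=
  (PlaneCurve.coordRingHom_injective C h).isDomain (PlaneCurve.coordRingHom C h).toRingHom

/-- In a quotient of two forms of the same degree the powers of the cone variable cancel, so the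
function field embeds in `ℂ(t)`. The linear forms `A`, `B` give a nonconstant element, and Lüroth's
theorem identifies the image with a rational function field. The parametrization need not be known
to be birational. -/
theorem PlaneCurve.isRational_of_parametrization
    (h : ∀ (n : ℕ) (H : MvPolynomial (Fin 3) ℂ), H.IsHomogeneous n →
      (MvPolynomial.aeval γ H = 0 ↔ PlaneCurve.equation C ∣ H))
    (hγ : ∃ A B : MvPolynomial (Fin 3) ℂ, A.IsHomogeneous 1 ∧ B.IsHomogeneous 1 ∧
      MvPolynomial.aeval γ B ≠ 0 ∧
      ∀ a : ℂ, MvPolynomial.aeval γ A ≠ Polynomial.C a * MvPolynomial.aeval γ B) :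
    PlaneCurve.IsRational C := by
  have hdom : IsDomain (PlaneCurve.CoordRing C) := PlaneCurve.isIntegral_of_parametrization C h
  refine ⟨hdom, ?_⟩
  let E := FractionRing (Polynomial (RatFunc ℂ))
  let φ : PlaneCurve.CoordRing C →ₐ[ℂ] E :=
    (IsScalarTower.toAlgHom ℂ (Polynomial (RatFunc ℂ)) E).comp (PlaneCurve.coordRingHom C h)
  have hφ : Function.Injective φ :=
    (IsFractionRing.injective (Polynomial (RatFunc ℂ)) E).comp
      (PlaneCurve.coordRingHom_injective C h)
  let Φ : FractionRing (PlaneCurve.CoordRing C) →ₐ[ℂ] E := IsFractionRing.liftAlgHom hφ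
  let j : RatFunc ℂ →ₐ[ℂ] E :=
    (IsScalarTower.toAlgHom ℂ (Polynomial (RatFunc ℂ)) E).comp Polynomial.CAlgHom
  have hval : ∀ (n : ℕ) (H : MvPolynomial (Fin 3) ℂ), H.IsHomogeneous n →
      Φ (algebraMap _ _ (Ideal.Quotient.mk _ H : PlaneCurve.CoordRing C)) =
        (algebraMap (Polynomial (RatFunc ℂ)) E Polynomial.X) ^ n *
          j (algebraMap (Polynomial ℂ) (RatFunc ℂ) (MvPolynomial.aeval γ H)) := by
    intro n H hH
    rw [IsFractionRing.liftAlgHom_apply, IsFractionRing.lift_algebraMap]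
    change algebraMap (Polynomial (RatFunc ℂ)) E (coneParametrization γ H) = _
    rw [coneParametrization_of_isHomogeneous γ hH, map_mul, map_pow]
    rfl
  have hX : algebraMap (Polynomial (RatFunc ℂ)) E Polynomial.X ≠ 0 := by
    rw [ne_eq, IsFractionRing.to_map_eq_zero_iff]
    exact Polynomial.X_ne_zero
  have hquot : ∀ (n : ℕ) (f g : MvPolynomial (Fin 3) ℂ), f.IsHomogeneous n → g.IsHomogeneous n →
      Φ (algebraMap _ _ (Ideal.Quotient.mk _ f : PlaneCurve.CoordRing C) /
        algebraMap _ _ (Ideal.Quotient.mk _ g : PlaneCurve.CoordRing C)) =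
      j (algebraMap (Polynomial ℂ) (RatFunc ℂ) (MvPolynomial.aeval γ f) /
        algebraMap (Polynomial ℂ) (RatFunc ℂ) (MvPolynomial.aeval γ g)) := by
    intro n f g hf hg
    rw [map_div₀, map_div₀, hval n f hf, hval n g hg, mul_div_mul_left _ _ (pow_ne_zero n hX)]
  let M : IntermediateField ℂ (RatFunc ℂ) := ((PlaneCurve.functionField C).map Φ).comap j
  have hM : M.map j = (PlaneCurve.functionField C).map Φ := by
    refine le_antisymm ?_ ?_
    · rintro _ ⟨x, hx, rfl⟩
      exact hx
    · rintro x ⟨y, ⟨n, f, g, hf, hg, h0, rfl⟩, rfl⟩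
      refine ⟨_, ?_, (hquot n f g hf hg).symm⟩
      exact ⟨_, ⟨n, f, g, hf, hg, h0, rfl⟩, hquot n f g hf hg⟩
  have hne : M ≠ ⊥ := by
    obtain ⟨A, B, hA, hB, hB0, hAB⟩ := hγ
    intro hbot
    have hmem : algebraMap (Polynomial ℂ) (RatFunc ℂ) (MvPolynomial.aeval γ A) /
        algebraMap (Polynomial ℂ) (RatFunc ℂ) (MvPolynomial.aeval γ B) ∈ M := by
      refine ⟨_, ⟨1, A, B, hA, hB, ?_, rfl⟩, hquot 1 A B hA hB⟩
      rw [ne_eq, Ideal.Quotient.eq_zero_iff_mem, Ideal.mem_span_singleton, ← h 1 B hB]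
      exact hB0
    rw [hbot, IntermediateField.mem_bot] at hmem
    obtain ⟨a, ha⟩ := hmem
    have hB1 : algebraMap (Polynomial ℂ) (RatFunc ℂ) (MvPolynomial.aeval γ B) ≠ 0 :=
      (map_ne_zero_iff _ (RatFunc.algebraMap_injective ℂ)).2 hB0
    rw [eq_div_iff hB1, IsScalarTower.algebraMap_apply ℂ (Polynomial ℂ) (RatFunc ℂ), ← map_mul] at ha
    exact hAB a (RatFunc.algebraMap_injective ℂ ha).symm
  exact ⟨((PlaneCurve.functionField C).equivMap Φ).trans
    ((IntermediateField.equivOfEq hM.symm).trans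
      ((M.equivMap j).symm.trans (RatFunc.Luroth.algEquiv hne).symm))⟩

end Parametrization

/-! ### Restriction of forms to lines, and degrees of subfields of the rational function field -/

section Lines

open Polynomial

/-- The top coefficient along a line is the value of the form at the direction `q`. A curve through
the point `q` therefore meets the line in one fewer finite point. -/
theorem natDegree_aeval_line_le {K S : Type*} [CommRing K] [CommRing S] [Algebra K S] {n : ℕ}
    {H : MvPolynomial (Fin 3) K} (hH : H.IsHomogeneous n) (p q : Fin 3 → S) :
    (MvPolynomial.aeval (fun i => C (p i) + C (q i) * X) H : S[X]).natDegree ≤ n ∧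
      (MvPolynomial.aeval (fun i => C (p i) + C (q i) * X) H : S[X]).coeff n =
        MvPolynomial.aeval q H := by
  have hl : ∀ i, (C (p i) + C (q i) * X : S[X]).natDegree ≤ 1 := fun i => by compute_degree
  have hc : ∀ i, (C (p i) + C (q i) * X : S[X]).coeff 1 = q i := fun i => by simp [coeff_C]
  have hpow : ∀ i k, ((C (p i) + C (q i) * X : S[X]) ^ k).natDegree ≤ k := fun i k =>
    (natDegree_pow_le_of_le k (hl i)).trans (by simp)
  have hpow' : ∀ i k, ((C (p i) + C (q i) * X : S[X]) ^ k).coeff k = q i ^ k := fun i k => by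
    have := coeff_pow_of_natDegree_le (m := k) (hl i)
    rw [mul_one, hc] at this
    exact this
  rw [MvPolynomial.aeval_def, MvPolynomial.aeval_def, MvPolynomial.eval₂_eq',
    MvPolynomial.eval₂_eq']
  have hterm : ∀ d ∈ H.support,
      (algebraMap K S[X] (H.coeff d) * ∏ i, (C (p i) + C (q i) * X) ^ d i).natDegree ≤ n ∧
      (algebraMap K S[X] (H.coeff d) * ∏ i, (C (p i) + C (q i) * X) ^ d i).coeff n =
        algebraMap K S (H.coeff d) * ∏ i, q i ^ d i := by
    intro d hd
    have hn : n = d 0 + d 1 + d 2 := by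
      have := hH (MvPolynomial.mem_support_iff.1 hd)
      rw [Finsupp.weight_apply, Finsupp.sum_fintype _ _ (by simp), Fin.sum_univ_three] at this
      simpa using this.symm
    have h01 := natDegree_mul_le_of_le (hpow 0 (d 0)) (hpow 1 (d 1))
    have h012 := natDegree_mul_le_of_le h01 (hpow 2 (d 2))
    rw [Fin.prod_univ_three, Fin.prod_univ_three, Polynomial.algebraMap_apply, hn]
    refine ⟨(natDegree_C_mul_le _ _).trans h012, ?_⟩
    rw [coeff_C_mul, coeff_mul_add_eq_of_natDegree_le h01 (hpow 2 (d 2)),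
      coeff_mul_add_eq_of_natDegree_le (hpow 0 (d 0)) (hpow 1 (d 1)), hpow', hpow', hpow']
  refine ⟨natDegree_sum_le_of_forall_le _ _ fun d hd => (hterm d hd).1, ?_⟩
  rw [finsetSum_coeff]
  exact Finset.sum_congr rfl fun d hd => (hterm d hd).2

/-- The degree of a field extension generated by one element is at most the degree of any nonzero
polynomial that vanishes at the element. -/
theorem finrank_adjoin_simple_le {K L : Type*} [Field K] [Field L] [Algebra K L] {f g : L}
    (hfg : IntermediateField.adjoin K {f, g} = ⊤) {n : ℕ}
    {Q : (IntermediateField.adjoin K {f})[X]} (hQ : Q ≠ 0) (hn : Q.natDegree ≤ n)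
    (h0 : aeval g Q = 0) : Module.finrank (IntermediateField.adjoin K {f}) L ≤ n := by
  have hint : IsIntegral (IntermediateField.adjoin K {f}) g := by
    have : IsAlgebraic (IntermediateField.adjoin K {f}) g := ⟨Q, hQ, h0⟩
    exact this.isIntegral
  have htop : IntermediateField.adjoin (IntermediateField.adjoin K {f}) {g} = ⊤ := by
    rw [← IntermediateField.restrictScalars_eq_top_iff (K := K),
      IntermediateField.adjoin_adjoin_left, ← hfg]
    congr 1
  rw [← (IntermediateField.topEquiv (F := IntermediateField.adjoin K {f}) (E := L)).toLinearEquiv.finrank_eq,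
    ← htop, IntermediateField.adjoin.finrank hint]
  exact (natDegree_le_natDegree (minpoly.degree_le_of_ne_zero _ _ hQ h0)).trans hn

/-- The denominator of a fraction of coprime polynomials. -/
theorem natDegree_le_finrank_of_isCoprime {K : Type*} [Field K] {a c : K[X]} (hc : c ≠ 0)
    (h : IsCoprime a c) : c.natDegree ≤ Module.finrank (IntermediateField.adjoin K
      {algebraMap K[X] (RatFunc K) a / algebraMap K[X] (RatFunc K) c}) (RatFunc K) := by
  set f := algebraMap K[X] (RatFunc K) a / algebraMap K[X] (RatFunc K) c with hf
  -- The degree over `K(f)` is the larger of the degrees of the reduced numerator and denominator,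
  -- and by coprimality `c` divides the reduced denominator.
  rw [RatFunc.finrank_eq_max_natDegree]
  refine le_max_of_le_right (natDegree_le_of_dvd ?_ (RatFunc.denom_ne_zero f))
  have h1 : a * f.denom = f.num * c := by
    have h2 := (RatFunc.num_div_denom f).trans hf
    rw [div_eq_div_iff ((map_ne_zero_iff _ (RatFunc.algebraMap_injective K)).2
      (RatFunc.denom_ne_zero f)) ((map_ne_zero_iff _ (RatFunc.algebraMap_injective K)).2 hc),
      ← map_mul, ← map_mul] at h2
    exact (RatFunc.algebraMap_injective K h2).symm
  exact h.symm.dvd_of_dvd_mul_left (h1 ▸ dvd_mul_left c f.num)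

end Lines

/-! ### Change of parameter -/

section Moebius

open Polynomial

/-- A change of the parameter `X` to `t₀ + 1 / X`. -/
theorem exists_moebius {K : Type*} [Field K] (t₀ : K) :
    ∃ σ : RatFunc K ≃ₐ[K] RatFunc K, ∀ (n : ℕ) (a : K[X]), a.natDegree ≤ n →
      σ (algebraMap K[X] (RatFunc K) a) * RatFunc.X ^ n =
        algebraMap K[X] (RatFunc K) (reflect n (a.comp (X + C t₀))) := by
  have hX : (RatFunc.X : RatFunc K) ≠ 0 := RatFunc.X_ne_zero
  set f : RatFunc K := RatFunc.C t₀ + RatFunc.X⁻¹ with hf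
  have htop : IntermediateField.adjoin K {f} = ⊤ := by
    rw [eq_top_iff, ← RatFunc.adjoin_X, IntermediateField.adjoin_simple_le_iff]
    have h1 : RatFunc.X = (f - algebraMap K (RatFunc K) t₀)⁻¹ := by
      rw [hf, RatFunc.algebraMap_eq_C, add_sub_cancel_left, inv_inv]
    rw [h1]
    exact inv_mem (sub_mem (IntermediateField.mem_adjoin_simple_self K f) (algebraMap_mem _ _))
  have htr : Transcendental K f := by
    refine RatFunc.transcendental_of_ne_C f ?_
    rintro ⟨c, hc⟩
    have h2 : (RatFunc.X : RatFunc K) = RatFunc.C (c - t₀)⁻¹ := by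
      rw [map_inv₀, map_sub, ← hc, hf, add_sub_cancel_left, inv_inv]
    have h3 := congrArg RatFunc.num h2
    rw [RatFunc.num_X, RatFunc.num_C] at h3
    exact X_ne_C _ h3
  refine ⟨(RatFunc.algEquivOfTranscendental f htr).trans
    ((IntermediateField.equivOfEq htop).trans IntermediateField.topEquiv), ?_⟩
  intro n a ha
  have hσ : ((RatFunc.algEquivOfTranscendental f htr).trans
      ((IntermediateField.equivOfEq htop).trans IntermediateField.topEquiv))
      (algebraMap K[X] (RatFunc K) a) = aeval f a := by
    rw [AlgEquiv.trans_apply, RatFunc.algEquivOfTranscendental_algebraMap]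
    change (IntermediateField.val (IntermediateField.adjoin K {f}))
      (aeval (IntermediateField.AdjoinSimple.gen K f) a) = _
    rw [← aeval_algHom_apply]
    rfl
  rw [hσ]
  have hdeg : (a.comp (X + C t₀)).natDegree ≤ n := by
    rw [natDegree_comp, natDegree_X_add_C, mul_one]
    exact ha
  have := invertibleOfNonzero (inv_ne_zero hX)
  -- Reversing coefficients turns the value at `1 / X` into the value at `X`, up to the factor `X ^
  -- n`.
  have h4 := eval₂_reflect_mul_pow (algebraMap K (RatFunc K)) (RatFunc.X⁻¹) n _ hdeg
  have h5 : ⅟(RatFunc.X⁻¹ : RatFunc K) = RatFunc.X := by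
    rw [invOf_eq_inv, inv_inv]
  rw [h5, eval₂_comp] at h4
  have h6 : eval₂ (algebraMap K (RatFunc K)) RatFunc.X (reflect n (a.comp (X + C t₀))) =
      algebraMap K[X] (RatFunc K) (reflect n (a.comp (X + C t₀))) := by
    rw [← aeval_def, ← RatFunc.algebraMap_X, aeval_algebraMap_apply, aeval_X_left_apply]
  have h7 : eval₂ (algebraMap K (RatFunc K)) (RatFunc.X⁻¹) (X + C t₀) = f := by
    simp [hf, add_comm]
  rw [h6, h7, ← aeval_def] at h4
  rw [← h4, mul_assoc, ← mul_pow, inv_mul_cancel₀ hX, one_pow, mul_one]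

end Moebius

/-! ### Parametrizations without base points and with no pole at infinity -/

section NormalizedParametrization

open Polynomial

theorem exists_common_root_free {K : Type*} [Field K] (α β : RatFunc K) (n : ℕ) (a b c : K[X])
    (hn : c.natDegree = n) (hc : c ≠ 0) (ha : a.natDegree ≤ c.natDegree)
    (hb : b.natDegree ≤ c.natDegree)
    (hα : α * algebraMap K[X] (RatFunc K) c = algebraMap K[X] (RatFunc K) a)
    (hβ : β * algebraMap K[X] (RatFunc K) c = algebraMap K[X] (RatFunc K) b) :
    ∃ a b c : K[X], c ≠ 0 ∧ a.natDegree ≤ c.natDegree ∧ b.natDegree ≤ c.natDegree ∧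
      α * algebraMap K[X] (RatFunc K) c = algebraMap K[X] (RatFunc K) a ∧
      β * algebraMap K[X] (RatFunc K) c = algebraMap K[X] (RatFunc K) b ∧
      ∀ t, ¬ (a.eval t = 0 ∧ b.eval t = 0 ∧ c.eval t = 0) := by
  induction n generalizing a b c with
  | zero =>
    refine ⟨a, b, c, hc, ha, hb, hα, hβ, fun t ⟨_, _, h⟩ => hc ?_⟩
    rw [eq_C_of_natDegree_eq_zero hn] at h ⊢
    rw [eval_C] at h
    rw [h, C_0]
  | succ n ih =>
    by_cases h : ∃ t, a.eval t = 0 ∧ b.eval t = 0 ∧ c.eval t = 0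
    · obtain ⟨t, h1, h2, h3⟩ := h
      obtain ⟨a', rfl⟩ := dvd_iff_isRoot.2 h1
      obtain ⟨b', rfl⟩ := dvd_iff_isRoot.2 h2
      obtain ⟨c', rfl⟩ := dvd_iff_isRoot.2 h3
      have hX : (X - C t : K[X]) ≠ 0 := X_sub_C_ne_zero t
      have hX' : algebraMap K[X] (RatFunc K) (X - C t) ≠ 0 :=
        (map_ne_zero_iff _ (RatFunc.algebraMap_injective K)).2 hX
      have hc' : c' ≠ 0 := right_ne_zero_of_mul hc
      have hdeg : ∀ p : K[X], p ≠ 0 → ((X - C t) * p).natDegree = 1 + p.natDegree := fun p hp => by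
        rw [natDegree_mul hX hp, natDegree_X_sub_C]
      have hdeg' : ∀ p : K[X], ((X - C t) * p).natDegree ≤ ((X - C t) * c').natDegree →
          p.natDegree ≤ c'.natDegree := by
        intro p hp
        by_cases h0 : p = 0
        · simp [h0]
        · rw [hdeg p h0, hdeg c' hc'] at hp
          omega
      refine ih a' b' c' (by rw [hdeg c' hc'] at hn; omega) hc' (hdeg' _ ha) (hdeg' _ hb) ?_ ?_
      · rw [map_mul, map_mul, mul_left_comm] at hα
        exact mul_left_cancel₀ hX' hα
      · rw [map_mul, map_mul, mul_left_comm] at hβ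
        exact mul_left_cancel₀ hX' hβ
    · push Not at h
      exact ⟨a, b, c, hc, ha, hb, hα, hβ, fun t ⟨h1, h2, h3⟩ => h t h1 h2 h3⟩

/-- A parameter `t₀` where the common denominator does not vanish is moved to infinity. The new
denominator then has the full degree `n`, which bounds both numerators; common roots are divided out
afterwards. -/
theorem exists_normalized_parametrization {K : Type*} [Field K] [Infinite K] (α β : RatFunc K) :
    ∃ (σ : RatFunc K ≃ₐ[K] RatFunc K) (a b c : K[X]), c ≠ 0 ∧ a.natDegree ≤ c.natDegree ∧
      b.natDegree ≤ c.natDegree ∧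
      σ α * algebraMap K[X] (RatFunc K) c = algebraMap K[X] (RatFunc K) a ∧
      σ β * algebraMap K[X] (RatFunc K) c = algebraMap K[X] (RatFunc K) b ∧
      ∀ t, ¬ (a.eval t = 0 ∧ b.eval t = 0 ∧ c.eval t = 0) := by
  set c := α.denom * β.denom with hcdef
  have hc : c ≠ 0 := mul_ne_zero α.denom_ne_zero β.denom_ne_zero
  have hinj := RatFunc.algebraMap_injective K
  have hden : ∀ f : RatFunc K, f * algebraMap K[X] (RatFunc K) f.denom =
      algebraMap K[X] (RatFunc K) f.num := fun f => by
    rw [← eq_div_iff ((map_ne_zero_iff _ hinj).2 f.denom_ne_zero)]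
    exact (RatFunc.num_div_denom f).symm
  have hα : α * algebraMap K[X] (RatFunc K) c =
      algebraMap K[X] (RatFunc K) (α.num * β.denom) := by
    rw [hcdef, map_mul, map_mul, ← mul_assoc, hden]
  have hβ : β * algebraMap K[X] (RatFunc K) c =
      algebraMap K[X] (RatFunc K) (β.num * α.denom) := by
    rw [hcdef, map_mul, map_mul, mul_left_comm, hden, mul_comm]
  set a := α.num * β.denom
  set b := β.num * α.denom
  obtain ⟨t₀, ht₀⟩ : ∃ t, c.eval t ≠ 0 := by
    by_contra! h
    exact hc (Polynomial.funext fun t => by rw [h t, eval_zero])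
  set n := max a.natDegree (max b.natDegree c.natDegree) with hn
  obtain ⟨σ, hσ⟩ := exists_moebius t₀
  have hrefl : ∀ p : K[X], p.natDegree ≤ n → (reflect n (p.comp (X + C t₀))).natDegree ≤ n := by
    intro p hp
    refine natDegree_reflect_le.trans (max_le le_rfl ?_)
    rw [natDegree_comp, natDegree_X_add_C, mul_one]
    exact hp
  have hca : a.natDegree ≤ n := le_max_left _ _
  have hcb : b.natDegree ≤ n := (le_max_left _ _).trans (le_max_right _ _)
  have hcc : c.natDegree ≤ n := (le_max_right _ _).trans (le_max_right _ _)
  have hcoeff : (reflect n (c.comp (X + C t₀))).coeff n ≠ 0 := by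
    rw [coeff_reflect, revAt_le le_rfl, Nat.sub_self, coeff_zero_eq_eval_zero, eval_comp]
    simpa using ht₀
  have hne : reflect n (c.comp (X + C t₀)) ≠ 0 := fun h => hcoeff (by rw [h, coeff_zero])
  have hdeg : (reflect n (c.comp (X + C t₀))).natDegree = n :=
    le_antisymm (hrefl c hcc) (le_natDegree_of_ne_zero hcoeff)
  refine ⟨σ, exists_common_root_free (σ α) (σ β) n (reflect n (a.comp (X + C t₀)))
    (reflect n (b.comp (X + C t₀))) (reflect n (c.comp (X + C t₀))) hdeg hne
    ((hrefl a hca).trans hdeg.ge) ((hrefl b hcb).trans hdeg.ge) ?_ ?_⟩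
  · rw [← hσ n c hcc, ← hσ n a hca, ← hα, map_mul σ, mul_assoc]
  · rw [← hσ n c hcc, ← hσ n b hcb, ← hβ, map_mul σ, mul_assoc]

end NormalizedParametrization

/-! ### A quartic needs parametrizations of degree at least four -/

section DegreeFour

open Polynomial

theorem card_planeMonomial_four : Fintype.card (PlaneMonomial 4) = 15 := by
  rw [Fintype.card_coe]
  decide

theorem coeff_ternaryForm {d : ℕ} (c : PlaneMonomial d → ℂ) (m : PlaneMonomial d) :
    (ternaryForm c).coeff m.1 = c m := by
  classical
  rw [ternaryForm, MvPolynomial.coeff_sum, Finset.sum_eq_single m]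
  · simp
  · intro b _ hb
    rw [MvPolynomial.coeff_monomial, if_neg fun h => hb (Subtype.ext h)]
  · simp

theorem ternaryForm_coeff {d : ℕ} {F : MvPolynomial (Fin 3) ℂ} (hF : F.IsHomogeneous d) :
    ternaryForm (fun m : PlaneMonomial d => F.coeff m.1) = F := by
  classical
  ext m
  by_cases hm : m ∈ Finset.finsuppAntidiag (Finset.univ : Finset (Fin 3)) d
  · exact coeff_ternaryForm _ ⟨m, hm⟩
  · have hdeg : m.degree ≠ d := by
      intro h
      refine hm (Finset.mem_finsuppAntidiag.2 ⟨?_, Finset.subset_univ _⟩)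
      rw [← h, Finsupp.degree_eq_sum]
    rw [(isHomogeneous_ternaryForm _).coeff_eq_zero hdeg, hF.coeff_eq_zero hdeg]

theorem eq_C_mul_of_dvd_of_isHomogeneous {K : Type*} [Field K] {σ : Type*} {d : ℕ}
    {F G : MvPolynomial σ K} (hF : F.IsHomogeneous d) (hG : G.IsHomogeneous d) (h : F ∣ G) :
    ∃ k : K, G = MvPolynomial.C k * F := by
  by_cases hG0 : G = 0
  · exact ⟨0, by simp [hG0]⟩
  obtain ⟨q, rfl⟩ := h
  have hF0 := left_ne_zero_of_mul hG0
  have hq0 := right_ne_zero_of_mul hG0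
  have := MvPolynomial.totalDegree_mul_of_isDomain hF0 hq0
  rw [hG.totalDegree hG0, hF.totalDegree hF0] at this
  obtain ⟨k, hk⟩ : ∃ k, q = MvPolynomial.C k := ⟨_, MvPolynomial.totalDegree_eq_zero_iff_eq_C.1 (by omega)⟩
  exact ⟨k, by rw [hk, mul_comm]⟩

/-- A plane quartic form that generates the ideal of a parametrized curve is not parametrized by
polynomials of degree less than four. -/
theorem four_le_natDegree_of_generates {F : MvPolynomial (Fin 3) ℂ} (hF : F.IsHomogeneous 4)
    {γ : Fin 3 → ℂ[X]} {n : ℕ} (hγ : ∀ i, (γ i).natDegree ≤ n)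
    (hP : ∀ H : MvPolynomial (Fin 3) ℂ, H.IsHomogeneous 4 →
      MvPolynomial.aeval γ H = 0 → F ∣ H) : 4 ≤ n := by
  by_contra! hn
  -- Restriction to a curve of degree at most 3 maps the 15-dimensional space of quartic forms to
  -- the 13-dimensional space of polynomials of degree at most 12. The kernel would have dimension
  -- at least 2, but it lies in the span of `F`.
  let e : (PlaneMonomial 4 → ℂ) →ₗ[ℂ] ℂ[X] :=
    { toFun := fun c => MvPolynomial.aeval γ (ternaryForm c)
      map_add' := fun c c' => by
        rw [← map_add]
        congr 1
        simp [ternaryForm, Finset.sum_add_distrib]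
      map_smul' := fun s c => by
        rw [RingHom.id_apply, ← map_smul]
        congr 1
        simp [ternaryForm, Finset.smul_sum, MvPolynomial.smul_monomial] }
  have hdeg : ∀ c, e c ∈ degreeLT ℂ 13 := by
    intro c
    rw [mem_degreeLT]
    have h1 : (MvPolynomial.aeval γ (ternaryForm c)).natDegree ≤ 12 := by
      rw [ternaryForm, map_sum]
      refine natDegree_sum_le_of_forall_le _ _ fun m _ => ?_
      rw [MvPolynomial.aeval_monomial, Finsupp.prod_fintype _ _ (by simp), Fin.prod_univ_three]
      have hm := (Finset.mem_finsuppAntidiag.1 m.2).1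
      rw [Fin.sum_univ_three] at hm
      have hp : ∀ i, (γ i ^ m.1 i).natDegree ≤ m.1 i * 3 := fun i =>
        natDegree_pow_le_of_le _ ((hγ i).trans (by omega))
      rw [Polynomial.algebraMap_apply]
      refine (natDegree_C_mul_le _ _).trans ?_
      refine (natDegree_mul_le_of_le (natDegree_mul_le_of_le (hp 0) (hp 1)) (hp 2)).trans ?_
      omega
    have h2 : (e c).degree ≤ (12 : ℕ) := degree_le_of_natDegree_le h1
    exact h2.trans_lt (by norm_num)
  let e' : (PlaneMonomial 4 → ℂ) →ₗ[ℂ] degreeLT ℂ 13 := e.codRestrict _ hdeg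
  have hker : LinearMap.ker e' ≤ Submodule.span ℂ {fun m : PlaneMonomial 4 => F.coeff m.1} := by
    intro c hc
    have h0 : MvPolynomial.aeval γ (ternaryForm c) = 0 := congrArg Subtype.val hc
    obtain ⟨k, hk⟩ := eq_C_mul_of_dvd_of_isHomogeneous hF (isHomogeneous_ternaryForm c)
      (hP _ (isHomogeneous_ternaryForm c) h0)
    rw [Submodule.mem_span_singleton]
    refine ⟨k, ?_⟩
    ext m
    rw [← coeff_ternaryForm c m, hk, MvPolynomial.coeff_C_mul]
    rfl
  have h1 := LinearMap.finrank_range_add_finrank_ker e'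
  have h2 : Module.finrank ℂ (PlaneMonomial 4 → ℂ) = 15 := by
    rw [Module.finrank_fintype_fun_eq_card, card_planeMonomial_four]
  have h3 : Module.finrank ℂ (degreeLT ℂ 13) = 13 := by
    rw [(degreeLTEquiv ℂ 13).finrank_eq]
    simp
  have h4 := Submodule.finrank_mono hker
  have h5 := finrank_span_le_card (R := ℂ) ({fun m : PlaneMonomial 4 => F.coeff m.1} : Set (PlaneMonomial 4 → ℂ))
  have : FiniteDimensional ℂ (degreeLT ℂ 13) := Module.finite_of_finrank_pos (by omega)
  have h6 := Submodule.finrank_le (LinearMap.range e')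
  simp at h5
  omega

end DegreeFour

/-! ### From a rational quartic to its four poles -/

section Reconstruction

open Polynomial

theorem exists_eq_C_mul_prod_add {K : Type*} [Field K] [Infinite K] {η : Fin 4 → K}
    (hη : Function.Injective η) {F : MvPolynomial (Fin 3) K} (hF : F.IsHomogeneous 4)
    (hY : ∀ i, MvPolynomial.eval ![1, η i, 0] F = 0) :
    ∃ (κ : K) (r : MvPolynomial (Fin 3) K), r.IsHomogeneous 3 ∧ F = MvPolynomial.C κ *
      ∏ i, (MvPolynomial.X 1 - MvPolynomial.C (η i) * MvPolynomial.X 0) +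
      MvPolynomial.X 2 * r := by
  obtain ⟨q, r, hqr⟩ := exists_eq_prod_mul_add_of_eval_eq_zero hη F (by
    intro i s
    have h : ![s, η i * s, 0] = s • ![1, η i, 0] := by
      ext l
      fin_cases l <;> simp [mul_comm]
    rw [h, hF.eval_smul, hY, mul_zero])
  have hP : (∏ i, (MvPolynomial.X 1 - MvPolynomial.C (η i) * MvPolynomial.X 0) :
      MvPolynomial (Fin 3) K).IsHomogeneous 4 :=
    MvPolynomial.IsHomogeneous.prod Finset.univ _ (fun _ => 1) fun i _ =>
      (MvPolynomial.isHomogeneous_X _ _).sub ((MvPolynomial.isHomogeneous_X _ _).C_mul _)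
  have h := congrArg (MvPolynomial.homogeneousComponent 4) hqr
  rw [map_add, MvPolynomial.homogeneousComponent_mul_of_isHomogeneous hP,
    MvPolynomial.homogeneousComponent_mul_of_isHomogeneous (MvPolynomial.isHomogeneous_X _ _),
    MvPolynomial.homogeneousComponent_of_mem hF, if_pos rfl, if_pos le_rfl,
    if_pos (by norm_num), Nat.sub_self, MvPolynomial.homogeneousComponent_zero] at h
  exact ⟨_, _, MvPolynomial.homogeneousComponent_isHomogeneous 3 _,
    by rw [h, mul_comm (MvPolynomial.C _)]⟩

/-- A polynomial parametrization of degree four is determined by its values at four poles. -/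
theorem exists_eq_rationalCurve {K : Type*} [Field K] {τ η : Fin 4 → K} (hτ : Function.Injective τ)
    {a b c : K[X]} (hc4 : c.natDegree = 4) (ha : a.natDegree ≤ 4) (hb : b.natDegree ≤ 4)
    (hcτ : ∀ i, c.eval (τ i) = 0) (haτ : ∀ i, a.eval (τ i) ≠ 0)
    (hbτ : ∀ i, b.eval (τ i) = η i * a.eval (τ i)) :
    ∃ (μ : Fin 4 → K) (a₀ b₀ : K), (∀ i, μ i ≠ 0) ∧
      ∀ l, ![a, b, c] l = C c.leadingCoeff * rationalCurve η τ μ a₀ b₀ l := by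
  have hc : c ≠ 0 := by
    rintro rfl
    simp at hc4
  set P : K[X] := ∏ i, (X - C (τ i)) with hP
  have hP4 : P.natDegree = 4 := by
    rw [hP, natDegree_prod_of_monic _ _ fun i _ => monic_X_sub_C _]
    simp
  have hP0 : P ≠ 0 := fun h => by rw [h] at hP4; simp at hP4
  have hdvd : ∀ p : K[X], (∀ i, p.eval (τ i) = 0) → P ∣ p := fun p hp =>
    Finset.prod_dvd_of_coprime ((pairwise_coprime_X_sub_C hτ).set_pairwise _)
      fun i _ => dvd_iff_isRoot.2 (hp i)
  have hconst : ∀ p : K[X], p.natDegree ≤ 4 → (∀ i, p.eval (τ i) = 0) →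
      ∃ s, p = C s * P := by
    intro p hp4 hp
    obtain ⟨q, rfl⟩ := hdvd p hp
    by_cases hq : q = 0
    · exact ⟨0, by simp [hq]⟩
    · rw [natDegree_mul hP0 hq, hP4] at hp4
      rw [eq_C_of_natDegree_eq_zero (p := q) (by omega)]
      exact ⟨_, mul_comm _ _⟩
  set k := c.leadingCoeff with hk
  have hk0 : k ≠ 0 := leadingCoeff_ne_zero.2 hc
  have hcP : c = C k * P := by
    obtain ⟨s, hs⟩ := hconst c hc4.le hcτ
    have : k = s := by
      rw [hk, hs, leadingCoeff_mul, leadingCoeff_C, (monic_prod_X_sub_C τ Finset.univ).leadingCoeff,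
        mul_one]
    rw [this, ← hs]
  set e : Fin 4 → K[X] := fun j => ∏ k ∈ Finset.univ.erase j, (X - C (τ k)) with he
  have hedeg : ∀ j, (e j).natDegree ≤ 4 := by
    intro j
    rw [he, natDegree_prod_of_monic _ _ fun i _ => monic_X_sub_C _]
    simp
  -- Lagrange interpolation at the four poles leaves a polynomial of degree at most 4 vanishing at
  -- all of them, hence a constant multiple of `P`.
  have hint : ∀ p : K[X], p.natDegree ≤ 4 → ∃ s : K, p = C k * (C s * P +
      ∑ j, C (k⁻¹ * p.eval (τ j) / (e j).eval (τ j)) * e j) := by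
    intro p hp
    obtain ⟨s, hs⟩ := hconst (C k⁻¹ * p - ∑ j, C (k⁻¹ * p.eval (τ j) / (e j).eval (τ j)) * e j)
      (by
        refine (natDegree_sub_le _ _).trans (max_le ((natDegree_C_mul_le _ _).trans hp) ?_)
        exact natDegree_sum_le_of_forall_le _ _ fun j _ =>
          (natDegree_C_mul_le _ _).trans (hedeg j))
      (by
        intro i
        rw [eval_sub, eval_finsetSum, Finset.sum_eq_single i]
        · rw [eval_mul, eval_C, eval_mul, eval_C, div_mul_cancel₀ _ (eval_prod_erase_ne_zero hτ i),
            sub_self]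
        · intro j _ hj
          rw [eval_mul, eval_prod_erase_of_ne τ hj.symm, mul_zero]
        · simp)
    refine ⟨s, ?_⟩
    rw [← hs, sub_add_cancel, ← mul_assoc, ← C_mul, mul_inv_cancel₀ hk0, C_1, one_mul]
  obtain ⟨a₀, ha₀⟩ := hint a ha
  obtain ⟨b₀, hb₀⟩ := hint b hb
  refine ⟨fun j => k⁻¹ * a.eval (τ j) / (e j).eval (τ j), a₀, b₀, fun i => ?_, fun l => ?_⟩
  · exact div_ne_zero (mul_ne_zero (inv_ne_zero hk0) (haτ i)) (eval_prod_erase_ne_zero hτ i)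
  · fin_cases l
    · exact ha₀
    · refine hb₀.trans ?_
      congr 2
      refine Finset.sum_congr rfl fun j _ => ?_
      rw [hbτ]
      congr 2
      ring
    · exact hcP


theorem MvPolynomial.algebraMap_eval_eq_aeval {K A σ : Type*} [CommRing K] [CommRing A] [Algebra K A]
    (x : σ → K) (F : MvPolynomial σ K) :
    algebraMap K A (MvPolynomial.eval x F) = MvPolynomial.aeval (fun i => algebraMap K A (x i)) F := by
  rw [← MvPolynomial.coe_aeval_eq_eval]
  exact (MvPolynomial.aeval_algebraMap_apply A x F).symm

theorem finrank_adjoin_simple_le_of_form {K L : Type*} [Field K] [Field L] [Algebra K L] {f g : L}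
    (hfg : IntermediateField.adjoin K {f, g} = ⊤) {n : ℕ} {F : MvPolynomial (Fin 3) K}
    (p q : Fin 3 → IntermediateField.adjoin K {f})
    (hQ : (MvPolynomial.aeval (fun i => C (p i) + C (q i) * X) F :
      (IntermediateField.adjoin K {f})[X]) ≠ 0)
    (hn : (MvPolynomial.aeval (fun i => C (p i) + C (q i) * X) F :
      (IntermediateField.adjoin K {f})[X]).natDegree ≤ n)
    (h0 : MvPolynomial.aeval (fun i => (p i : L) + q i * g) F = 0) :
    Module.finrank (IntermediateField.adjoin K {f}) L ≤ n := by
  refine finrank_adjoin_simple_le hfg hQ hn ?_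
  have h := MvPolynomial.comp_aeval_apply (fun i => C (p i) + C (q i) * X)
    ((aeval g : (IntermediateField.adjoin K {f})[X] →ₐ[_] L).restrictScalars K) F
  refine h.trans ?_
  rw [← h0]
  congr 1
  congr 1
  ext i
  simp

theorem four_le_of_dvd_of_isHomogeneous {F : MvPolynomial (Fin 3) ℂ} (hF : F.IsHomogeneous 4) (hF0 : F ≠ 0)
    (n : ℕ) (H : MvPolynomial (Fin 3) ℂ) (hH : H.IsHomogeneous n) (h0 : H ≠ 0) (h : F ∣ H) :
    4 ≤ n := by
  obtain ⟨q, rfl⟩ := h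
  have := MvPolynomial.totalDegree_mul_of_isDomain hF0 (right_ne_zero_of_mul h0)
  rw [hF.totalDegree hF0, hH.totalDegree h0] at this
  omega

section Normalized

variable {η : Fin 4 → ℂ} {F : MvPolynomial (Fin 3) ℂ} {α β : RatFunc ℂ}

/-- If `κ = 0` then `F` is `X₂` times a cubic. As the third coordinate is 1, the cubic vanishes on
the curve and would be divisible by `F`. -/
theorem exists_eq_C_mul_prod_add_of_generates (hη : Function.Injective η)
    (hF : F.IsHomogeneous 4) (hY : ∀ i, MvPolynomial.eval ![1, η i, 0] F = 0) (hF0 : F ≠ 0)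
    (hP : ∀ (n : ℕ) (H : MvPolynomial (Fin 3) ℂ), H.IsHomogeneous n →
      (MvPolynomial.aeval ![α, β, 1] H = 0 ↔ F ∣ H)) :
    ∃ (κ : ℂ) (r : MvPolynomial (Fin 3) ℂ), κ ≠ 0 ∧ F = MvPolynomial.C κ *
      ∏ i, (MvPolynomial.X 1 - MvPolynomial.C (η i) * MvPolynomial.X 0) +
      MvPolynomial.X 2 * r := by
  obtain ⟨κ, r, hr, hκr⟩ := exists_eq_C_mul_prod_add hη hF hY
  refine ⟨κ, r, ?_, hκr⟩
  rintro rfl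
  rw [map_zero, zero_mul, zero_add] at hκr
  have hr0 : r ≠ 0 := by
    rintro rfl
    rw [mul_zero] at hκr
    exact hF0 hκr
  have h1 : MvPolynomial.aeval ![α, β, 1] F = 0 := (hP 4 F hF).2 dvd_rfl
  rw [hκr, map_mul, MvPolynomial.aeval_X] at h1
  have h2 : MvPolynomial.aeval ![α, β, 1] r = 0 := by simpa using h1
  have := four_le_of_dvd_of_isHomogeneous hF hF0 3 r hr hr0 ((hP 3 r hr).1 h2)
  omega

/-- Lines through `(0 : 1 : 0)`, a point off the curve: `β` is a root of `F(α, X, 1)`, whose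
coefficient in degree 4 is `F(0, 1, 0) ≠ 0`. -/
theorem finrank_adjoin_le_four (hF : F.IsHomogeneous 4)
    (hF2 : MvPolynomial.eval ![0, 1, 0] F ≠ 0)
    (h0 : MvPolynomial.aeval ![α, β, 1] F = 0) (hgen : IntermediateField.adjoin ℂ {α, β} = ⊤) :
    Module.finrank (IntermediateField.adjoin ℂ {α}) (RatFunc ℂ) ≤ 4 := by
  set p : Fin 3 → IntermediateField.adjoin ℂ {α} :=
    ![⟨α, IntermediateField.mem_adjoin_simple_self ℂ α⟩, 0, 1] with hp
  set q : Fin 3 → IntermediateField.adjoin ℂ {α} := ![0, 1, 0] with hq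
  have hQ := natDegree_aeval_line_le hF p q
  refine finrank_adjoin_simple_le_of_form hgen p q ?_ hQ.1 ?_
  · intro h
    rw [h, coeff_zero] at hQ
    refine hF2 ((algebraMap ℂ (IntermediateField.adjoin ℂ {α})).injective ?_)
    rw [map_zero, hQ.2, MvPolynomial.algebraMap_eval_eq_aeval]
    congr 2
    ext i
    fin_cases i <;> simp [hq]
  · rw [← h0]
    congr 2
    ext i
    fin_cases i <;> simp [hp, hq]

/-- Lines through `(1 : e : 0)`, a point of the curve: with `f = β - e α`, the function `α` is a
root of `F(X, f + e X, 1)`, whose coefficient in degree 4 is `F(1, e, 0) = 0`. -/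
theorem finrank_adjoin_le_three (hF : F.IsHomogeneous 4) (hF0 : F ≠ 0)
    (hF2 : MvPolynomial.eval ![0, 1, 0] F ≠ 0)
    (hP : ∀ (n : ℕ) (H : MvPolynomial (Fin 3) ℂ), H.IsHomogeneous n →
      (MvPolynomial.aeval ![α, β, 1] H = 0 ↔ F ∣ H))
    (hgen : IntermediateField.adjoin ℂ {α, β} = ⊤) {e : ℂ}
    (hY : MvPolynomial.eval ![1, e, 0] F = 0) :
    Module.finrank (IntermediateField.adjoin ℂ {β - RatFunc.C e * α}) (RatFunc ℂ) ≤ 3 := by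
  set f := β - RatFunc.C e * α with hf
  have hmem := IntermediateField.mem_adjoin_simple_self ℂ f
  set p : Fin 3 → IntermediateField.adjoin ℂ {f} := ![0, ⟨f, hmem⟩, 1] with hp
  set q : Fin 3 → IntermediateField.adjoin ℂ {f} := ![1, algebraMap _ _ e, 0] with hq
  have hQ := natDegree_aeval_line_le hF p q
  have hgen' : IntermediateField.adjoin ℂ {f, α} = ⊤ := by
    rw [eq_top_iff, ← hgen, IntermediateField.adjoin_le_iff]
    have hα : α ∈ IntermediateField.adjoin ℂ {f, α} := IntermediateField.subset_adjoin _ _ (by simp)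
    have hf' : f ∈ IntermediateField.adjoin ℂ {f, α} := IntermediateField.subset_adjoin _ _ (by simp)
    rintro x (rfl | rfl)
    · exact hα
    · have hx : x = f + algebraMap ℂ (RatFunc ℂ) e * α := by
        rw [hf, RatFunc.algebraMap_eq_C, sub_add_cancel]
      rw [hx]
      exact add_mem hf' (mul_mem (algebraMap_mem _ e) hα)
  have hlin : ∀ k : ℂ, f ≠ RatFunc.C k := by
    intro k hk
    set H : MvPolynomial (Fin 3) ℂ := MvPolynomial.X 1 - MvPolynomial.C e * MvPolynomial.X 0 -
      MvPolynomial.C k * MvPolynomial.X 2 with hH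
    have hH1 : H.IsHomogeneous 1 := ((MvPolynomial.isHomogeneous_X _ _).sub
      ((MvPolynomial.isHomogeneous_X _ _).C_mul _)).sub ((MvPolynomial.isHomogeneous_X _ _).C_mul _)
    have hH0 : H ≠ 0 := by
      intro h
      have := congrArg (MvPolynomial.eval ![0, 1, 0]) h
      simp [hH] at this
    have := four_le_of_dvd_of_isHomogeneous hF hF0 1 H hH1 hH0 ((hP 1 H hH1).1 (by
      simp only [hH, map_sub, map_mul, MvPolynomial.aeval_X, MvPolynomial.aeval_C,
        RatFunc.algebraMap_eq_C, Matrix.cons_val_zero, Matrix.cons_val_one, Matrix.cons_val, mul_one]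
      rw [← hf, hk, sub_self]))
    omega
  refine finrank_adjoin_simple_le_of_form hgen' (F := F) p q ?_ ?_ ?_
  -- Setting the variable to 0 leaves `F(0, f, 1)`, which is nonzero: `f` is nonconstant, hence
  -- transcendental, and `F(0, X, 1)` has top coefficient `F(0, 1, 0)`.
  · intro h
    have h1 := congrArg (Polynomial.aeval (R := IntermediateField.adjoin ℂ {f}) (0 : RatFunc ℂ)) h
    have h2 := MvPolynomial.comp_aeval_apply (fun i => C (p i) + C (q i) * X)
      ((aeval (0 : RatFunc ℂ) : (IntermediateField.adjoin ℂ {f})[X] →ₐ[_] _).restrictScalars ℂ) F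
    have h3 := h2.symm.trans (h1.trans (map_zero _))
    have h4 := natDegree_aeval_line_le hF (![0, 0, 1] : Fin 3 → ℂ) ![0, 1, 0]
    have h5 := MvPolynomial.comp_aeval_apply
      (fun i => C ((![0, 0, 1] : Fin 3 → ℂ) i) + C ((![0, 1, 0] : Fin 3 → ℂ) i) * X) (aeval f) F
    refine RatFunc.transcendental_of_ne_C f (by simpa using fun k => (hlin k)) ⟨_, ?_, h5.trans ?_⟩
    · intro h6
      rw [h6, coeff_zero] at h4
      exact hF2 h4.2.symm
    · rw [← h3]
      congr 2
      ext i
      fin_cases i <;> simp [hp, hq]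
  · have h4 : (MvPolynomial.aeval (fun i => C (p i) + C (q i) * X) F :
        (IntermediateField.adjoin ℂ {f})[X]).coeff 4 = 0 := by
      rw [hQ.2, ← map_zero (algebraMap ℂ (IntermediateField.adjoin ℂ {f})), ← hY,
        MvPolynomial.algebraMap_eval_eq_aeval]
      congr 2
      ext i
      fin_cases i <;> simp [hq]
    rw [natDegree_le_iff_coeff_eq_zero]
    intro N hN
    rcases eq_or_lt_of_le (Nat.succ_le_of_lt hN) with rfl | hN'
    · exact h4
    · exact coeff_eq_zero_of_natDegree_lt (hQ.1.trans_lt hN')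
  · rw [← (hP 4 F hF).2 dvd_rfl]
    congr 2
    ext i
    fin_cases i
    · simp [hp, hq]
    · simp [hp, hq, hf, RatFunc.algebraMap_eq_C]
    · simp [hp, hq]

end Normalized

variable {η : Fin 4 → ℂ} {F : MvPolynomial (Fin 3) ℂ}

theorem mvPolynomial_aeval_vecCons_map {L L' : Type*} [Field L] [Field L'] [Algebra ℂ L]
    [Algebra ℂ L'] {α β : L} (σ : L →ₐ[ℂ] L') (H : MvPolynomial (Fin 3) ℂ) :
    MvPolynomial.aeval ![σ α, σ β, 1] H = σ (MvPolynomial.aeval ![α, β, 1] H) := by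
  have h := MvPolynomial.comp_aeval_apply ![α, β, 1] σ H
  refine Eq.trans ?_ h.symm
  congr 2
  ext i
  fin_cases i <;> simp

theorem adjoin_pair_map {α β : RatFunc ℂ} (σ : RatFunc ℂ ≃ₐ[ℂ] RatFunc ℂ)
    (hgen : IntermediateField.adjoin ℂ {α, β} = ⊤) :
    IntermediateField.adjoin ℂ {σ α, σ β} = ⊤ := by
  have h := IntermediateField.adjoin_map ℂ {α, β} (σ : RatFunc ℂ →ₐ[ℂ] RatFunc ℂ)
  rw [hgen, Set.image_pair] at h
  refine Eq.trans h.symm ?_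
  rw [← AlgHom.fieldRange_eq_map, AlgHom.fieldRange_eq_top]
  exact σ.surjective

/-- The parametrization of a quartic through the four points of a line, with coprime coordinates,
is that of a rational curve with four poles. -/
theorem exists_eq_rationalCurve_of_generates (hη : Function.Injective η) (hF : F.IsHomogeneous 4)
    (hY : ∀ i, MvPolynomial.eval ![1, η i, 0] F = 0) (hF0 : F ≠ 0) {α β : RatFunc ℂ}
    (hP : ∀ (n : ℕ) (H : MvPolynomial (Fin 3) ℂ), H.IsHomogeneous n →
      (MvPolynomial.aeval ![α, β, 1] H = 0 ↔ F ∣ H))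
    (hgen : IntermediateField.adjoin ℂ {α, β} = ⊤) {a b c : ℂ[X]} (hc : c ≠ 0)
    (ha : a.natDegree ≤ c.natDegree) (hb : b.natDegree ≤ c.natDegree)
    (hα : α * algebraMap ℂ[X] (RatFunc ℂ) c = algebraMap ℂ[X] (RatFunc ℂ) a)
    (hβ : β * algebraMap ℂ[X] (RatFunc ℂ) c = algebraMap ℂ[X] (RatFunc ℂ) b)
    (hroot : ∀ t, ¬ (a.eval t = 0 ∧ b.eval t = 0 ∧ c.eval t = 0)) :
    ∃ (τ μ : Fin 4 → ℂ) (a₀ b₀ : ℂ), Function.Injective τ ∧ (∀ i, μ i ≠ 0) ∧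
      (∀ l, ![a, b, c] l = C c.leadingCoeff * rationalCurve η τ μ a₀ b₀ l) ∧
      MvPolynomial.eval ![0, 1, 0] F ≠ 0 ∧
      ∀ (n : ℕ) (H : MvPolynomial (Fin 3) ℂ), H.IsHomogeneous n →
        (MvPolynomial.aeval ![a, b, c] H = 0 ↔ F ∣ H) := by
  have hinj := RatFunc.algebraMap_injective ℂ
  have hcc : algebraMap ℂ[X] (RatFunc ℂ) c ≠ 0 := (map_ne_zero_iff _ hinj).2 hc
  have hγ : ∀ (n : ℕ) (H : MvPolynomial (Fin 3) ℂ), H.IsHomogeneous n →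
      (MvPolynomial.aeval ![a, b, c] H = 0 ↔ F ∣ H) := by
    intro n H hH
    rw [← hP n H hH, ← map_eq_zero_iff _ hinj]
    have h1 := MvPolynomial.comp_aeval_apply ![a, b, c]
      (IsScalarTower.toAlgHom ℂ ℂ[X] (RatFunc ℂ)) H
    have h2 := hH.aeval_mul (algebraMap ℂ[X] (RatFunc ℂ) c) ![α, β, 1]
    have h3 : (fun i => algebraMap ℂ[X] (RatFunc ℂ) c * (![α, β, 1] : Fin 3 → RatFunc ℂ) i) =
        fun i => (IsScalarTower.toAlgHom ℂ ℂ[X] (RatFunc ℂ)) (![a, b, c] i) := by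
      ext1 i
      fin_cases i
      · simpa [mul_comm] using hα
      · simpa [mul_comm] using hβ
      · simp
    rw [h3] at h2
    have h4 := h1.trans h2
    refine (iff_of_eq (congrArg (· = 0) h4)).trans ?_
    rw [mul_eq_zero, or_iff_right (pow_ne_zero _ hcc)]
  obtain ⟨κ, r, hκ, hκr⟩ := exists_eq_C_mul_prod_add_of_generates hη hF hY hF0 hP
  have hF2 : MvPolynomial.eval ![0, 1, 0] F ≠ 0 := by
    rw [hκr]
    simpa using hκ
  have hn4 : 4 ≤ c.natDegree := by
    refine four_le_natDegree_of_generates hF (γ := ![a, b, c]) ?_ fun H hH => (hγ 4 H hH).1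
    intro i
    fin_cases i
    · exact ha
    · exact hb
    · exact le_rfl
  -- At a common zero of `a` and `c`, the equation reduces to `κ b ^ 4 = 0`, so `b` vanishes too,
  -- against `hroot`.
  have hat : ∀ t, c.eval t = 0 → a.eval t ≠ 0 := by
    intro t ht h
    have h1 := congrArg (eval t) ((hγ 4 F hF).2 dvd_rfl)
    rw [hκr] at h1
    simp [ht, h, hκ, eval_prod] at h1
    exact hroot t ⟨h, h1, ht⟩
  have hcop : IsCoprime a c := by
    rw [Polynomial.isCoprime_iff_aeval_ne_zero_of_isAlgClosed ℂ ℂ]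
    intro t
    by_cases ht : c.eval t = 0
    · left
      simpa using hat t ht
    · right
      simpa using ht
  have hc4 : c.natDegree = 4 := by
    refine le_antisymm ?_ hn4
    have h1 := natDegree_le_finrank_of_isCoprime hc hcop
    rw [← hα, mul_div_cancel_right₀ _ hcc] at h1
    exact h1.trans (finrank_adjoin_le_four hF hF2 ((hP 4 F hF).2 dvd_rfl) hgen)
  -- If no pole lay over `(1 : ηᵢ : 0)`, then `(b - ηᵢ a) / c` would be reduced of degree at least
  -- 4, whereas lines through that point give degree at most 3.
  have hτ : ∀ i, ∃ t, c.eval t = 0 ∧ (b - C (η i) * a).eval t = 0 := by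
    intro i
    by_contra! hne
    have hcop' : IsCoprime (b - C (η i) * a) c := by
      rw [Polynomial.isCoprime_iff_aeval_ne_zero_of_isAlgClosed ℂ ℂ]
      intro t
      by_cases ht : c.eval t = 0
      · left
        rw [coe_aeval_eq_eval]
        exact hne t ht
      · right
        simpa using ht
    have h1 := natDegree_le_finrank_of_isCoprime hc hcop'
    have h2 : algebraMap ℂ[X] (RatFunc ℂ) (b - C (η i) * a) / algebraMap ℂ[X] (RatFunc ℂ) c =
        β - RatFunc.C (η i) * α := by
      rw [div_eq_iff hcc, map_sub, map_mul, RatFunc.algebraMap_C, ← hα, ← hβ]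
      ring
    rw [h2, hc4] at h1
    have := h1.trans (finrank_adjoin_le_three hF hF0 hF2 hP hgen (hY i))
    omega
  choose τ hτc hτb using hτ
  have hτb' : ∀ i, b.eval (τ i) = η i * a.eval (τ i) := fun i => by
    simpa [sub_eq_zero] using hτb i
  have hτinj : Function.Injective τ := by
    intro i j hij
    have h1 := hτb' i
    rw [hij, hτb' j] at h1
    exact (hη (mul_right_cancel₀ (hat _ (hτc j)) h1)).symm
  obtain ⟨μ, a₀, b₀, hμ, hcurve⟩ := exists_eq_rationalCurve hτinj hc4 (hc4 ▸ ha) (hc4 ▸ hb) hτc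
    (fun i => hat _ (hτc i)) hτb'
  exact ⟨τ, μ, a₀, b₀, hτinj, hμ, hcurve, hF2, hγ⟩

theorem aeval_rationalCurve_pencil {τ μ : Fin 4 → ℂ} (hτ : Function.Injective τ) (a b : ℂ) :
    MvPolynomial.aeval (rationalCurve η τ μ a b) (pencil (fun i => MvPolynomial.C (η i))
      ((rationalMatrix η τ μ a b).map MvPolynomial.C) (MvPolynomial.X 0) (MvPolynomial.X 1)
      (MvPolynomial.X 2) : MvPolynomial (Fin 3) ℂ) = 0 := by
  have h2 := map_pencil (MvPolynomial.aeval (rationalCurve η τ μ a b)).toRingHom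
    (fun i => MvPolynomial.C (η i)) ((rationalMatrix η τ μ a b).map MvPolynomial.C)
    (MvPolynomial.X 0) (MvPolynomial.X 1) (MvPolynomial.X 2)
  refine h2.trans (Eq.trans ?_ (pencil_rationalCurve (η := η) (μ := μ) hτ a b))
  simp [Matrix.map_map, Function.comp_def]

/-- The determinant of the reconstructed curve vanishes on it, so `F` divides it; both are quartics,
so the quotient is a scalar. The value 1 of the determinant at `(0, 1, 0)` makes this scalar
nonzero. -/
theorem exists_pencil_of_generates (hη : Function.Injective η) (hF : F.IsHomogeneous 4)
    (hY : ∀ i, MvPolynomial.eval ![1, η i, 0] F = 0) (hF0 : F ≠ 0) {α β : RatFunc ℂ}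
    (hP : ∀ (n : ℕ) (H : MvPolynomial (Fin 3) ℂ), H.IsHomogeneous n →
      (MvPolynomial.aeval ![α, β, 1] H = 0 ↔ F ∣ H))
    (hgen : IntermediateField.adjoin ℂ {α, β} = ⊤) :
    ∃ (τ μ : Fin 4 → ℂ) (a b k : ℂ), Function.Injective τ ∧ (∀ i, μ i ≠ 0) ∧ k ≠ 0 ∧
      F = MvPolynomial.C k * pencil (fun i => MvPolynomial.C (η i))
        ((rationalMatrix η τ μ a b).map MvPolynomial.C) (MvPolynomial.X 0) (MvPolynomial.X 1)
        (MvPolynomial.X 2) := by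
  obtain ⟨σ, a, b, c, hc, ha, hb, hα, hβ, hroot⟩ := exists_normalized_parametrization α β
  obtain ⟨τ, μ, a₀, b₀, hτ, hμ, hcurve, hF2, hγ⟩ :=
    exists_eq_rationalCurve_of_generates hη hF hY hF0 (α := σ α) (β := σ β)
    (fun n H hH => by
      have h1 := mvPolynomial_aeval_vecCons_map (α := α) (β := β) σ.toAlgHom H
      refine (iff_of_eq (congrArg (· = 0) h1)).trans ?_
      rw [AlgEquiv.coe_toAlgHom, map_eq_zero_iff _ σ.injective]
      exact hP n H hH) (adjoin_pair_map σ hgen) hc ha hb hα hβ hroot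
  set G : MvPolynomial (Fin 3) ℂ := pencil (fun i => MvPolynomial.C (η i))
        ((rationalMatrix η τ μ a₀ b₀).map MvPolynomial.C) (MvPolynomial.X 0) (MvPolynomial.X 1)
        (MvPolynomial.X 2) with hG
  have hG4 : G.IsHomogeneous 4 := isHomogeneous_pencil _ _ (MvPolynomial.isHomogeneous_X _ _)
    (MvPolynomial.isHomogeneous_X _ _) (MvPolynomial.isHomogeneous_X _ _)
  have hGγ : MvPolynomial.aeval ![a, b, c] G = 0 := by
    have h1 : (![a, b, c] : Fin 3 → ℂ[X]) =
        fun l => C c.leadingCoeff * rationalCurve η τ μ a₀ b₀ l := funext hcurve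
    rw [h1, hG4.aeval_mul]
    rw [aeval_rationalCurve_pencil hτ a₀ b₀, mul_zero]
  obtain ⟨k, hk⟩ := eq_C_mul_of_dvd_of_isHomogeneous hF hG4 ((hγ 4 G hG4).1 hGγ)
  have hk0 : k ≠ 0 := by
    rintro rfl
    have h1 : MvPolynomial.eval ![0, 1, 0] G = 0 := by rw [hk]; simp
    rw [hG, map_pencil] at h1
    simp [pencil_zero] at h1
  refine ⟨τ, μ, a₀, b₀, k⁻¹, hτ, hμ, inv_ne_zero hk0, ?_⟩
  rw [← hG, hk, ← mul_assoc, ← map_mul, inv_mul_cancel₀ hk0, map_one, one_mul]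

end Reconstruction

/-! ### Linear changes of coordinates -/

section LinearSubst

/-- The linear forms given by the rows of a matrix. -/
def linearForms (N : Matrix (Fin 3) (Fin 3) ℂ) (i : Fin 3) : MvPolynomial (Fin 3) ℂ :=
  ∑ j, MvPolynomial.C (N i j) * MvPolynomial.X j

/-- The linear change of coordinates on ternary forms. -/
def linearSubst (N : Matrix (Fin 3) (Fin 3) ℂ) :
    MvPolynomial (Fin 3) ℂ →ₐ[ℂ] MvPolynomial (Fin 3) ℂ :=
  MvPolynomial.aeval (linearForms N)

variable {M N : Matrix (Fin 3) (Fin 3) ℂ}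

theorem isHomogeneous_linearForms (N : Matrix (Fin 3) (Fin 3) ℂ) (i : Fin 3) :
    (linearForms N i).IsHomogeneous 1 :=
  MvPolynomial.IsHomogeneous.sum _ _ _ fun _ _ => (MvPolynomial.isHomogeneous_X _ _).C_mul _

theorem linearSubst_X (N : Matrix (Fin 3) (Fin 3) ℂ) (i : Fin 3) :
    linearSubst N (MvPolynomial.X i) = linearForms N i := by
  rw [linearSubst, MvPolynomial.aeval_X]

theorem isHomogeneous_linearSubst (N : Matrix (Fin 3) (Fin 3) ℂ) {n : ℕ}
    {H : MvPolynomial (Fin 3) ℂ} (hH : H.IsHomogeneous n) : (linearSubst N H).IsHomogeneous n := by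
  have := hH.aeval (linearForms N) (n := 1) (isHomogeneous_linearForms N)
  rwa [one_mul] at this

theorem aeval_linearForms {A : Type*} [CommRing A] [Algebra ℂ A] (N : Matrix (Fin 3) (Fin 3) ℂ)
    (x : Fin 3 → A) (i : Fin 3) : MvPolynomial.aeval x (linearForms N i) = ∑ j, N i j • x j := by
  simp [linearForms, Algebra.smul_def]

theorem eval_linearForms (N : Matrix (Fin 3) (Fin 3) ℂ) (x : Fin 3 → ℂ) (i : Fin 3) :
    MvPolynomial.eval x (linearForms N i) = N.mulVec x i := by
  simp [linearForms, Matrix.mulVec, dotProduct]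

theorem aeval_linearSubst {A : Type*} [CommRing A] [Algebra ℂ A] (N : Matrix (Fin 3) (Fin 3) ℂ)
    (x : Fin 3 → A) (H : MvPolynomial (Fin 3) ℂ) : MvPolynomial.aeval x (linearSubst N H) =
      MvPolynomial.aeval (fun i => ∑ j, N i j • x j) H := by
  rw [linearSubst, MvPolynomial.comp_aeval_apply]
  simp only [aeval_linearForms]

theorem eval_linearSubst (N : Matrix (Fin 3) (Fin 3) ℂ) (x : Fin 3 → ℂ)
    (H : MvPolynomial (Fin 3) ℂ) : MvPolynomial.eval x (linearSubst N H) =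
      MvPolynomial.eval (N.mulVec x) H := by
  exact aeval_linearSubst N x H

theorem linearSubst_linearSubst (h : N * M = 1) (H : MvPolynomial (Fin 3) ℂ) :
    linearSubst M (linearSubst N H) = H := by
  have h1 := aeval_linearSubst N (linearForms M) H
  refine h1.trans ?_
  have h2 : (fun i => ∑ j, N i j • linearForms M j) = MvPolynomial.X := by
    ext1 i
    have h3 : ∀ k, ∑ j, N i j * M j k = if i = k then 1 else 0 := fun k => by
      rw [← Matrix.mul_apply, h, Matrix.one_apply]
    simp only [linearForms, Finset.smul_sum, MvPolynomial.smul_eq_C_mul, ← mul_assoc, ← map_mul]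
    rw [Finset.sum_comm]
    simp only [← Finset.sum_mul, ← map_sum, h3]
    simp
  rw [h2, MvPolynomial.aeval_X_left_apply]

theorem linearSubst_dvd_iff (h : N * M = 1) (h' : M * N = 1) (F H : MvPolynomial (Fin 3) ℂ) :
    F ∣ linearSubst N H ↔ linearSubst M F ∣ H := by
  constructor
  · intro hd
    have := map_dvd (linearSubst M) hd
    rwa [linearSubst_linearSubst h] at this
  · intro hd
    have := map_dvd (linearSubst N) hd
    rwa [linearSubst_linearSubst h'] at this

theorem PlaneCurve.equation_ne_zero {d : ℕ} (C : PlaneCurve d) : PlaneCurve.equation C ≠ 0 := by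
  intro h
  refine C.rep_nonzero (funext fun m => ?_)
  rw [← coeff_ternaryForm C.rep m]
  rw [show ternaryForm C.rep = 0 from h]
  simp

/-- Affine coordinates on a rational quartic generate the field of rational functions, and they
satisfy precisely the relations given by the equation of the curve. -/
theorem PlaneCurve.exists_generators_of_isRational (h : N * M = 1) (h' : M * N = 1)
    {C : PlaneCurve 4} (hC : PlaneCurve.IsRational C) :
    ∃ α β : RatFunc ℂ, (∀ (n : ℕ) (H : MvPolynomial (Fin 3) ℂ), H.IsHomogeneous n →
      (MvPolynomial.aeval ![α, β, 1] H = 0 ↔ linearSubst M (PlaneCurve.equation C) ∣ H)) ∧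
      IntermediateField.adjoin ℂ {α, β} = ⊤ := by
  obtain ⟨hdom, ⟨φ⟩⟩ := hC
  set E := FractionRing (PlaneCurve.CoordRing C) with hE
  set π : MvPolynomial (Fin 3) ℂ →ₐ[ℂ] E := (IsScalarTower.toAlgHom ℂ (PlaneCurve.CoordRing C) E).comp
    (Ideal.Quotient.mkₐ ℂ _) with hπ
  have hπ' : ∀ H, π H = algebraMap (PlaneCurve.CoordRing C) E (Ideal.Quotient.mk _ H) := fun H => rfl
  have hπ0 : ∀ H, π H = 0 ↔ PlaneCurve.equation C ∣ H := by
    intro H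
    rw [hπ', map_eq_zero_iff _ (IsFractionRing.injective (PlaneCurve.CoordRing C) E),
      Ideal.Quotient.eq_zero_iff_mem, Ideal.mem_span_singleton]
  set z : Fin 3 → E := fun i => π (linearForms N i) with hz
  have hzπ : ∀ H, MvPolynomial.aeval z H = π (linearSubst N H) := fun H =>
    (MvPolynomial.comp_aeval_apply (linearForms N) π H).symm
  have hN2 : linearForms N 2 ≠ 0 := by
    intro h0
    have h1 := linearSubst_linearSubst h (MvPolynomial.X 2)
    rw [linearSubst_X, h0, map_zero] at h1
    exact MvPolynomial.X_ne_zero _ h1.symm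
  have hz2' : ¬ PlaneCurve.equation C ∣ linearForms N 2 := by
    intro h0
    have := four_le_of_dvd_of_isHomogeneous C.isHomogeneous_equation C.equation_ne_zero 1 _
      (isHomogeneous_linearForms N 2) hN2 h0
    omega
  have hz2 : z 2 ≠ 0 := fun h0 => hz2' ((hπ0 _).1 h0)
  have hmem : ∀ i, z i / z 2 ∈ PlaneCurve.functionField C := fun i =>
    ⟨1, linearForms N i, linearForms N 2, isHomogeneous_linearForms N i,
      isHomogeneous_linearForms N 2, fun h0 => hz2 (by
        change π (linearForms N 2) = 0
        rw [hπ', h0, map_zero]), rfl⟩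
  set x : PlaneCurve.functionField C := ⟨_, hmem 0⟩ with hx
  set y : PlaneCurve.functionField C := ⟨_, hmem 1⟩ with hy
  have hxy : ∀ (n : ℕ) (H : MvPolynomial (Fin 3) ℂ), H.IsHomogeneous n →
      ((MvPolynomial.aeval ![x, y, 1] H : PlaneCurve.functionField C) : E) =
        (z 2)⁻¹ ^ n * π (linearSubst N H) := by
    intro n H hH
    have h1 := mvPolynomial_aeval_vecCons_map (α := x) (β := y) (PlaneCurve.functionField C).val H
    refine h1.symm.trans ?_
    rw [← hzπ, ← hH.aeval_mul]
    congr 2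
    ext i
    fin_cases i
    · simp [hx, div_eq_inv_mul]
    · simp [hy, div_eq_inv_mul]
    · simp [inv_mul_cancel₀ hz2]
  refine ⟨φ x, φ y, ?_, ?_⟩
  · intro n H hH
    have h1 := mvPolynomial_aeval_vecCons_map (α := x) (β := y)
      φ.toAlgHom H
    refine (iff_of_eq (congrArg (· = 0) h1)).trans ?_
    rw [AlgEquiv.coe_toAlgHom, map_eq_zero_iff _ φ.injective, ← linearSubst_dvd_iff h h', ← hπ0,
      ← ZeroMemClass.coe_eq_zero, hxy n H hH, mul_eq_zero,
      or_iff_right (pow_ne_zero _ (inv_ne_zero hz2))]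
  · have htop : IntermediateField.adjoin ℂ {x, y} = ⊤ := by
      rw [eq_top_iff]
      rintro ⟨t, n, f, g, hf, hg, hg0, ht⟩ -
      have hadj : ∀ H : MvPolynomial (Fin 3) ℂ, MvPolynomial.aeval ![x, y, 1] H ∈ IntermediateField.adjoin ℂ {x, y} := by
        intro H
        induction H using MvPolynomial.induction_on with
        | C a =>
          rw [MvPolynomial.aeval_C]
          exact algebraMap_mem _ a
        | add p q hp hq =>
          rw [map_add]
          exact add_mem hp hq
        | mul_X p i hp =>
          rw [map_mul, MvPolynomial.aeval_X]
          refine mul_mem hp ?_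
          fin_cases i
          · exact IntermediateField.subset_adjoin _ _ (by simp)
          · exact IntermediateField.subset_adjoin _ _ (by simp)
          · exact one_mem _
      have h1 : (⟨t, n, f, g, hf, hg, hg0, ht⟩ : PlaneCurve.functionField C) =
          MvPolynomial.aeval ![x, y, 1] (linearSubst M f) /
            MvPolynomial.aeval ![x, y, 1] (linearSubst M g) := by
        apply Subtype.ext
        rw [IntermediateField.coe_div, hxy n _ (isHomogeneous_linearSubst M hf),
          hxy n _ (isHomogeneous_linearSubst M hg), linearSubst_linearSubst h',
          linearSubst_linearSubst h', mul_div_mul_left _ _ (pow_ne_zero _ (inv_ne_zero hz2))]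
        exact ht
      rw [h1]
      exact div_mem (hadj _) (hadj _)
    have h1 := IntermediateField.adjoin_map ℂ {x, y} φ.toAlgHom
    rw [htop, Set.image_pair] at h1
    refine Eq.trans h1.symm ?_
    rw [← AlgHom.fieldRange_eq_map, AlgHom.fieldRange_eq_top]
    exact φ.surjective

end LinearSubst

/-! ### Rational quartics through the four points as determinants -/

section Description

open Polynomial

variable {η : Fin 4 → ℂ} {M N : Matrix (Fin 3) (Fin 3) ℂ}

theorem linearSubst_pencil (O : Matrix (Fin 4) (Fin 4) ℂ) :
    linearSubst N (pencil (fun i => MvPolynomial.C (η i)) (O.map MvPolynomial.C)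
      (MvPolynomial.X 0) (MvPolynomial.X 1) (MvPolynomial.X 2)) =
    pencil (fun i => MvPolynomial.C (η i)) (O.map MvPolynomial.C)
      (linearForms N 0) (linearForms N 1) (linearForms N 2) := by
  have h2 := map_pencil (linearSubst N).toRingHom (fun i => MvPolynomial.C (η i))
    (O.map MvPolynomial.C) (MvPolynomial.X 0) (MvPolynomial.X 1) (MvPolynomial.X 2)
  refine h2.trans ?_
  have hC : ∀ x, (linearSubst N).toRingHom (MvPolynomial.C x) = MvPolynomial.C x :=
    (linearSubst N).commutes
  have hX : ∀ i, (linearSubst N).toRingHom (MvPolynomial.X i) = linearForms N i := linearSubst_X N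
  simp only [Matrix.map_map, Function.comp_def, hC, hX]

theorem rationalCurve_two_ne_zero (τ μ : Fin 4 → ℂ) (a b : ℂ) : rationalCurve η τ μ a b 2 ≠ 0 := by
  change ∏ i, (X - C (τ i)) ≠ 0
  exact Finset.prod_ne_zero_iff.2 fun i _ => X_sub_C_ne_zero (τ i)

theorem aeval_rationalCurve_eq_zero_iff (hη : Function.Injective η) {τ μ : Fin 4 → ℂ}
    (hτ : Function.Injective τ) (hμ : ∀ i, μ i ≠ 0) (a b : ℂ) (n : ℕ)
    (H : MvPolynomial (Fin 3) ℂ) (hH : H.IsHomogeneous n) :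
    MvPolynomial.aeval (rationalCurve η τ μ a b) H = 0 ↔
      pencil (fun i => MvPolynomial.C (η i)) ((rationalMatrix η τ μ a b).map MvPolynomial.C)
        (MvPolynomial.X 0) (MvPolynomial.X 1) (MvPolynomial.X 2) ∣ H := by
  constructor
  · intro h
    obtain ⟨r, hr⟩ := exists_pencil_eq (fun i => MvPolynomial.C (η i))
      ((rationalMatrix η τ μ a b).map MvPolynomial.C) (MvPolynomial.X 0 : MvPolynomial (Fin 3) ℂ)
      (MvPolynomial.X 1) (MvPolynomial.X 2)
    refine dvd_of_aeval_eq_zero hη (isHomogeneous_pencil _ _ (MvPolynomial.isHomogeneous_X _ _)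
      (MvPolynomial.isHomogeneous_X _ _) (MvPolynomial.isHomogeneous_X _ _)) hr
      (γ := rationalCurve η τ μ a b) ?_ (aeval_rationalCurve_pencil hτ a b) (fun i => ?_) n H hH h
    · exact rationalCurve_two_ne_zero τ μ a b
    · exact ⟨τ i, _, mul_ne_zero (hμ i) (eval_prod_erase_ne_zero hτ i), eval_rationalCurve i⟩
  · rintro ⟨q, rfl⟩
    rw [map_mul, aeval_rationalCurve_pencil hτ a b, zero_mul]

variable {Y : Set ProjPlane}

/-- The integral rational quartics through four collinear points, in terms of their equations. -/
theorem mem_integralRationalQuartics_iff (hη : Function.Injective η) (h : N * M = 1)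
    (h' : M * N = 1) (hM : ∀ i, M.mulVec ![1, η i, 0] ≠ 0)
    (hY : Y = Set.range fun i => Projectivization.mk ℂ (M.mulVec ![1, η i, 0]) (hM i))
    (C : PlaneCurve 4) : C ∈ integralRationalQuartics Y ↔
      ∃ (τ μ : Fin 4 → ℂ) (a b k : ℂ), Function.Injective τ ∧ (∀ i, μ i ≠ 0) ∧ k ≠ 0 ∧
        PlaneCurve.equation C = MvPolynomial.C k * pencil (fun i => MvPolynomial.C (η i))
          ((rationalMatrix η τ μ a b).map MvPolynomial.C)
          (linearForms N 0) (linearForms N 1) (linearForms N 2) := by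
  have hcontains : (∀ P ∈ Y, PlaneCurve.Contains C P) ↔ ∀ i,
      MvPolynomial.eval ![1, η i, 0] (linearSubst M (PlaneCurve.equation C)) = 0 := by
    rw [hY, Set.forall_mem_range]
    refine forall_congr' fun i => ?_
    rw [eval_linearSubst]
    exact eval_rep_mk_eq_zero_iff C.isHomogeneous_equation _ (hM i)
  constructor
  · rintro ⟨-, hrat, hCY⟩
    rw [hcontains] at hCY
    obtain ⟨α, β, hP, hgen⟩ := PlaneCurve.exists_generators_of_isRational h h' hrat
    have hF0 : linearSubst M (PlaneCurve.equation C) ≠ 0 := by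
      intro h0
      have := linearSubst_linearSubst h' (PlaneCurve.equation C)
      rw [h0, map_zero] at this
      exact C.equation_ne_zero this.symm
    obtain ⟨τ, μ, a, b, k, hτ, hμ, hk, hF⟩ := exists_pencil_of_generates hη
      (isHomogeneous_linearSubst M C.isHomogeneous_equation) hCY hF0 hP hgen
    refine ⟨τ, μ, a, b, k, hτ, hμ, hk, ?_⟩
    rw [← linearSubst_linearSubst h' (PlaneCurve.equation C), hF, map_mul, linearSubst_pencil,
      ← MvPolynomial.algebraMap_eq, AlgHom.commutes]
  · rintro ⟨τ, μ, a, b, k, hτ, hμ, hk, hF⟩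
    set G := pencil (fun i => MvPolynomial.C (η i)) ((rationalMatrix η τ μ a b).map MvPolynomial.C)
      (MvPolynomial.X 0 : MvPolynomial (Fin 3) ℂ) (MvPolynomial.X 1) (MvPolynomial.X 2) with hG
    set γ : Fin 3 → ℂ[X] := fun i => ∑ j, M i j • rationalCurve η τ μ a b j with hγ
    have hγG : ∀ H : MvPolynomial (Fin 3) ℂ, MvPolynomial.aeval γ H =
        MvPolynomial.aeval (rationalCurve η τ μ a b) (linearSubst M H) := fun H =>
      (aeval_linearSubst M _ H).symm
    have hu : IsUnit (MvPolynomial.C k : MvPolynomial (Fin 3) ℂ) := (IsUnit.mk0 k hk).map _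
    rw [← linearSubst_pencil, ← hG] at hF
    have hdvd : ∀ (n : ℕ) (H : MvPolynomial (Fin 3) ℂ), H.IsHomogeneous n →
        (MvPolynomial.aeval γ H = 0 ↔ PlaneCurve.equation C ∣ H) := by
      intro n H hH
      rw [hγG, aeval_rationalCurve_eq_zero_iff hη hτ hμ a b n _ (isHomogeneous_linearSubst M hH),
        linearSubst_dvd_iff h' h, hF, hu.mul_left_dvd]
    have hγi : ∀ i, MvPolynomial.aeval γ (linearForms N i) = rationalCurve η τ μ a b i := by
      intro i
      rw [hγG, ← linearSubst_X, linearSubst_linearSubst h, MvPolynomial.aeval_X]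
    refine ⟨PlaneCurve.isIntegral_of_parametrization C hdvd,
      PlaneCurve.isRational_of_parametrization C hdvd ⟨linearForms N 0, linearForms N 2,
        isHomogeneous_linearForms N 0, isHomogeneous_linearForms N 2, ?_, fun s hs => ?_⟩,
      hcontains.2 fun i => ?_⟩
    · rw [hγi]
      exact rationalCurve_two_ne_zero τ μ a b
    · rw [hγi, hγi] at hs
      -- The ratio of the two coordinates is nonconstant: at the pole `τ 0` the denominator vanishes
      -- and the numerator does not.
      have h1 := congrArg (eval (τ 0)) hs
      have h2 := fun l => congrFun (eval_rationalCurve (η := η) (τ := τ) (μ := μ) (a := a) (b := b) 0) l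
      rw [eval_mul, h2 0, h2 2] at h1
      simp [hμ 0] at h1
      exact eval_prod_erase_ne_zero hτ 0 h1
    · rw [hF, map_mul, linearSubst_linearSubst h, map_mul, hG, map_pencil]
      simp only [MvPolynomial.eval_X, MvPolynomial.eval_C, Matrix.cons_val_zero, Matrix.cons_val_one,
        Matrix.cons_val, pencil_zero]
      rw [Finset.prod_eq_zero (Finset.mem_univ i) (by ring), mul_zero]

end Description

/-! ### Coordinates adapted to the four points -/

/-- Adapted linear coordinates for four collinear points of the plane. -/
theorem exists_coordinates_of_isCollinear (Y : Set ProjPlane) (hcard : Y.ncard = 4)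
    (hline : Projectivization.IsCollinear Y) :
    ∃ (η : Fin 4 → ℂ) (M N : Matrix (Fin 3) (Fin 3) ℂ) (hM : ∀ i, M.mulVec ![1, η i, 0] ≠ 0),
      Function.Injective η ∧ N * M = 1 ∧ M * N = 1 ∧
      Y = Set.range fun i => Projectivization.mk ℂ (M.mulVec ![1, η i, 0]) (hM i) := by
  obtain ⟨S, -, hS2, hYS⟩ := hline
  set W := Projectivization.Subspace.submodule S with hW
  have hfin : Finite Y := Set.finite_of_ncard_ne_zero (by omega)
  let e : Fin 4 ≃ Y := (Finite.equivFinOfCardEq (by rw [Nat.card_coe_set_eq, hcard])).symm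
  set p : Fin 4 → Fin 3 → ℂ := fun i => (e i : ProjPlane).rep with hp
  have hpmk : ∀ i, Projectivization.mk ℂ (p i) (e i : ProjPlane).rep_nonzero = e i := fun i =>
    (e i : ProjPlane).mk_rep
  have hpW : ∀ i, p i ∈ W := by
    intro i
    rw [hW, Projectivization.Subspace.mem_submodule_iff _ (e i : ProjPlane).rep_nonzero,
      Projectivization.mk_rep]
    exact hYS (e i).2
  have hne : (e 0 : ProjPlane) ≠ e 1 := fun h => by
    have := e.injective (Subtype.ext h)
    simp at this
  have hli := Projectivization.linearIndependent_pair_iff_ne.2 hne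
  change LinearIndependent ℂ ![p 0, p 1] at hli
  have hspan : Submodule.span ℂ {p 0, p 1} = W := by
    refine Submodule.eq_of_le_of_finrank_le ?_ ?_
    · rw [Submodule.span_le]
      rintro x (rfl | rfl)
      · exact hpW 0
      · exact hpW 1
    · have := finrank_span_eq_card hli
      rw [Matrix.range_cons, Matrix.range_cons, Matrix.range_empty, Set.union_empty] at this
      rw [Set.insert_eq, this]
      exact hS2
  have hxy : ∀ i, ∃ x y : ℂ, x • p 0 + y • p 1 = p i := fun i =>
    Submodule.mem_span_pair.1 (hspan ▸ hpW i)
  choose x y hxy using hxy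
  -- In the basis `p 1`, `p 0 + s • p 1` the point `p i` has coordinates `(y i - x i * s, x i)`.
  -- Avoiding finitely many `s` makes all the first coordinates nonzero, so each point has the form
  -- `(1 : ηᵢ : 0)`.
  obtain ⟨s, hs⟩ := (Set.finite_range fun i => y i / x i).exists_notMem
  have hden : ∀ i, y i - x i * s ≠ 0 := by
    intro i hi
    by_cases hx : x i = 0
    · rw [hx, zero_mul, sub_zero] at hi
      have := hxy i
      rw [hx, hi, zero_smul, zero_smul, add_zero] at this
      exact (e i : ProjPlane).rep_nonzero this.symm
    · exact hs ⟨i, by rw [sub_eq_zero] at hi; simp [hi, hx]⟩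
  obtain ⟨q, hq⟩ : ∃ q, q ∉ W := by
    by_contra! h
    have h1 : W = ⊤ := eq_top_iff.2 fun v _ => h v
    rw [h1, finrank_top, Module.finrank_fin_fun] at hS2
    omega
  set M : Matrix (Fin 3) (Fin 3) ℂ := (Matrix.of ![p 1, p 0 + s • p 1, q]).transpose with hMdef
  have hMv : ∀ v : Fin 3 → ℂ, M.mulVec v = v 0 • p 1 + v 1 • (p 0 + s • p 1) + v 2 • q := by
    intro v
    ext l
    simp [hMdef, Matrix.mulVec, dotProduct, Fin.sum_univ_three]
    ring
  have hMunit : IsUnit M := by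
    rw [← Matrix.mulVec_injective_iff_isUnit]
    rw [← Matrix.coe_mulVecLin, injective_iff_map_eq_zero]
    intro v hv
    rw [Matrix.mulVecLin_apply, hMv] at hv
    have hv2 : v 2 = 0 := by
      by_contra h2
      refine hq ?_
      have h3 : q = (v 2)⁻¹ • (-(v 0 • p 1 + v 1 • (p 0 + s • p 1))) := by
        rw [← eq_neg_of_add_eq_zero_right hv, smul_smul, inv_mul_cancel₀ h2, one_smul]
      rw [h3]
      exact W.smul_mem _ (W.neg_mem (W.add_mem (W.smul_mem _ (hpW 1))
        (W.smul_mem _ (W.add_mem (hpW 0) (W.smul_mem _ (hpW 1))))))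
    have h4 := LinearIndependent.pair_iff.1 hli (v 1) (v 0 + v 1 * s) (by
      rw [← hv, hv2]
      module)
    have hv1 := h4.1
    have hv0 := h4.2
    rw [hv1, zero_mul, add_zero] at hv0
    ext l
    fin_cases l
    · exact hv0
    · exact hv1
    · exact hv2
  set η : Fin 4 → ℂ := fun i => x i / (y i - x i * s) with hη
  have hp' : ∀ i, (y i - x i * s) • M.mulVec ![1, η i, 0] = p i := by
    intro i
    have h1 : x i = (y i - x i * s) * η i := by rw [hη, mul_div_cancel₀ _ (hden i)]
    rw [hMv]
    simp only [Matrix.cons_val_zero, Matrix.cons_val_one, Matrix.cons_val, zero_smul, add_zero,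
      one_smul, smul_add, smul_smul, ← h1]
    rw [← hxy i, ← mul_assoc, ← h1]
    module
  have hM0 : ∀ i, M.mulVec ![1, η i, 0] ≠ 0 := by
    intro i h
    have := hp' i
    rw [h, smul_zero] at this
    exact (e i : ProjPlane).rep_nonzero this.symm
  have hmk : ∀ i, Projectivization.mk ℂ (M.mulVec ![1, η i, 0]) (hM0 i) = e i := by
    intro i
    rw [← hpmk i, Projectivization.mk_eq_mk_iff']
    exact ⟨(y i - x i * s)⁻¹, by rw [← hp' i, smul_smul, inv_mul_cancel₀ (hden i), one_smul]⟩
  obtain ⟨⟨M', N, h1, h2⟩, rfl⟩ := hMunit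
  refine ⟨η, M, N, hM0, ?_, h2, h1, ?_⟩
  · intro i j hij
    refine e.injective (Subtype.ext ?_)
    rw [← hmk i, ← hmk j]
    simp only [hij]
  · ext P
    simp only [hmk, Set.mem_range]
    constructor
    · intro hP
      exact ⟨e.symm ⟨P, hP⟩, by simp⟩
    · rintro ⟨i, rfl⟩
      exact (e i).2

/-! ### The seven-parameter normal form -/

/-- A family of matrices with seven parameters, polynomial in the parameters, whose pencils define
the rational quartics through four points of a line. -/
def quarticMatrix {S : Type*} [CommRing S] (η : Fin 4 → S) (x : Fin 7 → S) :
    Matrix (Fin 4) (Fin 4) S :=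
  !![η 0 * x 5 - x 6, (η 0 - η 1) * (x 4 * (1 + x 4) * x 1),
      (η 0 - η 2) * (x 4 * (1 + x 4) * x 2), (η 0 - η 3) * (x 4 * (1 + x 4) * x 3);
    -((η 1 - η 0) * x 0), η 1 * x 5 - x 6 - (η 1 - η 2) * (x 4 * (1 + x 4) * x 2)
      - (η 1 - η 3) * (x 4 * x 3), (η 1 - η 2) * (x 4 * (1 + x 4) * x 2), (η 1 - η 3) * (x 4 * x 3);
    -((η 2 - η 0) * x 0), -((η 2 - η 1) * (x 4 * (1 + x 4) * x 1)),
      η 2 * x 5 - x 6 - (η 2 - η 0) * x 0 + (η 2 - η 1) * (x 4 * (1 + x 4) * x 1)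
        - (η 2 - η 3) * ((1 + x 4) * x 3), (η 2 - η 3) * ((1 + x 4) * x 3);
    -((η 3 - η 0) * x 0), -((η 3 - η 1) * (x 4 * x 1)), -((η 3 - η 2) * ((1 + x 4) * x 2)),
      η 3 * x 5 - x 6 - (η 3 - η 0) * ((1 + x 4) * x 0) + (η 3 - η 1) * (x 4 * x 1)
        + (η 3 - η 2) * ((1 + x 4) * x 2)]

theorem map_quarticMatrix {S S' : Type*} [CommRing S] [CommRing S'] (f : S →+* S') (η : Fin 4 → S)
    (x : Fin 7 → S) : (quarticMatrix η x).map f =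
      quarticMatrix (fun i => f (η i)) (fun i => f (x i)) := by
  ext i j
  fin_cases i <;> fin_cases j <;> simp [quarticMatrix]

/-- In the coordinate `δ / (t - τ₀)` the poles are at `∞, p, p + 1, p + 1 + r`; the finite ones
differ by `1`, `r` and `1 + r`. Scaling three residues by `r (1 + r)` cancels these denominators,
and the diagonal conjugation together with the shift of the constants removes `p`, `δ` and `τ₀`. -/
theorem conj_rationalMatrix_eq_quarticMatrix {K : Type*} [Field K] (η : Fin 4 → K)
    {p r δ : K} (hp : p ≠ 0) (hp1 : p + 1 ≠ 0) (hpr : p + 1 + r ≠ 0) (hr : r ≠ 0) (hr1 : 1 + r ≠ 0)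
    (hδ : δ ≠ 0) (τ₀ k₀ k₁ k₂ k₃ a b : K) (i j : Fin 4) :
    ![-1, 1 / p, 1 / (p + 1), 1 / (p + 1 + r)] i *
      rationalMatrix η ![τ₀, τ₀ + δ / p, τ₀ + δ / (p + 1), τ₀ + δ / (p + 1 + r)]
        ![-δ * k₀, -δ * (r * (1 + r) * k₁) / p ^ 2, -δ * (r * (1 + r) * k₂) / (p + 1) ^ 2,
          -δ * (r * (1 + r) * k₃) / (p + 1 + r) ^ 2]
        (a - r * (1 + r) * (k₁ / p + k₂ / (p + 1) + k₃ / (p + 1 + r)) + p * k₀)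
        (b - r * (1 + r) * (η 1 * k₁ / p + η 2 * k₂ / (p + 1) + η 3 * k₃ / (p + 1 + r))
          + η 0 * p * k₀) i j =
      quarticMatrix η ![k₀, k₁, k₂, k₃, r, a, b] i j *
        ![-1, 1 / p, 1 / (p + 1), 1 / (p + 1 + r)] j := by
  have e01 : (τ₀ - (τ₀ + δ / p)) = -δ / p := by ring
  have e02 : (τ₀ - (τ₀ + δ / (p + 1))) = -δ / (p + 1) := by ring
  have e03 : (τ₀ - (τ₀ + δ / (p + 1 + r))) = -δ / (p + 1 + r) := by ring
  have e10 : (τ₀ + δ / p - τ₀) = δ / p := by ring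
  have e20 : (τ₀ + δ / (p + 1) - τ₀) = δ / (p + 1) := by ring
  have e30 : (τ₀ + δ / (p + 1 + r) - τ₀) = δ / (p + 1 + r) := by ring
  have e12 : (τ₀ + δ / p - (τ₀ + δ / (p + 1))) = δ / (p * (p + 1)) := by field_simp; ring
  have e21 : (τ₀ + δ / (p + 1) - (τ₀ + δ / p)) = -δ / (p * (p + 1)) := by field_simp; ring
  have e13 : (τ₀ + δ / p - (τ₀ + δ / (p + 1 + r))) = δ * (1 + r) / (p * (p + 1 + r)) := by
    field_simp; ring
  have e31 : (τ₀ + δ / (p + 1 + r) - (τ₀ + δ / p)) = -δ * (1 + r) / (p * (p + 1 + r)) := by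
    field_simp; ring
  have e23 : (τ₀ + δ / (p + 1) - (τ₀ + δ / (p + 1 + r))) = δ * r / ((p + 1) * (p + 1 + r)) := by
    field_simp; ring
  have e32 : (τ₀ + δ / (p + 1 + r) - (τ₀ + δ / (p + 1))) = -δ * r / ((p + 1) * (p + 1 + r)) := by
    field_simp; ring
  fin_cases i <;> fin_cases j <;>
    simp [rationalMatrix, quarticMatrix, Fin.sum_univ_four, -one_div, -neg_mul, e01, e02, e03, e10,
      e20, e30, e12, e21, e13, e31, e23, e32] <;> field_simp <;> ring

/-! ### Coefficients of the determinantal quartic -/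

section PencilForm

variable {S S' : Type*} [CommRing S] [CommRing S'] [Algebra ℂ S] [Algebra ℂ S']

/-- The ternary quartic form defined by the pencil of a matrix over a `ℂ`-algebra. -/
def pencilForm (η : Fin 4 → ℂ) (N : Matrix (Fin 3) (Fin 3) ℂ) (O : Matrix (Fin 4) (Fin 4) S) :
    MvPolynomial (Fin 3) S :=
  pencil (fun i => MvPolynomial.C (algebraMap ℂ S (η i))) (O.map MvPolynomial.C)
    (MvPolynomial.map (algebraMap ℂ S) (linearForms N 0))
    (MvPolynomial.map (algebraMap ℂ S) (linearForms N 1))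
    (MvPolynomial.map (algebraMap ℂ S) (linearForms N 2))

variable (η : Fin 4 → ℂ) (N : Matrix (Fin 3) (Fin 3) ℂ)

theorem pencilForm_complex (O : Matrix (Fin 4) (Fin 4) ℂ) : pencilForm η N O =
    pencil (fun i => MvPolynomial.C (η i)) (O.map MvPolynomial.C)
      (linearForms N 0) (linearForms N 1) (linearForms N 2) := by
  simp [pencilForm, MvPolynomial.map_id]

theorem isHomogeneous_pencilForm (O : Matrix (Fin 4) (Fin 4) S) :
    (pencilForm η N O).IsHomogeneous 4 :=
  isHomogeneous_pencil _ _ ((isHomogeneous_linearForms N 0).map _)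
    ((isHomogeneous_linearForms N 1).map _) ((isHomogeneous_linearForms N 2).map _)

theorem map_pencilForm (f : S →ₐ[ℂ] S') (O : Matrix (Fin 4) (Fin 4) S) :
    MvPolynomial.map f.toRingHom (pencilForm η N O) = pencilForm η N (O.map f) := by
  have hf : f.toRingHom.comp (algebraMap ℂ S) = algebraMap ℂ S' := f.comp_algebraMap
  rw [pencilForm, map_pencil, MvPolynomial.map_map, MvPolynomial.map_map, MvPolynomial.map_map, hf,
    pencilForm]
  congr 1
  · ext1 i
    rw [MvPolynomial.map_C]
    congr 1
    exact f.commutes _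
  · ext1 i j
    simp

/-- The coefficients of the quartic form defined by the pencil of a matrix. -/
def pencilCoeff (O : Matrix (Fin 4) (Fin 4) S) (m : PlaneMonomial 4) : S :=
  (pencilForm η N O).coeff m.1

theorem map_pencilCoeff (f : S →ₐ[ℂ] S') (O : Matrix (Fin 4) (Fin 4) S) (m : PlaneMonomial 4) :
    f (pencilCoeff η N O m) = pencilCoeff η N (O.map f) m := by
  rw [pencilCoeff, pencilCoeff, ← map_pencilForm, MvPolynomial.coeff_map]
  rfl

theorem ternaryForm_pencilCoeff (O : Matrix (Fin 4) (Fin 4) ℂ) :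
    ternaryForm (pencilCoeff η N O) = pencilForm η N O :=
  ternaryForm_coeff (isHomogeneous_pencilForm η N O)

/-- The linear form on the space of quartic forms that evaluates a form at the point `p`. -/
def evalForm (p : Fin 3 → ℂ) : MvPolynomial (PlaneMonomial 4) ℂ :=
  ∑ m, MvPolynomial.C (∏ i, p i ^ m.1 i) * MvPolynomial.X m

theorem isHomogeneous_evalForm (p : Fin 3 → ℂ) : (evalForm p).IsHomogeneous 1 :=
  MvPolynomial.IsHomogeneous.sum _ _ _ fun _ _ => (MvPolynomial.isHomogeneous_X _ _).C_mul _

theorem eval_evalForm (p : Fin 3 → ℂ) (c : PlaneMonomial 4 → ℂ) :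
    MvPolynomial.eval c (evalForm p) = MvPolynomial.eval p (ternaryForm c) := by
  simp only [evalForm, ternaryForm, map_sum, map_mul, MvPolynomial.eval_C, MvPolynomial.eval_X,
    MvPolynomial.eval_monomial]
  refine Finset.sum_congr rfl fun m _ => ?_
  rw [Finsupp.prod_fintype _ _ (fun i => pow_zero _), mul_comm]

variable {N} {M : Matrix (Fin 3) (Fin 3) ℂ}

theorem eval_pencilForm (h : N * M = 1) (O : Matrix (Fin 4) (Fin 4) ℂ) (x : Fin 3 → ℂ) :
    MvPolynomial.eval (M.mulVec x) (pencilForm η N O) = pencil η O (x 0) (x 1) (x 2) := by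
  have hx : ∀ i, MvPolynomial.eval (M.mulVec x) (linearForms N i) = x i := fun i => by
    rw [eval_linearForms, Matrix.mulVec_mulVec, h, Matrix.one_mulVec]
  rw [pencilForm_complex, map_pencil, hx, hx, hx]
  simp only [MvPolynomial.eval_C]
  congr 1
  ext i j
  simp

/-- The point `(0 : 1 : 0)` is a fifth point of the line. The value there normalizes the coefficient
vector of every member of the family at once. -/
theorem eval_evalForm_pencilCoeff (h : N * M = 1) (O : Matrix (Fin 4) (Fin 4) ℂ) :
    MvPolynomial.eval (pencilCoeff η N O) (evalForm (M.mulVec ![0, 1, 0])) = 1 := by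
  rw [eval_evalForm, ternaryForm_pencilCoeff, eval_pencilForm η h]
  simp [pencil_zero]

theorem pencilCoeff_ne_zero (h : N * M = 1) (O : Matrix (Fin 4) (Fin 4) ℂ) :
    pencilCoeff η N O ≠ 0 := by
  intro h0
  have := eval_evalForm_pencilCoeff η h O
  rw [h0] at this
  simp [evalForm] at this

end PencilForm

/-! ### The curves as a family over an open subset of affine 7-space -/

section Family

variable {η : Fin 4 → ℂ} {M N : Matrix (Fin 3) (Fin 3) ℂ}

theorem equation_eq_pencilForm_iff (h : N * M = 1) (O : Matrix (Fin 4) (Fin 4) ℂ)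
    (C : PlaneCurve 4) : C = Projectivization.mk ℂ (pencilCoeff η N O) (pencilCoeff_ne_zero η h O) ↔
      ∃ k : ℂ, k ≠ 0 ∧ PlaneCurve.equation C = MvPolynomial.C k * pencilForm η N O := by
  constructor
  · rintro rfl
    obtain ⟨k, hk⟩ := Projectivization.exists_smul_eq_mk_rep ℂ _ (pencilCoeff_ne_zero η h O)
    refine ⟨k, k.ne_zero, ?_⟩
    rw [PlaneCurve.equation, ← hk, ← ternaryForm_pencilCoeff, ternaryForm, ternaryForm,
      Finset.mul_sum]
    refine Finset.sum_congr rfl fun m _ => ?_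
    rw [MvPolynomial.C_mul_monomial]
    rfl
  · rintro ⟨k, hk, hC⟩
    rw [← C.mk_rep, Projectivization.mk_eq_mk_iff']
    refine ⟨k, funext fun m => ?_⟩
    rw [← coeff_ternaryForm C.rep m, show ternaryForm C.rep = _ from hC, MvPolynomial.coeff_C_mul]
    rfl

/-- Removal of the reparametrization group. The parameter `x 4` is a cross-ratio of the poles; `x 4
≠ 0` and `1 + x 4 ≠ 0` separate the fourth pole from the third and from the second. -/
theorem exists_rationalMatrix_iff_exists_quarticMatrix (G : MvPolynomial (Fin 3) ℂ) :
    (∃ (τ μ : Fin 4 → ℂ) (a b : ℂ), Function.Injective τ ∧ (∀ i, μ i ≠ 0) ∧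
      G = pencilForm η N (rationalMatrix η τ μ a b)) ↔
    ∃ x : Fin 7 → ℂ, (x 0 ≠ 0 ∧ x 1 ≠ 0 ∧ x 2 ≠ 0 ∧ x 3 ≠ 0 ∧ x 4 ≠ 0 ∧ 1 + x 4 ≠ 0) ∧
      G = pencilForm η N (quarticMatrix η x) := by
  have hconj : ∀ (O O' : Matrix (Fin 4) (Fin 4) ℂ) (k : Fin 4 → ℂ), (∀ i, k i ≠ 0) →
      (∀ i j, k i * O i j = O' i j * k j) → pencilForm η N O = pencilForm η N O' := by
    intro O O' k hk h
    rw [pencilForm_complex, pencilForm_complex]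
    refine pencil_eq_of_conj _ _ _ _ _ _ (fun i => MvPolynomial.C (k i))
      (fun i => (map_ne_zero_iff _ (MvPolynomial.C_injective _ _)).2 (hk i)) fun i j => ?_
    rw [Matrix.map_apply, Matrix.map_apply, ← map_mul, ← map_mul, h]
  constructor
  · rintro ⟨τ, μ, a, b, hτ, hμ, rfl⟩
    have hτ' : ∀ i j, i ≠ j → τ i - τ j ≠ 0 := fun i j hij => sub_ne_zero.2 (hτ.ne hij)
    have h10 := hτ' 1 0 (by decide)
    have h20 := hτ' 2 0 (by decide)
    have h30 := hτ' 3 0 (by decide)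
    have h12 := hτ' 1 2 (by decide)
    have h13 := hτ' 1 3 (by decide)
    have h23 := hτ' 2 3 (by decide)
    -- `δ` is chosen so that `δ / (τ 2 - τ 0) - δ / (τ 1 - τ 0) = 1`; then `p` and `r` are forced by
    -- the positions of the poles.
    set δ := (τ 2 - τ 0) * (τ 1 - τ 0) / (τ 1 - τ 2) with hδ
    set p := (τ 2 - τ 0) / (τ 1 - τ 2) with hp
    set r := (τ 1 - τ 0) * (τ 2 - τ 3) / ((τ 1 - τ 2) * (τ 3 - τ 0)) with hr
    have hδ0 : δ ≠ 0 := div_ne_zero (mul_ne_zero h20 h10) h12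
    have hp0 : p ≠ 0 := div_ne_zero h20 h12
    have hr0 : r ≠ 0 := div_ne_zero (mul_ne_zero h10 h23) (mul_ne_zero h12 h30)
    have hp1 : p + 1 = (τ 1 - τ 0) / (τ 1 - τ 2) := by
      rw [hp]
      field_simp
      ring
    have hpr : p + 1 + r = δ / (τ 3 - τ 0) := by
      rw [hp1, hr, hδ]
      field_simp
      ring
    have hr1 : 1 + r = (τ 2 - τ 0) * (τ 1 - τ 3) / ((τ 1 - τ 2) * (τ 3 - τ 0)) := by
      rw [hr]
      field_simp
      ring
    have hp10 : p + 1 ≠ 0 := hp1 ▸ div_ne_zero h10 h12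
    have hpr0 : p + 1 + r ≠ 0 := hpr ▸ div_ne_zero hδ0 h30
    have hr10 : 1 + r ≠ 0 := hr1 ▸ div_ne_zero (mul_ne_zero h20 h13) (mul_ne_zero h12 h30)
    set k₀ := -(μ 0 / δ) with hk0
    set k₁ := -(μ 1 * p ^ 2 / (δ * (r * (1 + r)))) with hk1
    set k₂ := -(μ 2 * (p + 1) ^ 2 / (δ * (r * (1 + r)))) with hk2
    set k₃ := -(μ 3 * (p + 1 + r) ^ 2 / (δ * (r * (1 + r)))) with hk3
    have hτe : ![τ 0, τ 0 + δ / p, τ 0 + δ / (p + 1), τ 0 + δ / (p + 1 + r)] = τ := by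
      have e1 : τ 0 + δ / p = τ 1 := by
        rw [hδ, hp]
        field_simp
        ring
      have e2 : τ 0 + δ / (p + 1) = τ 2 := by
        rw [hδ, hp1]
        field_simp
        ring
      have e3 : τ 0 + δ / (p + 1 + r) = τ 3 := by
        rw [hpr, div_div_cancel₀ hδ0]
        ring
      ext i
      fin_cases i
      · rfl
      · exact e1
      · exact e2
      · exact e3
    have hμe : ![-δ * k₀, -δ * (r * (1 + r) * k₁) / p ^ 2, -δ * (r * (1 + r) * k₂) / (p + 1) ^ 2,
        -δ * (r * (1 + r) * k₃) / (p + 1 + r) ^ 2] = μ := by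
      ext i
      fin_cases i
      · change -δ * k₀ = μ 0
        rw [hk0]
        field_simp
      · change -δ * (r * (1 + r) * k₁) / p ^ 2 = μ 1
        rw [hk1]
        field_simp
      · change -δ * (r * (1 + r) * k₂) / (p + 1) ^ 2 = μ 2
        rw [hk2]
        field_simp
      · change -δ * (r * (1 + r) * k₃) / (p + 1 + r) ^ 2 = μ 3
        rw [hk3]
        field_simp
    have hrr := mul_ne_zero hδ0 (mul_ne_zero hr0 hr10)
    refine ⟨![k₀, k₁, k₂, k₃, r,
      a + r * (1 + r) * (k₁ / p + k₂ / (p + 1) + k₃ / (p + 1 + r)) - p * k₀,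
      b + r * (1 + r) * (η 1 * k₁ / p + η 2 * k₂ / (p + 1) + η 3 * k₃ / (p + 1 + r))
        - η 0 * p * k₀], ⟨?_, ?_, ?_, ?_, hr0, hr10⟩, ?_⟩
    · exact neg_ne_zero.2 (div_ne_zero (hμ 0) hδ0)
    · exact neg_ne_zero.2 (div_ne_zero (mul_ne_zero (hμ 1) (pow_ne_zero _ hp0)) hrr)
    · exact neg_ne_zero.2 (div_ne_zero (mul_ne_zero (hμ 2) (pow_ne_zero _ hp10)) hrr)
    · exact neg_ne_zero.2 (div_ne_zero (mul_ne_zero (hμ 3) (pow_ne_zero _ hpr0)) hrr)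
    · refine hconj _ _ ![-1, 1 / p, 1 / (p + 1), 1 / (p + 1 + r)] ?_ fun i j => ?_
      · intro i
        fin_cases i
        · exact neg_ne_zero.2 one_ne_zero
        · exact one_div_ne_zero hp0
        · exact one_div_ne_zero hp10
        · exact one_div_ne_zero hpr0
      · rw [← conj_rationalMatrix_eq_quarticMatrix η hp0 hp10 hpr0 hr0 hr10 hδ0 (τ 0), hτe, hμe]
        congr 2 <;> ring
  · rintro ⟨x, ⟨h0, h1, h2, h3, h4, h5⟩, rfl⟩
    -- Any `p` outside these three values keeps all four poles finite; `δ = 1` and `τ₀ = 0` are then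
    -- admissible.
    obtain ⟨p, hp⟩ := (Set.toFinite {0, -1, -(1 + x 4)} : Set.Finite {(0 : ℂ), -1, -(1 + x 4)}).exists_notMem
    simp only [Set.mem_insert_iff, Set.mem_singleton_iff, not_or] at hp
    obtain ⟨hp0, hp1, hpr⟩ := hp
    have hp10 : p + 1 ≠ 0 := fun h => hp1 (eq_neg_of_add_eq_zero_left h)
    have hpr0 : p + 1 + x 4 ≠ 0 := fun h => hpr (eq_neg_of_add_eq_zero_left (by rw [← add_assoc, h]))
    have hrr := mul_ne_zero h4 h5
    have hx : ![x 0, x 1, x 2, x 3, x 4, x 5, x 6] = x := by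
      ext i
      fin_cases i <;> rfl
    refine ⟨_, _, _, _, ?_, ?_, (hconj _ _ ![-1, 1 / p, 1 / (p + 1), 1 / (p + 1 + x 4)] ?_ fun i j =>
      (conj_rationalMatrix_eq_quarticMatrix η hp0 hp10 hpr0 h4 h5 one_ne_zero 0 (x 0) (x 1) (x 2) (x 3)
        (x 5) (x 6) i j).trans (by rw [hx])).symm⟩
    · have hinj : ∀ s t : ℂ, (0 : ℂ) + 1 / s = 0 + 1 / t → s = t := fun s t hst => by
        simpa using hst
      have hz : ∀ s : ℂ, s ≠ 0 → (0 : ℂ) ≠ 0 + 1 / s := fun s hs => by simpa using hs.symm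
      intro i j hij
      fin_cases i <;> fin_cases j <;> first | rfl | exfalso
      · exact hz _ hp0 hij
      · exact hz _ hp10 hij
      · exact hz _ hpr0 hij
      · exact hz _ hp0 hij.symm
      · have := hinj _ _ hij
        simp at this
      · have := hinj _ _ hij
        rw [add_assoc] at this
        simp [h5] at this
      · exact hz _ hp10 hij.symm
      · have := hinj _ _ hij
        simp at this
      · have := hinj _ _ hij
        simp [h4] at this
      · exact hz _ hpr0 hij.symm
      · have := hinj _ _ hij
        rw [add_assoc] at this
        simp [h5] at this
      · have := hinj _ _ hij
        simp [h4] at this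
    · intro i
      fin_cases i
      · exact mul_ne_zero (by simp) h0
      · exact div_ne_zero (mul_ne_zero (by simp) (mul_ne_zero hrr h1)) (pow_ne_zero _ hp0)
      · exact div_ne_zero (mul_ne_zero (by simp) (mul_ne_zero hrr h2)) (pow_ne_zero _ hp10)
      · exact div_ne_zero (mul_ne_zero (by simp) (mul_ne_zero hrr h3)) (pow_ne_zero _ hpr0)
    · intro i
      fin_cases i
      · exact neg_ne_zero.2 one_ne_zero
      · exact one_div_ne_zero hp0
      · exact one_div_ne_zero hp10
      · exact one_div_ne_zero hpr0

/-- The universal matrix of the seven-parameter family. -/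
def genericQuarticMatrix (η : Fin 4 → ℂ) : Matrix (Fin 4) (Fin 4) (MvPolynomial (Fin 7) ℂ) :=
  quarticMatrix (fun i => MvPolynomial.C (η i)) MvPolynomial.X

theorem genericQuarticMatrix_map (η : Fin 4 → ℂ) (x : Fin 7 → ℂ) :
    (genericQuarticMatrix η).map (MvPolynomial.aeval x) = quarticMatrix η x := by
  have := map_quarticMatrix (MvPolynomial.aeval (R := ℂ) x).toRingHom
    (fun i => MvPolynomial.C (η i)) MvPolynomial.X
  refine this.trans ?_
  simp

theorem eval_pencilCoeff_genericQuarticMatrix (η : Fin 4 → ℂ) (N : Matrix (Fin 3) (Fin 3) ℂ)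
    (x : Fin 7 → ℂ) (m : PlaneMonomial 4) :
    MvPolynomial.eval x (pencilCoeff η N (genericQuarticMatrix η) m) =
      pencilCoeff η N (quarticMatrix η x) m := by
  rw [← genericQuarticMatrix_map]
  exact map_pencilCoeff η N (MvPolynomial.aeval x) _ m

/-- The locus of degenerate parameters. -/
def degenerateLocus : MvPolynomial (Fin 7) ℂ :=
  MvPolynomial.X 0 * MvPolynomial.X 1 * MvPolynomial.X 2 * MvPolynomial.X 3 * MvPolynomial.X 4 *
    (1 + MvPolynomial.X 4)

theorem eval_degenerateLocus_ne_zero_iff (x : Fin 7 → ℂ) :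
    MvPolynomial.eval x degenerateLocus ≠ 0 ↔
      x 0 ≠ 0 ∧ x 1 ≠ 0 ∧ x 2 ≠ 0 ∧ x 3 ≠ 0 ∧ x 4 ≠ 0 ∧ 1 + x 4 ≠ 0 := by
  simp only [degenerateLocus, map_mul, map_add, map_one, MvPolynomial.eval_X, mul_ne_zero_iff,
    and_assoc]

theorem degenerateLocus_ne_zero : degenerateLocus ≠ 0 := by
  have := (eval_degenerateLocus_ne_zero_iff fun _ => 1).2 (by norm_num)
  rintro h
  rw [h, map_zero] at this
  exact this rfl

/-- The integral rational quartics through four collinear points form a family with seven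
parameters. -/
theorem mem_integralRationalQuartics_iff_exists_parameter {Y : Set ProjPlane}
    (hη : Function.Injective η) (h : N * M = 1)
    (h' : M * N = 1) (hM : ∀ i, M.mulVec ![1, η i, 0] ≠ 0)
    (hY : Y = Set.range fun i => Projectivization.mk ℂ (M.mulVec ![1, η i, 0]) (hM i))
    (C : PlaneCurve 4) : C ∈ integralRationalQuartics Y ↔
      ∃ x : Fin 7 → ℂ, MvPolynomial.eval x degenerateLocus ≠ 0 ∧
        C = Projectivization.mk ℂ (pencilCoeff η N (quarticMatrix η x))
          (pencilCoeff_ne_zero η h _) := by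
  rw [mem_integralRationalQuartics_iff hη h h' hM hY]
  constructor
  · rintro ⟨τ, μ, a, b, k, hτ, hμ, hk, hC⟩
    obtain ⟨x, hx, hxG⟩ := (exists_rationalMatrix_iff_exists_quarticMatrix (η := η) (N := N) _).1
      ⟨τ, μ, a, b, hτ, hμ, rfl⟩
    refine ⟨x, (eval_degenerateLocus_ne_zero_iff x).2 hx,
      (equation_eq_pencilForm_iff h _ C).2 ⟨k, hk, ?_⟩⟩
    rw [← hxG, pencilForm_complex, hC]
  · rintro ⟨x, hx, hC⟩
    obtain ⟨k, hk, hC⟩ := (equation_eq_pencilForm_iff h _ C).1 hC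
    obtain ⟨τ, μ, a, b, hτ, hμ, hG⟩ := (exists_rationalMatrix_iff_exists_quarticMatrix
      (η := η) (N := N) _).2 ⟨x, (eval_degenerateLocus_ne_zero_iff x).1 hx, rfl⟩
    refine ⟨τ, μ, a, b, k, hτ, hμ, hk, ?_⟩
    rw [hC, hG, pencilForm_complex]

end Family

/-! ### Second-order expansion of the determinant at the four points -/

section Jets

/-- The product of the differences `ηᵢ - ηₖ` over the indices `k` different from `i` and `j`. -/
def partialDiscriminant {S : Type*} [CommRing S] (η : Fin 4 → S) (i j : Fin 4) : S :=
  ∏ k, if k = i ∨ k = j then 1 else η i - η k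

theorem Matrix.det_fin_four {S : Type*} [CommRing S] (A : Matrix (Fin 4) (Fin 4) S) : A.det =
    A 0 0 * (A 1 1 * (A 2 2 * A 3 3 - A 2 3 * A 3 2) - A 1 2 * (A 2 1 * A 3 3 - A 2 3 * A 3 1)
      + A 1 3 * (A 2 1 * A 3 2 - A 2 2 * A 3 1)) -
    A 0 1 * (A 1 0 * (A 2 2 * A 3 3 - A 2 3 * A 3 2) - A 1 2 * (A 2 0 * A 3 3 - A 2 3 * A 3 0)
      + A 1 3 * (A 2 0 * A 3 2 - A 2 2 * A 3 0)) +
    A 0 2 * (A 1 0 * (A 2 1 * A 3 3 - A 2 3 * A 3 1) - A 1 1 * (A 2 0 * A 3 3 - A 2 3 * A 3 0)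
      + A 1 3 * (A 2 0 * A 3 1 - A 2 1 * A 3 0)) -
    A 0 3 * (A 1 0 * (A 2 1 * A 3 2 - A 2 2 * A 3 1) - A 1 1 * (A 2 0 * A 3 2 - A 2 2 * A 3 0)
      + A 1 2 * (A 2 0 * A 3 1 - A 2 1 * A 3 0)) := by
  rw [Matrix.det_succ_row_zero]
  simp only [Fin.sum_univ_four, Matrix.det_fin_three, Matrix.submatrix_apply]
  have s0 : ∀ k : Fin 3, (0 : Fin 4).succAbove k = k.succ := fun k => rfl
  have e0 : (Fin.succ (0 : Fin 3)) = (1 : Fin 4) := rfl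
  have e1 : (Fin.succ (1 : Fin 3)) = (2 : Fin 4) := rfl
  have e2 : (Fin.succ (2 : Fin 3)) = (3 : Fin 4) := rfl
  have a0 : (1 : Fin 4).succAbove (0 : Fin 3) = 0 := rfl
  have a1 : (1 : Fin 4).succAbove (1 : Fin 3) = 2 := rfl
  have a2 : (1 : Fin 4).succAbove (2 : Fin 3) = 3 := rfl
  have b0 : (2 : Fin 4).succAbove (0 : Fin 3) = 0 := rfl
  have b1 : (2 : Fin 4).succAbove (1 : Fin 3) = 1 := rfl
  have b2 : (2 : Fin 4).succAbove (2 : Fin 3) = 3 := rfl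
  have c0 : (3 : Fin 4).succAbove (0 : Fin 3) = 0 := rfl
  have c1 : (3 : Fin 4).succAbove (1 : Fin 3) = 1 := rfl
  have c2 : (3 : Fin 4).succAbove (2 : Fin 3) = 2 := rfl
  simp only [s0, e0, e1, e2, a0, a1, a2, b0, b1, b2, c0, c1, c2]
  simp
  ring

/-- At `t = 0` the matrix is diagonal with a single zero, in place `i`. The linear term therefore
sees only `O i i`, and the quadratic term only the principal 2-minors involving `i`; the summand `j
= i` is zero. -/
theorem exists_pencil_eq_add_add {S : Type*} [CommRing S] (η : Fin 4 → S)
    (O : Matrix (Fin 4) (Fin 4) S) (t : S) (i : Fin 4) :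
    ∃ q, pencil η O 1 (η i) t = t * (partialDiscriminant η i i * O i i) +
      t ^ 2 * (∑ j, partialDiscriminant η i j * (O i i * O j j - O i j * O j i)) + t ^ 3 * q := by
  have hA : ∀ a b, (Matrix.diagonal (fun j => η i - η j * 1) + t • O) a b =
      (if a = b then η i - η a else 0) + t * O a b := by
    intro a b
    rw [Matrix.add_apply, Matrix.smul_apply, Matrix.diagonal_apply, mul_one, smul_eq_mul]
  -- The principal 3-minors of `O`, which give the cubic term.
  let m : Fin 4 → Fin 4 → Fin 4 → S := fun a b c => O a a * (O b b * O c c - O b c * O c b) -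
    O a b * (O b a * O c c - O b c * O c a) + O a c * (O b a * O c b - O b b * O c a)
  refine ⟨(η i - η 0) * m 1 2 3 + (η i - η 1) * m 0 2 3 + (η i - η 2) * m 0 1 3 +
    (η i - η 3) * m 0 1 2 + t * O.det, ?_⟩
  rw [pencil, Matrix.det_fin_four, Matrix.det_fin_four, partialDiscriminant]
  simp only [hA, m, partialDiscriminant, Fin.sum_univ_four, Fin.prod_univ_four]
  have d : (0 : Fin 4) ≠ 1 ∧ (0 : Fin 4) ≠ 2 ∧ (0 : Fin 4) ≠ 3 ∧ (1 : Fin 4) ≠ 2 ∧ (1 : Fin 4) ≠ 3 ∧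
    (2 : Fin 4) ≠ 3 := by decide
  obtain ⟨d1, d2, d3, d4, d5, d6⟩ := d
  fin_cases i <;>
  · simp only [Fin.reduceFinMk, Fin.zero_eta, Fin.mk_one, d1, d2, d3, d4, d5, d6, d1.symm, d2.symm,
      d3.symm, d4.symm, d5.symm, d6.symm, if_true, if_false, or_true, or_false]
    ring

/-- The coefficients of the restriction of a quartic form to a parametrized line, as linear forms
on the space of quartic forms. -/
def jetForm (p q : Fin 3 → ℂ) (k : ℕ) : MvPolynomial (PlaneMonomial 4) ℂ :=
  ∑ m, MvPolynomial.C ((∏ l, (Polynomial.C (p l) + Polynomial.C (q l) * Polynomial.X) ^ m.1 l).coeff k)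
    * MvPolynomial.X m

theorem eval_jetForm (p q : Fin 3 → ℂ) (k : ℕ) (c : PlaneMonomial 4 → ℂ) :
    MvPolynomial.eval c (jetForm p q k) = (MvPolynomial.aeval
      (fun l => Polynomial.C (p l) + Polynomial.C (q l) * Polynomial.X) (ternaryForm c)).coeff k := by
  simp only [jetForm, ternaryForm, map_sum, map_mul, MvPolynomial.eval_C, MvPolynomial.eval_X,
    MvPolynomial.aeval_monomial, Polynomial.finsetSum_coeff, Polynomial.algebraMap_eq,
    Polynomial.coeff_C_mul]
  refine Finset.sum_congr rfl fun m _ => ?_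
  rw [Finsupp.prod_fintype _ _ (fun i => pow_zero _), mul_comm]

variable {η : Fin 4 → ℂ} {M N : Matrix (Fin 3) (Fin 3) ℂ}

theorem coeff_pencil_jet (h : N * M = 1) (O : Matrix (Fin 4) (Fin 4) ℂ) (i : Fin 4) :
    MvPolynomial.eval (pencilCoeff η N O)
        (jetForm (M.mulVec ![1, η i, 0]) (M.mulVec ![0, 0, 1]) 1) =
      partialDiscriminant η i i * O i i ∧
    MvPolynomial.eval (pencilCoeff η N O)
        (jetForm (M.mulVec ![1, η i, 0]) (M.mulVec ![0, 0, 1]) 2) =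
      ∑ j, partialDiscriminant η i j * (O i i * O j j - O i j * O j i) := by
  have hx : ∀ l, MvPolynomial.aeval (fun l => Polynomial.C (M.mulVec ![1, η i, 0] l) +
      Polynomial.C (M.mulVec ![0, 0, 1] l) * Polynomial.X) (linearForms N l) =
      ![1, Polynomial.C (η i), Polynomial.X] l := by
    intro l
    have h1 : ∀ v : Fin 3 → ℂ, ∑ j, N l j * M.mulVec v j = v l := fun v => by
      have := congrFun (Matrix.mulVec_mulVec v N M) l
      rw [h, Matrix.one_mulVec] at this
      exact this
    rw [aeval_linearForms]
    simp only [smul_add, Polynomial.smul_C, Finset.sum_add_distrib, smul_eq_mul,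
      ← smul_mul_assoc, ← Finset.sum_mul, ← map_sum, h1]
    fin_cases l <;> simp
  have hF := map_pencil (MvPolynomial.aeval (fun l => Polynomial.C (M.mulVec ![1, η i, 0] l) +
      Polynomial.C (M.mulVec ![0, 0, 1] l) * Polynomial.X)).toRingHom
    (fun i => MvPolynomial.C (η i)) (O.map MvPolynomial.C) (linearForms N 0) (linearForms N 1)
    (linearForms N 2)
  obtain ⟨q, hq⟩ := exists_pencil_eq_add_add (fun i => Polynomial.C (η i)) (O.map Polynomial.C)
    Polynomial.X i
  have hd : ∀ j, partialDiscriminant (fun i => Polynomial.C (η i)) i j =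
      Polynomial.C (partialDiscriminant η i j) := by
    intro j
    simp only [partialDiscriminant, map_prod, apply_ite Polynomial.C, map_one, map_sub]
  have hFq : MvPolynomial.aeval (fun l => Polynomial.C (M.mulVec ![1, η i, 0] l) +
      Polynomial.C (M.mulVec ![0, 0, 1] l) * Polynomial.X) (ternaryForm (pencilCoeff η N O)) =
      Polynomial.X * Polynomial.C (partialDiscriminant η i i * O i i) + Polynomial.X ^ 2 *
        Polynomial.C (∑ j, partialDiscriminant η i j * (O i i * O j j - O i j * O j i)) +
        Polynomial.X ^ 3 * q := by
    rw [ternaryForm_pencilCoeff, pencilForm_complex]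
    refine hF.trans (Eq.trans ?_ (hq.trans ?_))
    · simp only [AlgHom.toRingHom_eq_coe, RingHom.coe_coe, hx, Matrix.map_map, Function.comp_def,
        MvPolynomial.aeval_C, Polynomial.algebraMap_eq]
      rfl
    · simp only [hd, Matrix.map_apply, map_mul, map_sum, map_sub]
  rw [eval_jetForm, eval_jetForm, hFq]
  constructor
  · simp [Polynomial.coeff_X_pow_mul']
  · simp [Polynomial.coeff_X_pow_mul', Polynomial.coeff_X_mul]

end Jets

/-! ### Seven independent functions on the family -/

section Jacobian

variable {η : Fin 4 → ℂ} {M N : Matrix (Fin 3) (Fin 3) ℂ}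

theorem partialDiscriminant_ne_zero (hη : Function.Injective η) (i j : Fin 4) :
    partialDiscriminant η i j ≠ 0 := by
  refine Finset.prod_ne_zero_iff.2 fun k _ => ?_
  split_ifs with h
  · exact one_ne_zero
  · rw [not_or] at h
    exact sub_ne_zero.2 (hη.ne (Ne.symm h.1))

/-- A polynomial in the coefficients of the quartic form that recovers a diagonal entry. -/
def diagonalForm (η : Fin 4 → ℂ) (M : Matrix (Fin 3) (Fin 3) ℂ) (i : Fin 4) :
    MvPolynomial (PlaneMonomial 4) ℂ :=
  MvPolynomial.C (partialDiscriminant η i i)⁻¹ *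
    jetForm (M.mulVec ![1, η i, 0]) (M.mulVec ![0, 0, 1]) 1

/-- A polynomial in the coefficients of the quartic form that recovers a weighted sum of products of
opposite off-diagonal entries. -/
def offDiagonalForm (η : Fin 4 → ℂ) (M : Matrix (Fin 3) (Fin 3) ℂ) (i : Fin 4) :
    MvPolynomial (PlaneMonomial 4) ℂ :=
  ∑ j, MvPolynomial.C (partialDiscriminant η i j) * (diagonalForm η M i * diagonalForm η M j) -
    jetForm (M.mulVec ![1, η i, 0]) (M.mulVec ![0, 0, 1]) 2 -
    MvPolynomial.C (partialDiscriminant η i i) * diagonalForm η M i ^ 2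

theorem eval_diagonalForm (hη : Function.Injective η) (h : N * M = 1)
    (O : Matrix (Fin 4) (Fin 4) ℂ) (i : Fin 4) :
    MvPolynomial.eval (pencilCoeff η N O) (diagonalForm η M i) = O i i := by
  rw [diagonalForm, map_mul, MvPolynomial.eval_C, (coeff_pencil_jet h O i).1,
    inv_mul_cancel_left₀ (partialDiscriminant_ne_zero hη i i)]

/-- Once the diagonal is known, the second-order jet yields a weighted sum of the products `O i j *
O j i` over `j ≠ i`; the subtracted square removes the term `j = i`. -/
theorem eval_offDiagonalForm (hη : Function.Injective η) (h : N * M = 1)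
    (O : Matrix (Fin 4) (Fin 4) ℂ) (i : Fin 4) :
    MvPolynomial.eval (pencilCoeff η N O) (offDiagonalForm η M i) =
      ∑ j, partialDiscriminant η i j * (O i j * O j i) - partialDiscriminant η i i * O i i ^ 2 := by
  simp only [offDiagonalForm, map_sub, map_sum, map_mul, map_pow, MvPolynomial.eval_C,
    eval_diagonalForm hη h, (coeff_pencil_jet h O i).2]
  rw [← Finset.sum_sub_distrib]
  congr 1
  exact Finset.sum_congr rfl fun j _ => by ring

/-- The seven functions on the space of quartic forms used as coordinates on the family. -/
def coordinateForm (η : Fin 4 → ℂ) (M : Matrix (Fin 3) (Fin 3) ℂ) :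
    Fin 7 → MvPolynomial (PlaneMonomial 4) ℂ :=
  ![diagonalForm η M 0, diagonalForm η M 1, diagonalForm η M 2, diagonalForm η M 3,
    offDiagonalForm η M 1, offDiagonalForm η M 2, offDiagonalForm η M 3]

/-- The coordinate functions in terms of the parameters of the family. -/
def coordinateValue {S : Type*} [CommRing S] (η : Fin 4 → S) (x : Fin 7 → S) : Fin 7 → S :=
  ![η 0 * x 5 - x 6,
    η 1 * x 5 - x 6 - (η 1 - η 2) * (x 4 * (1 + x 4) * x 2) - (η 1 - η 3) * (x 4 * x 3),
    η 2 * x 5 - x 6 - (η 2 - η 0) * x 0 + (η 2 - η 1) * (x 4 * (1 + x 4) * x 1)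
        - (η 2 - η 3) * ((1 + x 4) * x 3),
    η 3 * x 5 - x 6 - (η 3 - η 0) * ((1 + x 4) * x 0) + (η 3 - η 1) * (x 4 * x 1)
        + (η 3 - η 2) * ((1 + x 4) * x 2),
    (η 1 - η 0) * (η 1 - η 2) * (η 1 - η 3) * ((η 1 - η 0) * (x 4 * (1 + x 4) * x 0 * x 1) +
      (η 1 - η 2) * (x 4 ^ 2 * (1 + x 4) ^ 2 * x 1 * x 2) + (η 1 - η 3) * (x 4 ^ 2 * x 1 * x 3)),
    (η 2 - η 0) * (η 2 - η 1) * (η 2 - η 3) * ((η 2 - η 0) * (x 4 * (1 + x 4) * x 0 * x 2) +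
      (η 2 - η 1) * (x 4 ^ 2 * (1 + x 4) ^ 2 * x 1 * x 2) +
      (η 2 - η 3) * ((1 + x 4) ^ 2 * x 2 * x 3)),
    (η 3 - η 0) * (η 3 - η 1) * (η 3 - η 2) * ((η 3 - η 0) * (x 4 * (1 + x 4) * x 0 * x 3) +
      (η 3 - η 1) * (x 4 ^ 2 * x 1 * x 3) + (η 3 - η 2) * ((1 + x 4) ^ 2 * x 2 * x 3))]

theorem eval_coordinateForm (hη : Function.Injective η) (h : N * M = 1) (x : Fin 7 → ℂ)
    (i : Fin 7) : MvPolynomial.eval (pencilCoeff η N (quarticMatrix η x)) (coordinateForm η M i) =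
      coordinateValue η x i := by
  fin_cases i
  · exact eval_diagonalForm hη h _ 0
  · exact eval_diagonalForm hη h _ 1
  · exact eval_diagonalForm hη h _ 2
  · exact eval_diagonalForm hη h _ 3
  · refine (eval_offDiagonalForm hη h _ 1).trans ?_
    simp [Fin.sum_univ_four, partialDiscriminant, Fin.prod_univ_four, quarticMatrix, coordinateValue]
    ring
  · refine (eval_offDiagonalForm hη h _ 2).trans ?_
    simp [Fin.sum_univ_four, partialDiscriminant, Fin.prod_univ_four, quarticMatrix, coordinateValue]
    ring
  · refine (eval_offDiagonalForm hη h _ 3).trans ?_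
    simp [Fin.sum_univ_four, partialDiscriminant, Fin.prod_univ_four, quarticMatrix, coordinateValue]
    ring

theorem bind₁_coordinateForm (hη : Function.Injective η) (h : N * M = 1) (i : Fin 7) :
    MvPolynomial.bind₁ (pencilCoeff η N (genericQuarticMatrix η)) (coordinateForm η M i) =
      coordinateValue (fun i => MvPolynomial.C (η i)) MvPolynomial.X i := by
  refine MvPolynomial.funext fun x => ?_
  rw [MvPolynomial.eval_bind₁_apply]
  simp only [eval_pencilCoeff_genericQuarticMatrix]
  refine (eval_coordinateForm hη h x i).trans ?_
  fin_cases i <;> simp [coordinateValue]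

/-- At the point `(1, 0, 0, 0, 1, 0, 0)` the Jacobian matrix is nearly triangular: the last three
rows isolate `v 1`, `v 2`, `v 3`, and the first four then give `v 5`, `v 6`, `v 0`, `v 4`. The point
is degenerate for the family, which does not matter for the nonvanishing of a polynomial. -/
theorem det_jacobian_coordinateValue_ne_zero (hη : Function.Injective η) :
    (Matrix.of fun i j : Fin 7 => MvPolynomial.pderiv j
      (coordinateValue (fun i => MvPolynomial.C (η i)) MvPolynomial.X i)).det ≠ 0 := by
  intro hdet
  have h1 := congrArg (MvPolynomial.eval ![1, 0, 0, 0, 1, 0, 0]) hdet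
  rw [map_zero, RingHom.map_det, ← Matrix.exists_mulVec_eq_zero_iff] at h1
  obtain ⟨v, hv, h1⟩ := h1
  have r0 := congrFun h1 0
  have r1 := congrFun h1 1
  have r2 := congrFun h1 2
  have r3 := congrFun h1 3
  have r4 := congrFun h1 4
  have r5 := congrFun h1 5
  have r6 := congrFun h1 6
  simp [Matrix.mulVec, dotProduct, Fin.sum_univ_succ, coordinateValue, MvPolynomial.pderiv_X,
    Pi.single_apply] at r0 r1 r2 r3 r4 r5 r6
  have hd : ∀ i j, i ≠ j → η i - η j ≠ 0 := fun i j hij => sub_ne_zero.2 (hη.ne hij)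
  have v1 : v 1 = 0 := by
    simpa [hd 1 0 (by decide), hd 1 2 (by decide), hd 1 3 (by decide)] using r4
  have v2 : v 2 = 0 := by
    simpa [hd 2 0 (by decide), hd 2 1 (by decide), hd 2 3 (by decide)] using r5
  have v3 : v 3 = 0 := by
    simpa [hd 3 0 (by decide), hd 3 1 (by decide), hd 3 2 (by decide)] using r6
  rw [v1, v3] at r2
  rw [v1, v2] at r3
  rw [v2, v3] at r1
  have v5 : v 5 = 0 := mul_left_cancel₀ (hd 0 1 (by decide)) (by linear_combination r0 - r1)
  have v6 : v 6 = 0 := by linear_combination η 0 * v5 - r0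
  rw [v5, v6] at r2 r3
  have v0 : v 0 = 0 := mul_left_cancel₀ (hd 0 2 (by decide)) (by linear_combination r2)
  rw [v0] at r3
  have v4 : v 4 = 0 := mul_left_cancel₀ (hd 0 3 (by decide)) (by linear_combination r3)
  refine hv (funext fun i => ?_)
  fin_cases i
  · exact v0
  · exact v1
  · exact v2
  · exact v3
  · exact v4
  · exact v5
  · exact v6

end Jacobian

end

/-! ### Irreducibility and dimension -/

theorem mainTheorem9 (Y : Set ProjPlane) (hcard : Y.ncard = 4)
    (hline : Projectivization.IsCollinear Y) :
    IsIrreducible (integralRationalQuartics Y) ∧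
      topologicalKrullDim (integralRationalQuartics Y) = 7 := by
  obtain ⟨η, M, N, hM, hη, h, h', hY⟩ := exists_coordinates_of_isCollinear Y hcard hline
  have hR := mem_integralRationalQuartics_iff_exists_parameter hη h h' hM hY
  set Φ := pencilCoeff η N (genericQuarticMatrix η) with hΦ
  have hev : ∀ x, (fun m => MvPolynomial.eval x (Φ m)) = pencilCoeff η N (quarticMatrix η x) :=
    fun x => funext fun m => eval_pencilCoeff_genericQuarticMatrix η N x m
  have hl := isHomogeneous_evalForm (M.mulVec ![0, 1, 0])
  have hne : ∀ x, (fun m => MvPolynomial.eval x (Φ m)) ≠ 0 := fun x => by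
    rw [hev]
    exact pencilCoeff_ne_zero η h _
  have hR' : integralRationalQuartics Y = {C | ∃ x, ∃ _ : MvPolynomial.eval x degenerateLocus ≠ 0,
      C = Projectivization.mk ℂ (fun m => MvPolynomial.eval x (Φ m)) (hne x)} := by
    ext C
    rw [hR]
    simp only [hev, exists_prop, Set.mem_ofPred_eq]
  refine ⟨?_, le_antisymm ?_ ?_⟩
  · rw [hR']
    exact isIrreducible_image_of_polynomial Φ _ degenerateLocus_ne_zero fun x _ => hne x
  · refine topologicalKrullDim_le_of_polynomial hl (fun C hC => ?_) Φ fun c hc hc1 hC => ?_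
    · obtain ⟨x, -, rfl⟩ := (hR C).1 hC
      rw [Ne, eval_rep_mk_eq_zero_iff hl, eval_evalForm_pencilCoeff η h]
      exact one_ne_zero
    · obtain ⟨x, -, hx⟩ := (hR _).1 hC
      refine ⟨x, ?_⟩
      rw [hev]
      -- Both representatives take the value 1 at the fifth point of the line, so the scalar `k`
      -- between them is 1.
      obtain ⟨k, hk⟩ := (Projectivization.mk_eq_mk_iff' ℂ _ _ _ _).1 hx
      have h1 := hl.eval_smul k (pencilCoeff η N (quarticMatrix η x))
      rw [hk, hc1, eval_evalForm_pencilCoeff η h, pow_one, mul_one] at h1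
      rw [← hk, ← h1, one_smul]
  · refine le_topologicalKrullDim_of_jacobian hl Φ degenerateLocus degenerateLocus_ne_zero
      (fun x => ?_) (fun x hc hx => ?_) (coordinateForm η M) ?_
    · rw [hev]
      exact eval_evalForm_pencilCoeff η h _
    · rw [hR']
      exact ⟨x, hx, rfl⟩
    · simp only [hΦ, bind₁_coordinateForm hη h]
      exact det_jacobian_coordinateValue_ne_zero hη
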